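/- Let $\mathbb k$ be an algebraically closed field. A locally unital $\mathbb k$-algebra is an associative algebra $A=\bigoplus_{i,j\in I}e_iAe_j$ with a distinguished family $(e_i)_{i\in I}$ of mutually orthogonal idempotents; an $A$-module is a left module $V$ with $V=\bigoplus_{i}e_iV$. A category is *essentially finite Abelian* if it is equivalent to the category of finite-dimensional $A$-modules for some $A$ such that all $e_iA$ and all $Ae_j$ are finite-dimensional. (When moreover there are only finitely many isomorphism classes of irreducible objects, these are the finite Abelian categories, i.e. those equivalent to the finite-dimensional modules over a finite-dimensional algebra.) A category is *Schurian* if it is equivalent to the category of $A$-modules $V$ with $\dim e_iV<\infty$ for all $i$, for some $A$ such that $\dim e_iAe_j<\infty$ for all $i,j$. Let $\mathcal R$ be an Abelian category which is * either essentially finite Abelian, or * Schurian, in which case the poset $\Lambda$ below is assumed to be upper finite (every $\{\nu\in\Lambda: \nu\ge\lambda\}$ is finite). Let $\mathcal R$ be equipped with a stratification $\rho:\mathbf B\to\Lambda$: $\Lambda$ is an interval finite poset, $\mathbf B$ indexes a full set $\{L(b): b\in\mathbf B\}$ of pairwise non-isomorphic irreducible objects of $\mathcal R$, and $\rho$ is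 a function with finite fibers. For $\lambda\in\Lambda$ let $\mathcal R_{\le\lambda}$ (resp. $\mathcal R_{<\lambda}$) be the Serre subcategory of all objects $V$ such that $[V:L(b)]\neq0$ implies $\rho(b)\le\lambda$ (resp. $\rho(b)<\lambda$), let $\mathcal R_\lambda:=\mathcal R_{\le\lambda}/\mathcal R_{<\lambda}$ be the Serre quotient, with quotient functor $j^\lambda:\mathcal R_{\le\lambda}\to\mathcal R_\lambda$; this functor has a left adjoint $j^\lambda_!$ and a right adjoint $j^\lambda_*$. For $b$ with $\rho(b)=\lambda$ let $L_\lambda(b):=j^\lambda L(b)$, let $P_\lambda(b)$ and $I_\lambda(b)$ be a projective cover and an injective hull of $L_\lambda(b)$ in $\mathcal R_\lambda$, and let $$\Delta(b):=j^\lambda_!P_\lambda(b),\quad \bar\Delta(b):=j^\lambda_!L_\lambda(b),\quad \nabla(b):=j^\lambda_*I_\lambda(b),\quad \bar\nabla(b):=j^\lambda_*L_\lambda(b).$$ Let $\varepsilon:\Lambda\to\{\pm\}$ be a function. Put $\Delta_\varepsilon(b):=\Delta(b)$ and $\nabla_\varepsilon(b):=\bar\nabla(b)$ if $\varepsilon(\rho(b))=+$,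 and $\Delta_\varepsilon(b):=\bar\Delta(b)$ and $\nabla_\varepsilon(b):=\nabla(b)$ if $\varepsilon(\rho(b))=-$. A $\Delta_\varepsilon$-flag (resp. $\nabla_\varepsilon$-flag) of an object is a finite filtration all of whose sections are of the form $\Delta_\varepsilon(c)$ (resp. $\nabla_\varepsilon(c)$) for $c\in\mathbf B$. Then the following four conditions are equivalent: * $(\widehat{P\Delta}_\varepsilon)$ for each $b\in\mathbf B$ there is a projective object $P_b$ with a $\Delta_\varepsilon$-flag with $\Delta_\varepsilon(b)$ at the top and other sections $\Delta_\varepsilon(c)$ with $\rho(c)\ge\rho(b)$; * $(\widehat{I\nabla}_\varepsilon)$ for each $b\in\mathbf B$ there is an injective object $I_b$ with a $\nabla_\varepsilon$-flag with $\nabla_\varepsilon(b)$ at the bottom and other sections $\nabla_\varepsilon(c)$ with $\rho(c)\ge\rho(b)$; * $(P\Delta_\varepsilon)$ for each $b\in\mathbf B$ the projective cover $P(b)$ of $L(b)$ exists and has a $\Delta_\varepsilon$-flag with sections $\Delta_\varepsilon(c)$ with $\rho(c)\ge\rho(b)$; * $(I\nabla_\varepsilon)$ for each $b\in\mathbf B$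 the injective hull $I(b)$ of $L(b)$ exists and has a $\nabla_\varepsilon$-flag with sections $\nabla_\varepsilon(c)$ with $\rho(c)\ge\rho(b)$. When they hold, $\mathcal R$ is called $\varepsilon$-stratified (and $\varepsilon$-highest weight if moreover $\rho$ is a bijection), and then $j^\lambda_!$ is exact for every $\lambda$ with $\varepsilon(\lambda)=-$, and $j^\lambda_*$ is exact for every $\lambda$ with $\varepsilon(\lambda)=+$. Moreover, with the same $\rho$ regarded as a stratification of $\mathcal R^{\mathrm{op}}$, $\mathcal R$ is $\varepsilon$-stratified (resp. $\varepsilon$-highest weight) if and only if $\mathcal R^{\mathrm{op}}$ is $(-\varepsilon)$-stratified (resp. $(-\varepsilon)$-highest weight). -/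

import Mathlib

open CategoryTheory CategoryTheory.Limits

universe w v u uB uL

/-! ### Locally unital algebras and their modules -/

/-- A locally unital `k`-algebra: an associative, not necessarily unital algebra with a
distinguished family of mutually orthogonal idempotents `e i` such that
`A = ⨁ i j, e i * A * e j`. (The sum of these subspaces is automatically direct, by orthogonality,
so only the spanning condition has to be imposed.) -/
structure LocallyUnitalAlgebra (k : Type w) [Field k] where
  /-- the underlying type -/
  carrier : Type w
  [ring : NonUnitalRing carrier]
  [module : Module k carrier]
  [isScalarTower : IsScalarTower k carrier carrier]
  [smulCommClass : SMulCommClass k carrier carrier]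
  /-- the set indexing the distinguished idempotents -/
  I : Type w
  /-- the distinguished idempotents -/
  e : I → carrier
  idem : ∀ i, e i * e i = e i
  ortho : ∀ i j, i ≠ j → e i * e j = 0
  span_eq_top : Submodule.span k {x : carrier | ∃ i j a, x = e i * a * e j} = ⊤

attribute [instance] LocallyUnitalAlgebra.ring LocallyUnitalAlgebra.module
  LocallyUnitalAlgebra.isScalarTower LocallyUnitalAlgebra.smulCommClass

namespace LocallyUnitalAlgebra

variable {k : Type w} [Field k] (A : LocallyUnitalAlgebra.{w} k)

/-- The right ideal `e i * A`, as a subspace. -/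
def rightIdeal (i : A.I) : Submodule k A.carrier :=
  LinearMap.range (LinearMap.mulLeft k (A.e i))

/-- The left ideal `A * e j`, as a subspace. -/
def leftIdeal (j : A.I) : Submodule k A.carrier :=
  LinearMap.range (LinearMap.mulRight k (A.e j))

/-- The subspace `e i * A * e j`. -/
def corner (i j : A.I) : Submodule k A.carrier :=
  LinearMap.range (LinearMap.mulLeft k (A.e i) ∘ₗ LinearMap.mulRight k (A.e j))

/-- All subspaces `e i * A * e j` are finite-dimensional. -/
def IsLocallyFiniteDimensional : Prop :=
  ∀ i j, Module.Finite k (A.corner i j)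

/-- All right ideals `e i * A` and all left ideals `A * e j` are finite-dimensional. -/
def IsEssentiallyFiniteDimensional : Prop :=
  (∀ i, Module.Finite k (A.rightIdeal i)) ∧ ∀ j, Module.Finite k (A.leftIdeal j)

/-- A left module `V` over a locally unital algebra, with `V = ⨁ i, e i V`.
(Directness is again automatic.) -/
structure Mod where
  /-- the underlying type -/
  carrier : Type w
  [addCommGroup : AddCommGroup carrier]
  [module : Module k carrier]
  /-- the action of the algebra -/
  act : A.carrier →ₙₐ[k] Module.End k carrier
  iSup_eq_top : ⨆ i, LinearMap.range (act (A.e i)) = ⊤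

attribute [instance] Mod.addCommGroup Mod.module

/-- A homomorphism of modules over a locally unital algebra. -/
@[ext]
structure ModHom (V W : A.Mod) where
  /-- the underlying linear map -/
  toLin : V.carrier →ₗ[k] W.carrier
  map_act : ∀ (a : A.carrier) (x : V.carrier), toLin (V.act a x) = W.act a (toLin x)

instance : Category A.Mod where
  Hom V W := ModHom A V W
  id V := ⟨LinearMap.id, fun _ _ => rfl⟩
  comp f g := ⟨g.toLin ∘ₗ f.toLin, fun a x => by simp [f.map_act, g.map_act]⟩

/-- Finite-dimensional modules. -/
def isFd : ObjectProperty A.Mod := fun V => Module.Finite k V.carrier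

/-- Locally finite-dimensional modules: each `e i V` is finite-dimensional. -/
def isLfd : ObjectProperty A.Mod :=
  fun V => ∀ i, Module.Finite k (LinearMap.range (V.act (A.e i)))

end LocallyUnitalAlgebra

/-- A category is essentially finite Abelian (over `k`) if it is equivalent to the category of
finite-dimensional modules over an essentially finite-dimensional locally unital algebra. -/
def IsEssentiallyFiniteAbelian (k : Type w) [Field k] (R : Type u) [Category.{v} R] : Prop :=
  ∃ A : LocallyUnitalAlgebra.{w} k, A.IsEssentiallyFiniteDimensional ∧
    Nonempty (R ≌ A.isFd.FullSubcategory)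

/-- A category is Schurian (over `k`) if it is equivalent to the category of locally
finite-dimensional modules over a locally finite-dimensional locally unital algebra. -/
def IsSchurian (k : Type w) [Field k] (R : Type u) [Category.{v} R] : Prop :=
  ∃ A : LocallyUnitalAlgebra.{w} k, A.IsLocallyFiniteDimensional ∧
    Nonempty (R ≌ A.isLfd.FullSubcategory)

/-! ### Covers, hulls, subquotients, flags -/

section General

variable {C : Type u} [Category.{v} C]

/-- `f : P ⟶ X` is a projective cover: `P` is projective and `f` is an essential epimorphism. -/
structure IsProjectiveCover {P X : C} (f : P ⟶ X) : Prop where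
  projective : Projective P
  epi : Epi f
  essential : ∀ {Q : C} (g : Q ⟶ P), Epi (g ≫ f) → Epi g

/-- `f : X ⟶ J` is an injective hull: `J` is injective and `f` is an essential monomorphism. -/
structure IsInjectiveHull {X J : C} (f : X ⟶ J) : Prop where
  injective : Injective J
  mono : Mono f
  essential : ∀ {Q : C} (g : J ⟶ Q), Mono (f ≫ g) → Mono g

/-- `X` is (isomorphic to) a subquotient of `V`. -/
def IsSubquotient (X V : C) : Prop :=
  ∃ (Y : C) (i : Y ⟶ V) (p : Y ⟶ X), Mono i ∧ Epi p

/-- `HasFlag Sec l V` means that `V` has a finite filtration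
`0 = V_0 ⊂ V_1 ⊂ ⋯ ⊂ V_n = V` such that, reading the sections `V_m / V_{m-1}` from the top
(`m = n`) to the bottom (`m = 1`), they satisfy `Sec b` for the successive members `b` of
the list `l`. -/
inductive HasFlag [HasZeroMorphisms C] {B : Type uB} (Sec : B → C → Prop) : List B → C → Prop
  | zero {V : C} (h : IsZero V) : HasFlag Sec [] V
  | cons {U V W : C} (i : U ⟶ V) (p : V ⟶ W) (w : i ≫ p = 0)
      (hE : (ShortComplex.mk i p w).ShortExact) {b : B} {l : List B}
      (hU : HasFlag Sec l U) (hW : Sec b W) : HasFlag Sec (b :: l) V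

end General

section Abelian

variable {R : Type u} [Category.{v} R] [Abelian R]

lemma simple_op_of_simple (X : R) [Simple X] : Simple (Opposite.op X) where
  mono_isIso_iff_nonzero {Y} f _ := by
    rw [← isIso_unop_iff f]
    constructor
    · intro h h0
      have h1 : f.unop = 0 := by rw [h0]; rfl
      apply id_nonzero X
      have := IsIso.hom_inv_id f.unop
      generalize inv f.unop = g at this
      rw [h1, zero_comp] at this
      exact this.symm
    · intro h
      have : f.unop ≠ 0 := fun h0 => h (by rw [← f.op_unop, h0]; rfl)
      exact isIso_of_epi_of_nonzero this

lemma simple_unop_of_simple (X : Rᵒᵖ) [Simple X] : Simple X.unop where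
  mono_isIso_iff_nonzero {Y} f _ := by
    rw [← isIso_op_iff f]
    constructor
    · intro h h0
      have h1 : f.op = 0 := by rw [h0]; rfl
      apply id_nonzero X
      have := IsIso.hom_inv_id f.op
      generalize inv f.op = g at this
      rw [h1, zero_comp] at this
      exact this.symm
    · intro h
      have : f.op ≠ 0 := fun h0 => h (by rw [← f.unop_op, h0]; rfl)
      exact isIso_of_epi_of_nonzero this

lemma IsSubquotient.not_isZero {X V : R} [Simple X] (h : IsSubquotient X V) : ¬ IsZero V := by
  obtain ⟨Y, i, p, hi, hp⟩ := h
  intro hV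
  exact Simple.not_isZero X ((hV.of_mono i).of_epi p)

lemma IsSubquotient.iso_of_simple {X V : R} [Simple X] [Simple V] (h : IsSubquotient X V) :
    Nonempty (V ≅ X) := by
  obtain ⟨Y, i, p, hi, hp⟩ := h
  have hi0 : i ≠ 0 := by
    rintro rfl
    exact Simple.not_isZero X ((IsZero.of_mono_zero Y V).of_epi p)
  have := isIso_of_mono_of_nonzero hi0
  have hq : inv i ≫ p ≠ 0 := by
    intro h0
    have : Epi (0 : V ⟶ X) := by rw [← h0]; infer_instance
    exact Simple.not_isZero X (IsZero.of_epi_zero V X)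
  have := isIso_of_epi_of_nonzero hq
  exact ⟨asIso (inv i ≫ p)⟩

/-! ### Serre classes as full subcategories -/

section Serre

variable (P : ObjectProperty R) [P.IsSerreClass]

lemma isClosedUnderFiniteProducts_of_isSerreClass : P.IsClosedUnderFiniteProducts := by
  have : P.IsClosedUnderBinaryProducts :=
    .mk' (by
      rintro X ⟨F, hF⟩
      exact P.prop_of_iso
        ((biprod.isoProd _ _).trans (HasLimit.isoOfNatIso (diagramIsoPair F)).symm)
        (P.prop_biprod (hF ⟨WalkingPair.left⟩) (hF ⟨WalkingPair.right⟩)))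
  exact ObjectProperty.IsClosedUnderFiniteProducts.mk'

lemma preservesFiniteLimits_ι_of_isSerreClass : PreservesFiniteLimits P.ι := by
  have := isClosedUnderFiniteProducts_of_isSerreClass P
  exact (P.ι.preservesFiniteLimits_tfae.out 2 3 :).1 fun _ _ f => P.preservesKernels_ι f

lemma preservesFiniteColimits_ι_of_isSerreClass : PreservesFiniteColimits P.ι := by
  have := isClosedUnderFiniteProducts_of_isSerreClass P
  exact (P.ι.preservesFiniteColimits_tfae.out 2 3 :).1 fun _ _ f => P.preservesCokernels_ι f

end Serre

/-! ### Stratifications -/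

/-- A stratification `ρ : B → Λ` of an abelian category: `Λ` is an interval finite poset, the
`L b` represent the isomorphism classes of irreducible objects (each exactly once), and `ρ` has
finite fibers. -/
structure Stratification (R : Type u) [Category.{v} R] [Abelian R] (B : Type uB) (Λ : Type uL)
    [PartialOrder Λ] where
  /-- the irreducible objects -/
  L : B → R
  simple : ∀ b, Simple (L b)
  injective : ∀ b c, Nonempty (L b ≅ L c) → b = c
  exhaustive : ∀ X : R, Simple X → ∃ b, Nonempty (X ≅ L b)
  /-- the stratification function -/
  ρ : B → Λ
  finite_fibers : ∀ lam, (ρ ⁻¹' {lam}).Finite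
  interval_finite : ∀ lam mu : Λ, (Set.Icc lam mu).Finite

namespace Stratification

variable {B : Type uB} {Λ : Type uL} [PartialOrder Λ] (S : Stratification R B Λ)

/-- The same data, viewed as a stratification of the opposite category. -/
def op : Stratification Rᵒᵖ B Λ where
  L b := Opposite.op (S.L b)
  simple b := by
    have := S.simple b
    exact simple_op_of_simple _
  injective b c h := S.injective b c (h.map fun e => e.unop.symm)
  exhaustive X hX := by
    obtain ⟨b, ⟨e⟩⟩ := S.exhaustive X.unop (simple_unop_of_simple X)
    exact ⟨b, ⟨e.symm.op⟩⟩
  ρ := S.ρ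
  finite_fibers := S.finite_fibers
  interval_finite := S.interval_finite

/-- The objects `V` such that every irreducible `L b` with `[V : L b] ≠ 0`, i.e. every `L b`
that is a subquotient of `V`, has its index in `T`. -/
def serre (T : Set B) : ObjectProperty R :=
  fun V => ∀ b, IsSubquotient (S.L b) V → b ∈ T

instance (T : Set B) : (S.serre T).IsSerreClass where
  exists_zero := ⟨_, isZero_zero R, fun b h => by
    have := S.simple b
    exact (h.not_isZero (isZero_zero R)).elim⟩
  prop_of_mono f _ hY b := by
    rintro ⟨Z, i, p, hi, hp⟩
    exact hY b ⟨Z, i ≫ f, p, inferInstance, hp⟩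
  prop_of_epi f _ hX b := by
    rintro ⟨Z, i, p, hi, hp⟩
    exact hX b ⟨pullback f i, pullback.fst f i, pullback.snd f i ≫ p, inferInstance,
      inferInstance⟩
  prop_X₂_of_shortExact {E} hE h₁ h₃ b := by
    rintro ⟨Z, i, p, hi, hp⟩
    have := S.simple b
    have := hE.mono_f
    by_cases h0 : pullback.snd E.f i ≫ p = 0
    · -- the image of `Z` in `E.X₃` surjects onto `L b`
      have hz : kernel.ι (i ≫ E.g) ≫ p = 0 := by
        have hw : (kernel.ι (i ≫ E.g) ≫ i) ≫ E.g = 0 := by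
          rw [Category.assoc, kernel.condition]
        have : kernel.ι (i ≫ E.g) = pullback.lift (hE.exact.lift _ hw)
            (kernel.ι (i ≫ E.g)) (hE.exact.lift_f _ hw) ≫ pullback.snd E.f i := by
          rw [pullback.lift_snd]
        rw [this, Category.assoc, h0, comp_zero]
      refine h₃ b ⟨Abelian.coimage (i ≫ E.g), Abelian.factorThruCoimage (i ≫ E.g),
        cokernel.desc _ p hz, inferInstance, ?_⟩
      have : Epi (cokernel.π (kernel.ι (i ≫ E.g)) ≫ cokernel.desc _ p hz) := by
        rw [cokernel.π_desc]; exact hp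
      exact epi_of_epi (cokernel.π (kernel.ι (i ≫ E.g))) _
    · exact h₁ b ⟨pullback E.f i, pullback.fst E.f i, pullback.snd E.f i ≫ p, inferInstance,
        epi_of_nonzero_to_simple h0⟩

instance (T : Set B) : (S.serre T).IsClosedUnderFiniteProducts :=
  isClosedUnderFiniteProducts_of_isSerreClass _

instance (T : Set B) : PreservesFiniteLimits (S.serre T).ι :=
  preservesFiniteLimits_ι_of_isSerreClass _

instance (T : Set B) : PreservesFiniteColimits (S.serre T).ι :=
  preservesFiniteColimits_ι_of_isSerreClass _

/-- The Serre subcategory `R_{≤ lam}`. -/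
abbrev Le (lam : Λ) : Type u :=
  (S.serre {b | S.ρ b ≤ lam}).FullSubcategory

/-- The Serre subcategory `R_{< lam}`, as a Serre class in `R_{≤ lam}`. -/
abbrev ltIn (lam : Λ) : ObjectProperty (S.Le lam) :=
  (S.serre {b | S.ρ b < lam}).inverseImage (S.serre {b | S.ρ b ≤ lam}).ι

/-- The stratum `R_lam`: the Serre quotient of `R_{≤ lam}` by `R_{< lam}`. -/
abbrev Stratum (lam : Λ) := (S.ltIn lam).isoModSerre.Localization

/-- The quotient functor `j^lam : R_{≤ lam} ⥤ R_lam`. -/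
abbrev j (lam : Λ) : S.Le lam ⥤ S.Stratum lam := (S.ltIn lam).isoModSerre.Q

/-- The irreducible object `L b`, viewed in `R_{≤ ρ b}`. -/
def LLe (b : B) : S.Le (S.ρ b) :=
  ⟨S.L b, fun c hc => by
    have := S.simple b
    have := S.simple c
    obtain ⟨e⟩ := hc.iso_of_simple
    exact le_of_eq (congrArg S.ρ (S.injective c b ⟨e.symm⟩))⟩

/-- The object `L_lam(b) = j^lam (L b)` of the stratum `R_lam`, for `lam = ρ b`. -/
abbrev LStratum (b : B) : S.Stratum (S.ρ b) := (S.j (S.ρ b)).obj (S.LLe b)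

/-- `X` is isomorphic to `Δ(b) = j^lam_! P_lam(b)`, where `lam = ρ b`, `j^lam_!` is a left adjoint
of `j^lam` and `P_lam(b)` is a projective cover of `L_lam(b)`. -/
def IsStandard (b : B) (X : R) : Prop :=
  ∃ (F : S.Stratum (S.ρ b) ⥤ S.Le (S.ρ b)) (P : S.Stratum (S.ρ b)) (f : P ⟶ S.LStratum b),
    Nonempty (F ⊣ S.j (S.ρ b)) ∧ IsProjectiveCover f ∧ Nonempty (X ≅ (F.obj P).obj)

/-- `X` is isomorphic to the proper standard object `j^lam_! L_lam(b)`, where `lam = ρ b`. -/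
def IsProperStandard (b : B) (X : R) : Prop :=
  ∃ F : S.Stratum (S.ρ b) ⥤ S.Le (S.ρ b),
    Nonempty (F ⊣ S.j (S.ρ b)) ∧ Nonempty (X ≅ (F.obj (S.LStratum b)).obj)

/-- `X` is isomorphic to `∇(b) = j^lam_* I_lam(b)`, where `lam = ρ b`, `j^lam_*` is a right adjoint
of `j^lam` and `I_lam(b)` is an injective hull of `L_lam(b)`. -/
def IsCostandard (b : B) (X : R) : Prop :=
  ∃ (G : S.Stratum (S.ρ b) ⥤ S.Le (S.ρ b)) (J : S.Stratum (S.ρ b)) (f : S.LStratum b ⟶ J),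
    Nonempty (S.j (S.ρ b) ⊣ G) ∧ IsInjectiveHull f ∧ Nonempty (X ≅ (G.obj J).obj)

/-- `X` is isomorphic to the proper costandard object `j^lam_* L_lam(b)`, where `lam = ρ b`. -/
def IsProperCostandard (b : B) (X : R) : Prop :=
  ∃ G : S.Stratum (S.ρ b) ⥤ S.Le (S.ρ b),
    Nonempty (S.j (S.ρ b) ⊣ G) ∧ Nonempty (X ≅ (G.obj (S.LStratum b)).obj)

/-! Sign functions take values in `ℤˣ = {1, -1}`. -/

/-- `X` is isomorphic to `Δ_ε(b)`: standard if `ε (ρ b) = +`, proper standard if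
`ε (ρ b) = -`. -/
def IsEpsStandard (ε : Λ → ℤˣ) (b : B) (X : R) : Prop :=
  (ε (S.ρ b) = 1 ∧ S.IsStandard b X) ∨ (ε (S.ρ b) = -1 ∧ S.IsProperStandard b X)

/-- `X` is isomorphic to `∇_ε(b)`: proper costandard if `ε (ρ b) = +`, costandard if
`ε (ρ b) = -`. -/
def IsEpsCostandard (ε : Λ → ℤˣ) (b : B) (X : R) : Prop :=
  (ε (S.ρ b) = 1 ∧ S.IsProperCostandard b X) ∨ (ε (S.ρ b) = -1 ∧ S.IsCostandard b X)

/-- For each `b` there is a projective object with a `Δ_ε`-flag having `Δ_ε(b)` at the top and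
other sections `Δ_ε(c)` with `ρ c ≥ ρ b`. -/
def HatPDelta (ε : Λ → ℤˣ) : Prop :=
  ∀ b, ∃ (P : R) (l : List B), Projective P ∧ HasFlag (S.IsEpsStandard ε) (b :: l) P ∧
    ∀ c ∈ l, S.ρ b ≤ S.ρ c

/-- For each `b` there is an injective object with a `∇_ε`-flag having `∇_ε(b)` at the bottom and
other sections `∇_ε(c)` with `ρ c ≥ ρ b`. -/
def HatINabla (ε : Λ → ℤˣ) : Prop :=
  ∀ b, ∃ (J : R) (l : List B), Injective J ∧ HasFlag (S.IsEpsCostandard ε) (l ++ [b]) J ∧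
    ∀ c ∈ l, S.ρ b ≤ S.ρ c

/-- For each `b` the irreducible `L b` has a projective cover `P(b)` with a `Δ_ε`-flag whose
sections are `Δ_ε(c)` with `ρ c ≥ ρ b`. -/
def PDelta (ε : Λ → ℤˣ) : Prop :=
  ∀ b, ∃ (P : R) (f : P ⟶ S.L b) (l : List B), IsProjectiveCover f ∧
    HasFlag (S.IsEpsStandard ε) l P ∧ ∀ c ∈ l, S.ρ b ≤ S.ρ c

/-- For each `b` the irreducible `L b` has an injective hull `I(b)` with a `∇_ε`-flag whose
sections are `∇_ε(c)` with `ρ c ≥ ρ b`. -/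
def INabla (ε : Λ → ℤˣ) : Prop :=
  ∀ b, ∃ (J : R) (f : S.L b ⟶ J) (l : List B), IsInjectiveHull f ∧
    HasFlag (S.IsEpsCostandard ε) l J ∧ ∀ c ∈ l, S.ρ b ≤ S.ρ c

/-- `R` is `ε`-stratified. (The condition chosen here is one of the four conditions
`HatPDelta`, `HatINabla`, `PDelta`, `INabla`.) -/
def IsEpsStratified (ε : Λ → ℤˣ) : Prop := S.HatPDelta ε

/-- `R` is `ε`-highest weight: `ε`-stratified, with a bijective stratification function. -/
def IsEpsHighestWeight (ε : Λ → ℤˣ) : Prop :=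
  Function.Bijective S.ρ ∧ S.IsEpsStratified ε

end Stratification

end Abelian

/-! ### Vanishing of first extensions, without Ext groups. -/

section ExtVanish

variable {A : Type u} [Category.{v} A] [Abelian A]

/-! Write Ext¹(X, V) = 0 when every extension of X by V splits (`ExtVanish`). The adjoints are
eliminated first: Δ_ε(b) is the object with simple head L(b), with radical having all its factors
indexed by a set T, and with no extensions by objects whose factors are indexed by T. Here T is {ρ ≤
ρ b} for the sign + and {ρ < ρ b} for the sign − (`isEpsStandard_iff`). The description of ∇_ε(b) is
dual, with the opposite sign (`isEpsCostandard_iff`), so passing to the opposite category and to −ε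
exchanges the two families, and every statement comes with its dual.

The heart is `HatPDelta.iNabla`. The kernel K of P_b → Δ_ε(b) is filtered by objects Δ_ε(c) with ρ c
≥ ρ b. Comparing heads gives Hom(K, V) = 0, hence Ext¹(Δ_ε(b), V) = 0, whenever V has no factor L(d)
with ρ d ≥ ρ b. Together with the defining vanishing properties this yields Ext¹(Δ_ε(b), ∇_ε(c)) = 0
for all b, c (`HatPDelta.extVanish_costd`), and Ext² vanishes too, by dimension shifting along K.

Now let V be nonzero with Ext¹(Δ_ε(d), V) = 0 for all d, and with nonzero maps Δ_ε(d) → V only for ρ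
d ≥ lam. Choose mu minimal among the ρ d that occur. The largest subobject of V in R_{≤ mu} has no
subobject in R_{< mu}, so it contains some L(c) with ρ c = mu, and this inclusion extends to an
embedding of ∇_ε(c) (`HatPDelta.exists_costd_sub`). The vanishing of Ext² lets V/∇_ε(c) inherit the
hypotheses. An additive measure that is positive on all L(c) with ρ c ≥ lam replaces length and ends
the process (`HatPDelta.exists_costd_flag`). The injective hull of L(b) satisfies the hypotheses
with lam = ρ b.

Exactness of j_! for the sign − amounts to this: kernels of epimorphisms between objects without
maps to, or extensions by, R_{< mu} are again such objects (`HatPDelta.kernelClosed`). The same Ext²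
vanishing proves it.

All finiteness is collected in `IsFinitary`. It is verified for modules through the dimensions of
the weight spaces e_i V, with a Fitting argument for projective covers. -/

lemma shortExact_of_lift {X Y Z : A} (i : X ⟶ Y) (p : Y ⟶ Z) (w : i ≫ p = 0) [Mono i] [Epi p]
    (h : ∀ {T : A} (t : T ⟶ Y), t ≫ p = 0 → ∃ l : T ⟶ X, l ≫ i = t) :
    (ShortComplex.mk i p w).ShortExact where
  exact := by
    refine ShortComplex.exact_of_f_is_kernel _
      (KernelFork.IsLimit.ofι' i w fun t ht => ⟨(h t ht).choose, (h t ht).choose_spec⟩)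
  mono_f := ‹_›
  epi_g := ‹_›

lemma shortExact_of_desc {X Y Z : A} (i : X ⟶ Y) (p : Y ⟶ Z) (w : i ≫ p = 0) [Mono i] [Epi p]
    (h : ∀ {T : A} (t : Y ⟶ T), i ≫ t = 0 → ∃ l : Z ⟶ T, p ≫ l = t) :
    (ShortComplex.mk i p w).ShortExact where
  exact := by
    refine ShortComplex.exact_of_g_is_cokernel _
      (CokernelCofork.IsColimit.ofπ' p w fun t ht => ⟨(h t ht).choose, (h t ht).choose_spec⟩)
  mono_f := ‹_›
  epi_g := ‹_›

lemma CategoryTheory.ShortComplex.ShortExact.exists_lift {X Y Z T : A} {i : X ⟶ Y} {p : Y ⟶ Z}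
    {w : i ≫ p = 0} (h : (ShortComplex.mk i p w).ShortExact) (t : T ⟶ Y) (ht : t ≫ p = 0) :
    ∃ l : T ⟶ X, l ≫ i = t :=
  have := h.mono_f
  ⟨h.exact.lift t ht, h.exact.lift_f t ht⟩

lemma CategoryTheory.ShortComplex.ShortExact.exists_desc {X Y Z T : A} {i : X ⟶ Y} {p : Y ⟶ Z}
    {w : i ≫ p = 0} (h : (ShortComplex.mk i p w).ShortExact) (t : Y ⟶ T) (ht : i ≫ t = 0) :
    ∃ l : Z ⟶ T, p ≫ l = t :=
  have := h.epi_g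
  ⟨h.exact.desc t ht, h.exact.g_desc t ht⟩

lemma shortExact_kernel {X Y : A} (f : X ⟶ Y) [Epi f] :
    (ShortComplex.mk (kernel.ι f) f (kernel.condition f)).ShortExact :=
  shortExact_of_lift _ _ _ fun t ht => ⟨kernel.lift _ t ht, kernel.lift_ι _ _ _⟩

lemma shortExact_cokernel {X Y : A} (f : X ⟶ Y) [Mono f] :
    (ShortComplex.mk f (cokernel.π f) (cokernel.condition f)).ShortExact :=
  shortExact_of_desc _ _ _ fun t ht => ⟨cokernel.desc _ t ht, cokernel.π_desc _ _ _⟩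

lemma CategoryTheory.ShortComplex.ShortExact.exists_pullback {V U W X : A} {i : V ⟶ U} {p : U ⟶ W}
    {w : i ≫ p = 0} (hE : (ShortComplex.mk i p w).ShortExact) (g : X ⟶ W) :
    ∃ (i' : V ⟶ pullback g p) (w' : i' ≫ pullback.fst g p = 0),
      (ShortComplex.mk i' (pullback.fst g p) w').ShortExact ∧ i' ≫ pullback.snd g p = i := by
  have := hE.mono_f
  have : Epi p := hE.epi_g
  obtain ⟨i', h1, h2⟩ : ∃ i' : V ⟶ pullback g p,
      i' ≫ pullback.fst g p = 0 ∧ i' ≫ pullback.snd g p = i :=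
    ⟨pullback.lift 0 i (by rw [w, zero_comp]), pullback.lift_fst _ _ _, pullback.lift_snd _ _ _⟩
  have hm : Mono i' := by
    have : Mono (i' ≫ pullback.snd g p) := by rw [h2]; infer_instance
    exact mono_of_mono _ (pullback.snd g p)
  refine ⟨i', h1, shortExact_of_lift _ _ _ fun t ht => ?_, h2⟩
  obtain ⟨l, hl⟩ := hE.exists_lift (t ≫ pullback.snd g p) (by
    rw [Category.assoc, ← pullback.condition, reassoc_of% ht, zero_comp])
  exact ⟨l, by ext <;> simp [ht, hl, h1, h2]⟩

/-- Every extension of `X` by `V` splits. -/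
def ExtVanish (X V : A) : Prop :=
  ∀ ⦃E : A⦄ (i : V ⟶ E) (p : E ⟶ X) (w : i ≫ p = 0), (ShortComplex.mk i p w).ShortExact →
    ∃ s : X ⟶ E, s ≫ p = 𝟙 X

namespace ExtVanish

variable {X V : A}

lemma exists_retraction (h : ExtVanish X V) {E : A} (i : V ⟶ E) (p : E ⟶ X) (w : i ≫ p = 0)
    (hE : (ShortComplex.mk i p w).ShortExact) : ∃ r : E ⟶ V, i ≫ r = 𝟙 V := by
  obtain ⟨s, hs⟩ := h i p w hE
  have := hE.mono_f
  obtain ⟨r, hr⟩ := hE.exists_lift (𝟙 E - p ≫ s) (by simp [hs])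
  refine ⟨r, ?_⟩
  rw [← cancel_mono i]
  simp [hr, reassoc_of% w]

lemma of_retraction
    (h : ∀ {E : A} (i : V ⟶ E) (p : E ⟶ X) (w : i ≫ p = 0),
      (ShortComplex.mk i p w).ShortExact → ∃ r : E ⟶ V, i ≫ r = 𝟙 V) : ExtVanish X V := by
  intro E i p w hE
  obtain ⟨r, hr⟩ := h i p w hE
  have := hE.epi_g
  obtain ⟨s, hs⟩ := hE.exists_desc (𝟙 E - r ≫ i) (by simp [reassoc_of% hr])
  refine ⟨s, ?_⟩
  rw [← cancel_epi p]
  simp [reassoc_of% hs, w]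

/-- A lift of `g` is a splitting of the extension pulled back along `g`. -/
lemma lift (h : ExtVanish X V) {U W : A} {i : V ⟶ U} {p : U ⟶ W} {w : i ≫ p = 0}
    (hE : (ShortComplex.mk i p w).ShortExact) (g : X ⟶ W) : ∃ l : X ⟶ U, l ≫ p = g := by
  obtain ⟨i', w', hS, -⟩ := hE.exists_pullback g
  obtain ⟨s, hs⟩ := h i' (pullback.fst g p) w' hS
  exact ⟨s ≫ pullback.snd g p, by rw [Category.assoc, ← pullback.condition, reassoc_of% hs]⟩

/-- Dually, an extension of `g` to `W` is a retraction of the extension pushed out along `g`. -/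
lemma extend (h : ExtVanish X V) {U W : A} {i : U ⟶ W} {p : W ⟶ X} {w : i ≫ p = 0}
    (hE : (ShortComplex.mk i p w).ShortExact) (g : U ⟶ V) : ∃ l : W ⟶ V, i ≫ l = g := by
  have : Mono i := hE.mono_f
  have := hE.epi_g
  obtain ⟨p', h1, h2⟩ : ∃ p' : pushout g i ⟶ X,
      pushout.inl g i ≫ p' = 0 ∧ pushout.inr g i ≫ p' = p :=
    ⟨pushout.desc 0 p (by rw [w, comp_zero]), pushout.inl_desc _ _ _, pushout.inr_desc _ _ _⟩
  have hm : Epi p' := by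
    have : Epi (pushout.inr g i ≫ p') := by rw [h2]; infer_instance
    exact epi_of_epi (pushout.inr g i) _
  obtain ⟨s, hs⟩ := h.exists_retraction (pushout.inl g i) p' h1
    (shortExact_of_desc _ _ _ fun t ht => by
      obtain ⟨l, hl⟩ := hE.exists_desc (pushout.inr g i ≫ t) (by
        rw [← pushout.condition_assoc, ht, comp_zero])
      exact ⟨l, by ext <;> simp [ht, hl, reassoc_of% h1, reassoc_of% h2]⟩)
  exact ⟨pushout.inr g i ≫ s, by rw [← pushout.condition_assoc, hs, Category.comp_id]⟩

lemma op (h : ExtVanish X V) : ExtVanish (Opposite.op V) (Opposite.op X) := by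
  intro E i p w hE
  obtain ⟨r, hr⟩ := h.exists_retraction p.unop i.unop (Quiver.Hom.op_inj w) hE.unop
  exact ⟨r.op, Quiver.Hom.unop_inj hr⟩

lemma unop {X V : Aᵒᵖ} (h : ExtVanish X V) : ExtVanish V.unop X.unop := by
  intro E i p w hE
  obtain ⟨r, hr⟩ := h.exists_retraction p.op i.op (Quiver.Hom.unop_inj w) hE.op
  exact ⟨r.unop, Quiver.Hom.op_inj hr⟩

lemma of_projective [Projective X] : ExtVanish X V := fun _ _ p _ hE =>
  have := hE.epi_g
  ⟨Projective.factorThru (𝟙 X) p, Projective.factorThru_comp _ _⟩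

lemma of_injective [Injective V] : ExtVanish X V := of_retraction fun i _ _ hE =>
  have := hE.mono_f
  ⟨Injective.factorThru (𝟙 V) i, Injective.comp_factorThru _ _⟩

lemma of_retract (h : ExtVanish X V) {Y : A} (s : Y ⟶ X) (r : X ⟶ Y) (hs : s ≫ r = 𝟙 Y) :
    ExtVanish Y V := fun E i p w hE => by
  obtain ⟨l, hl⟩ := h.lift hE r
  exact ⟨s ≫ l, by rw [Category.assoc, hl, hs]⟩

lemma of_iso_left (h : ExtVanish X V) {Y : A} (e : X ≅ Y) : ExtVanish Y V :=
  h.of_retract e.inv e.hom e.inv_hom_id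

lemma of_isZero_left (h : IsZero X) : ExtVanish X V := fun _ _ _ _ _ =>
  ⟨0, h.eq_of_src _ _⟩

/-- Extension closure in the first argument. -/
lemma middle_left {U K W : A} {a : U ⟶ K} {b : K ⟶ W} {w : a ≫ b = 0}
    (hK : (ShortComplex.mk a b w).ShortExact) (hU : ExtVanish U V) (hW : ExtVanish W V) :
    ExtVanish K V := of_retraction fun {E} i p wE hE => by
  have := hE.mono_f
  have : Epi p := hE.epi_g
  have : Mono a := hK.mono_f
  have : Epi b := hK.epi_g
  -- The pullback is the preimage of `U` in `E`, an extension of `U` by `V`. A retraction found on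
  -- it extends to `E`, because the quotient of `E` by it is `W`.
  obtain ⟨i', h1, h2⟩ : ∃ i' : V ⟶ pullback p a,
      i' ≫ pullback.fst p a = i ∧ i' ≫ pullback.snd p a = 0 :=
    ⟨pullback.lift i 0 (by rw [wE, zero_comp]), pullback.lift_fst _ _ _, pullback.lift_snd _ _ _⟩
  have hm : Mono i' := by
    have : Mono (i' ≫ pullback.fst p a) := by rw [h1]; infer_instance
    exact mono_of_mono _ (pullback.fst p a)
  obtain ⟨r, hr⟩ := hU.exists_retraction i' (pullback.snd p a) h2
    (shortExact_of_lift _ _ _ fun t ht => by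
      obtain ⟨l, hl⟩ := hE.exists_lift (t ≫ pullback.fst p a) (by
        rw [Category.assoc, pullback.condition, reassoc_of% ht, zero_comp])
      exact ⟨l, by ext <;> simp [ht, hl, h1, h2]⟩)
  have hS : (ShortComplex.mk (pullback.fst p a) (p ≫ b)
      (by rw [pullback.condition_assoc, w, comp_zero])).ShortExact :=
    shortExact_of_lift _ _ _ fun t ht => by
      obtain ⟨l, hl⟩ := hK.exists_lift (t ≫ p) (by rwa [Category.assoc])
      exact ⟨pullback.lift t l hl.symm, pullback.lift_fst _ _ _⟩
  obtain ⟨l, hl⟩ := hW.extend hS r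
  exact ⟨l, by rw [← h1, Category.assoc, hl, hr]⟩

/-- The segment Hom(X, V₂) → Ext¹(X, V₁) → Ext¹(X, V) of the long exact sequence. -/
lemma of_hom_eq_zero_right (h : ExtVanish X V) {V₁ V₂ : A} {a : V₁ ⟶ V} {b : V ⟶ V₂}
    {w : a ≫ b = 0} (hV : (ShortComplex.mk a b w).ShortExact) (h0 : ∀ f : X ⟶ V₂, f = 0) :
    ExtVanish X V₁ := of_retraction fun i p wE hE => by
  have := hV.mono_f
  obtain ⟨g, hg⟩ := h.extend hE a
  obtain ⟨t, ht⟩ := hE.exists_desc (g ≫ b) (by rw [reassoc_of% hg, w])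
  obtain ⟨r, hr⟩ := hV.exists_lift g (by rw [← ht, h0 t, comp_zero])
  refine ⟨r, ?_⟩
  have : Mono a := hV.mono_f
  rw [← cancel_mono a, Category.assoc, hr, hg, Category.id_comp]

/-- The segment Hom(K, V) → Ext¹(X, V) → Ext¹(P, V) of the long exact sequence. -/
lemma of_hom_eq_zero_left {P K : A} (h : ExtVanish P V) {a : K ⟶ P} {b : P ⟶ X}
    {w : a ≫ b = 0} (hP : (ShortComplex.mk a b w).ShortExact) (h0 : ∀ f : K ⟶ V, f = 0) :
    ExtVanish X V := fun E i p wE hE => by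
  obtain ⟨g, hg⟩ := h.lift hE b
  obtain ⟨t, ht⟩ := hE.exists_lift (a ≫ g) (by rw [Category.assoc, hg, w])
  obtain ⟨r, hr⟩ := hP.exists_desc g (by rw [← ht, h0 t, zero_comp])
  refine ⟨r, ?_⟩
  have : Epi b := hP.epi_g
  rw [← cancel_epi b, reassoc_of% hr, hg, Category.comp_id]

/-- If the syzygy `K` of `X` has no extensions by `V₁`, then vanishing passes to the quotient
`V₂` of `V` by `V₁`. -/
lemma quotient_right (h : ExtVanish X V) {K P : A} [Projective P] {k : K ⟶ P} {q : P ⟶ X}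
    {wk : k ≫ q = 0} (hP : (ShortComplex.mk k q wk).ShortExact)
    {V₁ V₂ : A} {a : V₁ ⟶ V} {b : V ⟶ V₂}
    {w : a ≫ b = 0} (hV : (ShortComplex.mk a b w).ShortExact) (hK : ExtVanish K V₁) :
    ExtVanish X V₂ := fun E i p wE hE => by
  have := hE.epi_g
  have : Epi q := hP.epi_g
  dsimp at *
  -- The map `m : K ⟶ V₂` represents the class of `E`. It lifts to `V` because `K` has no extensions
  -- by `V₁`; the lift extends to `P` because `X` has none by `V`; subtracting the result makes `P ⟶
  -- E` vanish on `K`.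
  obtain ⟨m, hm⟩ := hE.exists_lift (k ≫ Projective.factorThru q p) (by simp [wk])
  obtain ⟨n, hn⟩ := hK.lift hV m
  obtain ⟨n', hn'⟩ := h.extend hP n
  obtain ⟨s, hs⟩ := hP.exists_desc (Projective.factorThru q p - n' ≫ b ≫ i) (by
    rw [Preadditive.comp_sub, ← hm, reassoc_of% hn', reassoc_of% hn, sub_self])
  refine ⟨s, ?_⟩
  rw [← cancel_epi q, reassoc_of% hs]
  simp [wE]

/-- If the syzygy `K` of `D` has no extensions by `V`, then vanishing passes from `Z` to the
kernel of an epimorphism `Z ⟶ D`. -/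
lemma kernel_left {Z Z' D K P : A} (h : ExtVanish Z V) [Projective P] {k : K ⟶ P} {q : P ⟶ D}
    {wk : k ≫ q = 0} (hP : (ShortComplex.mk k q wk).ShortExact)
    {a : Z' ⟶ Z} {b : Z ⟶ D} {w : a ≫ b = 0} (hZ : (ShortComplex.mk a b w).ShortExact)
    (hK : ExtVanish K V) : ExtVanish Z' V := by
  have : Mono k := hP.mono_f
  have : Epi q := hP.epi_g
  have : Mono a := hZ.mono_f
  have : Epi b := hZ.epi_g
  -- Comparing the two presentations of `D` gives an exact sequence 0 → K → Z' ⊞ P → Z → 0. Its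
  -- middle term has no extensions by `V`, and `Z'` is a summand of it.
  obtain ⟨t, ht⟩ : ∃ t : P ⟶ Z, t ≫ b = q := ⟨_, Projective.factorThru_comp q b⟩
  obtain ⟨u, hu⟩ := hZ.exists_lift (k ≫ t) (by rw [Category.assoc, ht, wk])
  have hm : Mono (biprod.lift u (-k)) := by
    have : Mono (biprod.lift u (-k) ≫ biprod.snd) := by rw [biprod.lift_snd]; infer_instance
    exact mono_of_mono _ biprod.snd
  have hepi : Epi (biprod.desc a t) := by
    refine Preadditive.epi_of_cancel_zero _ fun c hc => ?_
    have h1 : a ≫ c = 0 := by simpa using biprod.inl ≫= hc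
    have h2 : t ≫ c = 0 := by simpa using biprod.inr ≫= hc
    obtain ⟨c', rfl⟩ := hZ.exists_desc c h1
    have : c' = 0 := by rw [← cancel_epi q, ← ht, Category.assoc, h2, comp_zero]
    rw [this, comp_zero]
  have hS : (ShortComplex.mk (biprod.lift u (-k)) (biprod.desc a t) (by simp [hu])).ShortExact :=
    shortExact_of_lift _ _ _ fun s hs => by
      have h1 : (s ≫ biprod.fst) ≫ a + (s ≫ biprod.snd) ≫ t = 0 := by
        rw [← hs]; simp [biprod.desc_eq]
      obtain ⟨l, hl⟩ := hP.exists_lift (s ≫ biprod.snd) (by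
        have := h1 =≫ b
        simpa [w, ht] using this)
      refine ⟨-l, ?_⟩
      ext
      · rw [← cancel_mono a]
        rw [← hl] at h1
        simp only [Category.assoc, biprod.lift_fst, Preadditive.neg_comp, hu] at h1 ⊢
        rw [eq_neg_of_add_eq_zero_left h1]
      · simp [hl]
  exact (middle_left hS hK h).of_retract biprod.inl biprod.fst biprod.inl_fst

end ExtVanish

end ExtVanish

/-! ### Serre quotients, closed objects and the left adjoint of the quotient functor. -/

section SerreQuotient

section Essential

variable {A : Type u} [Category.{v} A]

/-- `f` is an essential epimorphism. -/
structure EssEpi {X Y : A} (f : X ⟶ Y) : Prop where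
  epi : Epi f
  essential : ∀ {Q : A} (g : Q ⟶ X), Epi (g ≫ f) → Epi g

/-- `f` is an essential monomorphism. -/
structure EssMono {X Y : A} (f : X ⟶ Y) : Prop where
  mono : Mono f
  essential : ∀ {Q : A} (g : Y ⟶ Q), Mono (f ≫ g) → Mono g

lemma EssEpi.op {X Y : A} {f : X ⟶ Y} (h : EssEpi f) : EssMono f.op where
  mono := have := h.epi; inferInstance
  essential g hg := by
    have := h.essential g.unop ((op_mono_iff (g.unop ≫ f)).1 hg)
    exact (unop_epi_iff g).1 this

lemma EssMono.op {X Y : A} {f : X ⟶ Y} (h : EssMono f) : EssEpi f.op where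
  epi := have := h.mono; inferInstance
  essential g hg := by
    have := h.essential g.unop ((op_epi_iff (f ≫ g.unop)).1 hg)
    exact (unop_mono_iff g).1 this

lemma EssEpi.unop {X Y : Aᵒᵖ} {f : X ⟶ Y} (h : EssEpi f) : EssMono f.unop where
  mono := have := h.epi; inferInstance
  essential g hg := by
    have := h.essential g.op ((unop_mono_iff (g.op ≫ f)).1 hg)
    exact (op_epi_iff g).1 this

lemma EssMono.unop {X Y : Aᵒᵖ} {f : X ⟶ Y} (h : EssMono f) : EssEpi f.unop where
  epi := have := h.mono; inferInstance
  essential g hg := by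
    have := h.essential g.op ((unop_epi_iff (f ≫ g.op)).1 hg)
    exact (op_mono_iff g).1 this

end Essential

variable {A : Type u} [Category.{v} A] [Abelian A]

variable (N : ObjectProperty A)

/-- Objects without maps to, or extensions by, objects of `N`. -/
structure LeftClosed (X : A) : Prop where
  hom_eq_zero : ∀ {V : A}, N V → ∀ f : X ⟶ V, f = 0
  ext : ∀ {V : A}, N V → ExtVanish X V

/-- Objects without maps from, or extensions of, objects of `N`. -/
structure RightClosed (X : A) : Prop where
  hom_eq_zero : ∀ {V : A}, N V → ∀ f : V ⟶ X, f = 0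
  ext : ∀ {V : A}, N V → ExtVanish V X

variable {N}

lemma RightClosed.op {X : A} (h : RightClosed N X) : LeftClosed N.op (Opposite.op X) where
  hom_eq_zero hV f := Quiver.Hom.unop_inj (h.hom_eq_zero hV f.unop)
  ext hV := (h.ext hV).op

lemma LeftClosed.unop {X : Aᵒᵖ} (h : LeftClosed N.op X) : RightClosed N X.unop where
  hom_eq_zero {V} hV f := Quiver.Hom.op_inj (h.hom_eq_zero (V := Opposite.op V) hV f.op)
  ext {V} hV := (h.ext (V := Opposite.op V) hV).unop

lemma LeftClosed.of_iso {X Y : A} (h : LeftClosed N X) (e : X ≅ Y) : LeftClosed N Y where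
  hom_eq_zero hV f := by
    rw [← cancel_epi e.hom, h.hom_eq_zero hV (e.hom ≫ f), comp_zero]
  ext hV := (h.ext hV).of_iso_left e

variable (N) [N.IsSerreClass]

instance isSerreClass_op : N.op.IsSerreClass where
  prop_of_mono f _ h := N.prop_of_epi f.unop h
  prop_of_epi f _ h := N.prop_of_mono f.unop h
  prop_X₂_of_shortExact h h₁ h₃ := N.prop_X₂_of_shortExact h.unop h₃ h₁

lemma isoModSerre_op : N.op.isoModSerre = N.isoModSerre.op := by
  ext X Y f
  rw [show N.isoModSerre.op f ↔ N.isoModSerre f.unop from Iff.rfl]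
  simp only [ObjectProperty.isoModSerre_iff, ObjectProperty.monoModSerre_iff,
    ObjectProperty.epiModSerre_iff]
  have h1 : N.op (kernel f) ↔ N (cokernel f.unop) :=
    (N.prop_iff_of_iso (cokernelUnopUnop f)).symm
  have h2 : N.op (cokernel f) ↔ N (kernel f.unop) :=
    (N.prop_iff_of_iso (kernelUnopUnop f)).symm
  rw [h1, h2, and_comm]

variable {N}

/-- Together with `LeftClosed.comp_surjective`: Hom(X, -) inverts the morphisms with kernel and
cokernel in `N`. Injectivity needs only Hom(X, ker f) = 0. Surjectivity uses Hom(X, coker f) = 0 to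
land in the image of `f`, then Ext¹(X, ker f) = 0 to lift. -/
lemma LeftClosed.comp_injective {X : A} (h : LeftClosed N X) {Y Z : A} (f : Y ⟶ Z)
    (hf : N.isoModSerre f) {g g' : X ⟶ Y} (e : g ≫ f = g' ≫ f) : g = g' := by
  have h0 := h.hom_eq_zero hf.1 (kernel.lift f (g - g') (by simp [e]))
  have := kernel.lift_ι f (g - g') (by simp [e])
  rw [h0, zero_comp] at this
  exact sub_eq_zero.1 this.symm

lemma LeftClosed.comp_surjective {X : A} (h : LeftClosed N X) {Y Z : A} (f : Y ⟶ Z)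
    (hf : N.isoModSerre f) (g : X ⟶ Z) : ∃ l : X ⟶ Y, l ≫ f = g := by
  have h0 := h.hom_eq_zero hf.2 (g ≫ cokernel.π f)
  have hS : (ShortComplex.mk (kernel.ι f) (Abelian.factorThruImage f) (by
      rw [← cancel_mono (Abelian.image.ι f)]; simp)).ShortExact :=
    shortExact_of_lift _ _ _ fun t ht => ⟨kernel.lift f t (by
      rw [← Abelian.image.fac f, reassoc_of% ht, zero_comp]), kernel.lift_ι _ _ _⟩
  obtain ⟨l, hl⟩ := (h.ext hf.1).lift hS (kernel.lift (cokernel.π f) g h0)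
  refine ⟨l, ?_⟩
  rw [← Abelian.image.fac f, reassoc_of% hl]
  exact kernel.lift_ι _ _ _

variable {Q : Type*} [Category* Q] (j : A ⥤ Q) [j.IsLocalization N.isoModSerre]

include j in
lemma LeftClosed.map_injective {X : A} (h : LeftClosed N X) {Y : A} {f g : X ⟶ Y}
    (e : j.map f = j.map g) : f = g := by
  rw [MorphismProperty.map_eq_iff_postcomp j N.isoModSerre] at e
  obtain ⟨Z, s, hs, e⟩ := e
  exact h.comp_injective s hs e

-- A morphism of the quotient is a fraction whose denominator is invisible to Hom(X, -), so it
-- already comes from the original category.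
include j in
lemma LeftClosed.map_surjective {X : A} (h : LeftClosed N X) {Y : A} (f : j.obj X ⟶ j.obj Y) :
    ∃ g : X ⟶ Y, j.map g = f := by
  obtain ⟨φ, rfl⟩ := Localization.exists_leftFraction j N.isoModSerre f
  obtain ⟨l, hl⟩ := h.comp_surjective φ.s φ.hs φ.f
  have := Localization.inverts j N.isoModSerre φ.s φ.hs
  refine ⟨l, ?_⟩
  rw [← cancel_mono (j.map φ.s), MorphismProperty.LeftFraction.map_comp_map_s, ← hl, j.map_comp]

lemma LeftClosed.nonempty_iso {X Y : A} (hX : LeftClosed N X) (hY : LeftClosed N Y)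
    (e : j.obj X ≅ j.obj Y) : Nonempty (X ≅ Y) := by
  obtain ⟨f, hf⟩ := hX.map_surjective j e.hom
  obtain ⟨g, hg⟩ := hY.map_surjective j e.inv
  exact ⟨⟨f, g, hX.map_injective j (by simp [hf, hg]), hY.map_injective j (by simp [hf, hg])⟩⟩

/-- If every object receives a map from a closed object with kernel and cokernel in `N`, the
Serre quotient functor has a left adjoint. -/
lemma isRightAdjoint_of_leftClosed
    (h : ∀ V : A, ∃ (X : A) (f : X ⟶ V), LeftClosed N X ∧ N.isoModSerre f) :
    j.IsRightAdjoint := by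
  refine Functor.isRightAdjoint_of_leftAdjointObjIsDefined_eq_top (top_le_iff.1 fun Y _ => ?_)
  have := Localization.essSurj j N.isoModSerre
  obtain ⟨X, f, hX, hf⟩ := h (j.objPreimage Y)
  have := Localization.inverts j N.isoModSerre f hf
  let e : j.obj X ≅ Y := asIso (j.map f) ≪≫ j.objObjPreimageIso Y
  -- Since `j.obj X ≅ Y` and maps out of a closed object are unchanged by `j`, the object `X`
  -- corepresents V ↦ Hom(Y, j V).
  refine ⟨⟨X, ⟨⟨fun {V} => Equiv.ofBijective (fun g => e.inv ≫ j.map g) ⟨fun g g' hg => ?_,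
    fun g => ?_⟩, ?_⟩⟩⟩⟩
  · exact hX.map_injective j ((cancel_epi e.inv).1 hg)
  · obtain ⟨l, hl⟩ := hX.map_surjective j (e.hom ≫ g)
    exact ⟨l, by simp [hl]⟩
  · intro V V' g f
    simp [Equiv.ofBijective]

section Adjunction

variable {j} {F : Q ⥤ A} (adj : F ⊣ j)
include adj

/-- Hom(F Y, V) = Hom(Y, j V) vanishes for `V` in `N`. For an extension `p` of F Y by such a `V`,
the morphism `j.map p` is invertible, and the unit composed with its inverse transposes to a section
of `p`. -/
lemma leftClosed_of_adjunction [Preadditive Q] [j.Additive] (Y : Q) : LeftClosed N (F.obj Y) where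
  hom_eq_zero {V} hV f := by
    apply (adj.homEquiv _ _).injective
    exact ((ObjectProperty.SerreClassLocalization.isZero_obj_iff j N V).2 hV).eq_of_tgt _ _
  ext {V} hV E i p w hE := by
    have hi : Mono i := hE.mono_f
    have hp : Epi p := hE.epi_g
    have : N.isoModSerre p := by
      rw [ObjectProperty.isoModSerre_iff_of_epi]
      obtain ⟨l, hl⟩ := hE.exists_lift (kernel.ι p) (kernel.condition p)
      have : Mono (l ≫ i) := by rw [hl]; infer_instance
      have := mono_of_mono l i
      exact N.prop_of_mono l hV
    have := Localization.inverts j N.isoModSerre p this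
    refine ⟨(adj.homEquiv _ _).symm (adj.unit.app Y ≫ inv (j.map p)), ?_⟩
    rw [← adj.homEquiv_naturality_right_symm, Category.assoc, IsIso.inv_hom_id,
      Category.comp_id]
    apply (adj.homEquiv _ _).injective
    simp [Adjunction.homEquiv_unit]

/-- The unit has a retraction `r` because `Y` is isomorphic to an object in the image of `j`. The
idempotent `r ≫ unit` lifts to an endomorphism of F Y, which the adjunction cannot distinguish from
the identity. -/
lemma isIso_unit_of_isLocalization (N : ObjectProperty A) [N.IsSerreClass]
    [j.IsLocalization N.isoModSerre] [Preadditive Q] [j.Additive] : IsIso adj.unit := by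
  have hess := Localization.essSurj j N.isoModSerre
  rw [NatTrans.isIso_iff_isIso_app]
  intro Y
  have hcl := leftClosed_of_adjunction (N := N) adj
  obtain ⟨r, hr⟩ : ∃ r : j.obj (F.obj Y) ⟶ Y, adj.unit.app Y ≫ r = 𝟙 _ := by
    let e := j.objObjPreimageIso Y
    refine ⟨j.map ((adj.homEquiv _ _).symm e.inv) ≫ e.hom, ?_⟩
    have := adj.homEquiv_unit (f := (adj.homEquiv Y (j.objPreimage Y)).symm e.inv)
    rw [Equiv.apply_symm_apply] at this
    rw [← Category.assoc, ← this, e.inv_hom_id]; rfl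
  refine ⟨r, hr, ?_⟩
  obtain ⟨g, hg⟩ := (hcl Y).map_surjective j (r ≫ adj.unit.app Y)
  have : g = 𝟙 _ := by
    apply (adj.homEquiv _ _).injective
    rw [adj.homEquiv_unit, adj.homEquiv_unit, hg, reassoc_of% hr]
    simp
  rw [← hg, this]
  simp

lemma LeftClosed.nonempty_iso_obj [Preadditive Q] [j.Additive] {X : A} (hX : LeftClosed N X) :
    Nonempty (X ≅ F.obj (j.obj X)) := by
  have := isIso_unit_of_isLocalization adj N
  exact hX.nonempty_iso j (leftClosed_of_adjunction adj _) (asIso (adj.unit.app (j.obj X)))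

/-- The left adjoint is exact if kernels of epimorphisms between closed objects are closed. -/
lemma exactFunctor_of_leftClosed_kernel [Preadditive Q] [j.Additive]
    (hker : ∀ {Z' Z Z'' : A} (a : Z' ⟶ Z) (b : Z ⟶ Z'') (w : a ≫ b = 0),
      (ShortComplex.mk a b w).ShortExact → LeftClosed N Z → LeftClosed N Z'' →
        LeftClosed N Z') : exactFunctor Q A F := by
  let := ObjectProperty.SerreClassLocalization.abelian j N
  have := adj.leftAdjoint_preservesColimits
  have hc : PreservesFiniteColimits F := inferInstance
  have hadd : F.Additive := adj.left_adjoint_additive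
  refine ⟨(((Functor.preservesFiniteLimits_tfae F).out 3 0 :)).2 fun S hS => ?_, hc⟩
  have hE := (((Functor.preservesFiniteColimits_tfae F).out 3 0 :)).1 hc S hS
  refine ⟨hE.1, ?_⟩
  have hg : Epi (F.map S.g) := hE.2
  have hcl := leftClosed_of_adjunction (N := N) adj
  have hK := hker _ _ _ (shortExact_kernel (F.map S.g)) (hcl _) (hcl _)
  -- By right exactness `e` is epi, and its kernel lies in `N` because `j.map (F.map S.f)` is mono.
  -- The target of `e` is closed, so `kernel e` is a direct summand of the closed object `F.obj
  -- S.X₁`; hence it is zero.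
  obtain ⟨e, he⟩ : ∃ e : F.obj S.X₁ ⟶ kernel (F.map S.g), e ≫ kernel.ι _ = F.map S.f :=
    ⟨kernel.lift _ (F.map S.f) (by rw [← F.map_comp, S.zero, F.map_zero]), kernel.lift_ι _ _ _⟩
  have hepi : Epi e := by
    have hw : F.map S.f ≫ F.map S.g = 0 := by rw [← F.map_comp, S.zero, F.map_zero]
    have hE1 : (ShortComplex.mk (F.map S.f) (F.map S.g) hw).Exact := hE.1
    rw [ShortComplex.exact_iff_epi_kernel_lift] at hE1
    rwa [(cancel_mono (kernel.ι (F.map S.g))).1 (he.trans (kernel.lift_ι _ _ hw).symm)]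
  have hunit := isIso_unit_of_isLocalization adj N
  have hmono : Mono (j.map (F.map S.f)) := by
    have h1 := adj.unit.naturality S.f
    have : Mono (adj.unit.app S.X₁ ≫ j.map (F.map S.f)) := by
      have := hS.mono_f
      rw [← Functor.comp_map, ← h1]
      dsimp
      infer_instance
    have h2 : j.map (F.map S.f) = inv (adj.unit.app S.X₁) ≫ adj.unit.app S.X₁ ≫
      j.map (F.map S.f) := by simp
    rw [h2]
    exact mono_comp _ _
  rw [ObjectProperty.SerreClassLocalization.mono_map_iff j N] at hmono
  have hNe : N (kernel e) := by
    obtain ⟨l, hl⟩ : ∃ l : kernel e ⟶ kernel (F.map S.f), l ≫ kernel.ι _ = kernel.ι e :=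
      ⟨kernel.lift _ (kernel.ι e) (by rw [← he]; simp), kernel.lift_ι _ _ _⟩
    have : Mono (l ≫ kernel.ι _) := by rw [hl]; infer_instance
    have := mono_of_mono l (kernel.ι _)
    exact N.prop_of_mono l hmono
  obtain ⟨r, hr⟩ := (hK.ext hNe).exists_retraction _ _ _ (shortExact_kernel e)
  have hz : IsZero (kernel e) := by
    rw [IsZero.iff_id_eq_zero, ← hr, (hcl _).hom_eq_zero hNe r, comp_zero]
  have : Mono e := Preadditive.mono_of_kernel_zero (f := e) (hz.eq_of_src _ _)
  have h4 : Mono (e ≫ kernel.ι (F.map S.g)) := mono_comp _ _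
  rwa [he] at h4

end Adjunction

end SerreQuotient

/-! ### Standard objects described by their heads and by vanishing extensions. -/

section Standard

variable {A : Type u} [Category.{v} A] [Abelian A]

lemma projective_of_extVanish {X : A} (h : ∀ V : A, ExtVanish X V) : Projective X where
  factors f e _ := (h _).lift (shortExact_kernel e) f

variable {N : ObjectProperty A} [N.IsSerreClass]

/-- Maps out of an object with simple head `L` into objects of a Serre class not containing `L`
vanish. -/
lemma EssEpi.hom_eq_zero {X L V : A} [Simple L] {f : X ⟶ L} (hf : EssEpi f) (hL : ¬ N L)
    (hV : N V) (g : X ⟶ V) : g = 0 := by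
  have := hf.epi
  -- Either `f` factors through the coimage of `g`, making `L` a subquotient of `V`, or `kernel g`
  -- maps onto `L` and is therefore all of `X`.
  by_cases h : kernel.ι g ≫ f = 0
  · exfalso
    have h1 : Abelian.coimage.π g ≫ cokernel.desc _ f h = f := cokernel.π_desc _ _ _
    have : Epi (Abelian.coimage.π g ≫ cokernel.desc _ f h) := by rw [h1]; infer_instance
    have : Epi (cokernel.desc _ f h) := epi_of_epi (Abelian.coimage.π g) _
    exact hL (N.prop_of_epi (cokernel.desc _ f h)
      (N.prop_of_mono (Abelian.factorThruCoimage g) hV))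
  · have := hf.essential _ (epi_of_nonzero_to_simple h)
    rw [← cancel_epi (kernel.ι g), kernel.condition, comp_zero]

lemma prop_cokernel_imp_epi {X L : A} [Simple L] (hL : ¬ N L) {f : X ⟶ L}
    (hf : N (cokernel f)) : Epi f := by
  by_contra h
  have h0 : f = 0 := by
    by_contra h0
    exact h (epi_of_nonzero_to_simple h0)
  subst h0
  exact hL (N.prop_of_iso cokernelZeroIsoTarget hf)

variable {Q : Type*} [Category* Q] [Preadditive Q] (j : A ⥤ Q) [j.IsLocalization N.isoModSerre]
  [j.Additive]

include j in
lemma essEpi_of_isLocalization {X L : A}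
    (hX : ∀ {V : A}, N V → ∀ f : X ⟶ V, f = 0) (f : X ⟶ L) (hf : Epi f)
    (hess : ∀ {Y : A} (g : Y ⟶ X), Epi (j.map g ≫ j.map f) → Epi (j.map g)) : EssEpi f where
  epi := hf
  essential g hg := by
    have := ObjectProperty.SerreClassLocalization.preservesEpimorphisms j N
    have := hess g (by rw [← j.map_comp]; infer_instance)
    rw [ObjectProperty.SerreClassLocalization.epi_map_iff j N] at this
    exact Preadditive.epi_of_cokernel_zero (f := g) (hX this _)

/-- A left adjoint of `j` preserves projectives because `j` preserves epimorphisms, and essentiality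
over `L` can be tested after applying `j`. Conversely a projective `X` with simple head outside `N`
is closed, so it is recovered from `j.obj X`, which inherits both properties: epimorphisms and
subobjects in the quotient come from the original category up to objects of `N`. -/
theorem exists_adjoint_projectiveCover_iff (hj : j.IsRightAdjoint) {L : A} [Simple L]
    (hL : ¬ N L) (X : A) :
    (∃ (F : Q ⥤ A) (P : Q) (f : P ⟶ j.obj L),
      Nonempty (F ⊣ j) ∧ IsProjectiveCover f ∧ Nonempty (X ≅ F.obj P)) ↔
    ∃ f : X ⟶ L, EssEpi f ∧ ∀ V : A, ExtVanish X V := by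
  have hpe := ObjectProperty.SerreClassLocalization.preservesEpimorphisms j N
  constructor
  · rintro ⟨F, P, p, ⟨adj⟩, hp, ⟨e⟩⟩
    have hcl := leftClosed_of_adjunction (N := N) adj P
    have hunit := isIso_unit_of_isLocalization adj N
    have hproj := hp.projective
    have hF : Projective (F.obj P) := adj.map_projective _ hproj
    have hX : Projective X := Projective.of_iso e.symm hF
    refine ⟨e.hom ≫ (adj.homEquiv _ _).symm p, ?_, fun V => ExtVanish.of_projective⟩
    have hjf : adj.unit.app P ≫ j.map ((adj.homEquiv _ _).symm p) = p := by
      have := adj.homEquiv_unit (f := (adj.homEquiv P L).symm p)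
      rw [Equiv.apply_symm_apply] at this
      exact this.symm
    have hpepi := hp.epi
    have hf : Epi ((adj.homEquiv _ _).symm p) := by
      refine epi_of_nonzero_to_simple fun h0 => hL ?_
      rw [h0, j.map_zero, comp_zero] at hjf
      rw [← ObjectProperty.SerreClassLocalization.isZero_obj_iff j N]
      have : Epi (0 : P ⟶ j.obj L) := by rw [hjf]; exact hpepi
      exact IsZero.of_epi_zero P _
    have key : EssEpi ((adj.homEquiv P L).symm p) := by
      refine essEpi_of_isLocalization j hcl.hom_eq_zero _ hf fun g hg => ?_
      have : Epi (j.map g ≫ inv (adj.unit.app P)) := by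
        refine hp.essential _ ?_
        rw [← hjf]
        simpa using hg
      have h2 : j.map g = (j.map g ≫ inv (adj.unit.app P)) ≫ adj.unit.app P := by simp
      rw [h2]
      exact epi_comp _ _
    have := key.epi
    refine ⟨inferInstance, fun g hg => ?_⟩
    have h3 := key.essential (g ≫ e.hom) (by rwa [Category.assoc])
    have h4 : g = (g ≫ e.hom) ≫ e.inv := by simp
    rw [h4]
    exact epi_comp _ _
  · rintro ⟨f, hf, hX⟩
    have hfe := hf.epi
    let adj := Adjunction.ofIsRightAdjoint j
    have hcl : LeftClosed N X := ⟨fun hV g => hf.hom_eq_zero hL hV g, fun _ => hX _⟩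
    have hproj := projective_of_extVanish hX
    refine ⟨_, j.obj X, j.map f, ⟨adj⟩, ⟨⟨fun {E Z} g e he => ?_⟩, inferInstance,
      fun {Y} g hg => ?_⟩, hcl.nonempty_iso_obj adj⟩
    -- Up to isomorphism `e` is `j.map φ.hom` with the cokernel of `φ.hom` in `N`. A map from the
    -- closed object `X` therefore lands in the image of `φ.hom`, and projectivity of `X` lifts it
    -- further.
    · have := Localization.essSurj_mapArrow j N.isoModSerre
      obtain ⟨φ, ⟨α⟩⟩ : ∃ φ : Arrow A, Nonempty (j.mapArrow.obj φ ≅ Arrow.mk e) :=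
        ⟨_, ⟨Functor.objObjPreimageIso _ _⟩⟩
      let α₁ : j.obj φ.left ≅ E := Arrow.leftFunc.mapIso α
      let α₂ : j.obj φ.right ≅ Z := Arrow.rightFunc.mapIso α
      have hα : α₁.hom ≫ e = j.map φ.hom ≫ α₂.hom := Arrow.w α.hom
      have hφ : Epi (j.map φ.hom) := by
        have : j.map φ.hom = α₁.hom ≫ e ≫ α₂.inv := by rw [reassoc_of% hα]; simp
        rw [this]
        infer_instance
      rw [ObjectProperty.SerreClassLocalization.epi_map_iff j N] at hφ
      obtain ⟨h, hh⟩ := hcl.map_surjective j (g ≫ α₂.inv)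
      have h0 := hcl.hom_eq_zero hφ (h ≫ cokernel.π φ.hom)
      obtain ⟨l, hl⟩ : ∃ l, l ≫ Abelian.image.ι φ.hom = h :=
        ⟨kernel.lift _ h h0, kernel.lift_ι _ _ _⟩
      refine ⟨j.map (Projective.factorThru l (Abelian.factorThruImage φ.hom)) ≫ α₁.hom, ?_⟩
      rw [Category.assoc, hα, ← j.map_comp_assoc]
      have : Projective.factorThru l (Abelian.factorThruImage φ.hom) ≫ φ.hom = h := by
        refine (Projective.factorThru l (Abelian.factorThruImage φ.hom) ≫=
          (Abelian.image.fac φ.hom).symm).trans ?_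
        rw [Projective.factorThru_comp_assoc, hl]
      rw [this, hh]
      simp
    · have := Localization.essSurj j N.isoModSerre
      obtain ⟨ψ, hψ⟩ := Localization.exists_rightFraction j N.isoModSerre
        ((j.objObjPreimageIso Y).hom ≫ g)
      have := Localization.inverts j N.isoModSerre ψ.s ψ.hs
      have hψ' : j.map ψ.s ≫ (j.objObjPreimageIso Y).hom ≫ g = j.map ψ.f := by
        rw [hψ]; simp
      have hg' : Epi (j.map (ψ.f ≫ f)) := by
        rw [j.map_comp, ← hψ']
        simp only [Category.assoc]
        infer_instance
      rw [ObjectProperty.SerreClassLocalization.epi_map_iff j N] at hg'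
      have := hf.essential _ (prop_cokernel_imp_epi hL hg')
      have h5 : Epi ((j.map ψ.s ≫ (j.objObjPreimageIso Y).hom) ≫ g) := by
        rw [Category.assoc, hψ']; infer_instance
      exact epi_of_epi (j.map ψ.s ≫ (j.objObjPreimageIso Y).hom) g

/-- The counit at `L` is inverted by `j`, so its kernel and cokernel lie in `N`, and it is epi
because `L` is simple and outside `N`. Conversely a morphism `f` as on the right is inverted by `j`,
and the closed object `X` is F(j X) ≅ F(j L). -/
theorem exists_adjoint_simple_iff (hj : j.IsRightAdjoint) {L : A} [Simple L]
    (hL : ¬ N L) (X : A) :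
    (∃ F : Q ⥤ A, Nonempty (F ⊣ j) ∧ Nonempty (X ≅ F.obj (j.obj L))) ↔
    ∃ f : X ⟶ L, EssEpi f ∧ N (kernel f) ∧ ∀ V : A, N V → ExtVanish X V := by
  constructor
  · rintro ⟨F, ⟨adj⟩, ⟨e⟩⟩
    have hcl := (leftClosed_of_adjunction (N := N) adj (j.obj L)).of_iso e.symm
    have hunit := isIso_unit_of_isLocalization adj N
    have hjf : IsIso (j.map (e.hom ≫ adj.counit.app L)) := by
      have : IsIso (j.map (adj.counit.app L)) := by
        have := adj.right_triangle_components L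
        exact ⟨adj.unit.app (j.obj L), by
          rw [← cancel_epi (adj.unit.app (j.obj L)), reassoc_of% this]; simp, this⟩
      rw [j.map_comp]
      infer_instance
    have hW := (ObjectProperty.SerreClassLocalization.isIso_map_iff j N _).1 hjf
    refine ⟨e.hom ≫ adj.counit.app L, essEpi_of_isLocalization j hcl.hom_eq_zero _
      (prop_cokernel_imp_epi hL hW.2) fun g hg => ?_, hW.1, fun V hV => hcl.ext hV⟩
    have : j.map g = (j.map g ≫ j.map (e.hom ≫ adj.counit.app L)) ≫
      inv (j.map (e.hom ≫ adj.counit.app L)) := by simp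
    rw [this]
    exact epi_comp _ _
  · rintro ⟨f, hf, hker, hX⟩
    have hfe := hf.epi
    have hcl : LeftClosed N X := ⟨fun hV g => hf.hom_eq_zero hL hV g, fun hV => hX _ hV⟩
    have hW : N.isoModSerre f := by
      rw [ObjectProperty.isoModSerre_iff_of_epi]
      exact hker
    have := Localization.inverts j N.isoModSerre f hW
    let adj := Adjunction.ofIsRightAdjoint j
    obtain ⟨e⟩ := hcl.nonempty_iso_obj adj
    exact ⟨_, ⟨adj⟩, ⟨e ≪≫ (j.leftAdjoint).mapIso (asIso (j.map f))⟩⟩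

/-! ### Dual statements, by passing to opposite categories. -/

section Dual

omit [Preadditive Q] in
lemma isProjectiveCover_op_iff {X J : Q} (f : X ⟶ J) :
    IsProjectiveCover f.op ↔ IsInjectiveHull f where
  mp h :=
    { injective := have := h.projective; inferInstanceAs (Injective (Opposite.unop (Opposite.op J)))
      mono := (op_epi_iff f).1 h.epi
      essential := fun g hg => (op_epi_iff g).1 (h.essential g.op ((op_epi_iff (f ≫ g)).2 hg)) }
  mpr h :=
    { projective := have := h.injective; inferInstance
      epi := (op_epi_iff f).2 h.mono
      essential := fun g hg => (unop_mono_iff g).1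
        (h.essential g.unop ((op_epi_iff (f ≫ g.unop)).1 hg)) }

omit [Preadditive Q] in
lemma isInjectiveHull_op_iff {P X : Q} (f : P ⟶ X) :
    IsInjectiveHull f.op ↔ IsProjectiveCover f where
  mp h :=
    { projective := have := h.injective; inferInstanceAs (Projective (Opposite.unop (Opposite.op P)))
      epi := (op_mono_iff f).1 h.mono
      essential := fun g hg => (op_mono_iff g).1 (h.essential g.op ((op_mono_iff (g ≫ f)).2 hg)) }
  mpr h :=
    { injective := have := h.projective; inferInstance
      mono := (op_mono_iff f).2 h.epi
      essential := fun g hg => (unop_epi_iff g).1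
        (h.essential g.unop ((op_mono_iff (g.unop ≫ f)).1 hg)) }

instance isLocalization_isoModSerre_op : j.op.IsLocalization N.op.isoModSerre := by
  rw [isoModSerre_op]
  infer_instance

theorem exists_adjoint_injectiveHull_iff (hj : j.IsLeftAdjoint) {L : A} [Simple L]
    (hL : ¬ N L) (X : A) :
    (∃ (G : Q ⥤ A) (J : Q) (f : j.obj L ⟶ J),
      Nonempty (j ⊣ G) ∧ IsInjectiveHull f ∧ Nonempty (X ≅ G.obj J)) ↔
    ∃ f : L ⟶ X, EssMono f ∧ ∀ V : A, ExtVanish V X := by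
  have := simple_op_of_simple L
  have := exists_adjoint_projectiveCover_iff (N := N.op) j.op inferInstance
    (L := Opposite.op L) hL (Opposite.op X)
  constructor
  · rintro ⟨G, J, f, ⟨adj⟩, hf, ⟨e⟩⟩
    obtain ⟨g, hg, hV⟩ := this.1 ⟨G.op, Opposite.op J, f.op, ⟨adj.op⟩,
      (isProjectiveCover_op_iff f).2 hf, ⟨e.symm.op⟩⟩
    exact ⟨g.unop, hg.unop, fun V => (hV (Opposite.op V)).unop⟩
  · rintro ⟨f, hf, hV⟩
    obtain ⟨F, P, p, ⟨adj⟩, hp, ⟨e⟩⟩ := this.2 ⟨f.op, hf.op, fun V => (hV V.unop).op⟩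
    exact ⟨F.unop, P.unop, p.unop, ⟨adj.unop⟩, (isProjectiveCover_op_iff p.unop).1 hp,
      ⟨e.unop.symm⟩⟩

theorem exists_right_adjoint_simple_iff (hj : j.IsLeftAdjoint) {L : A} [Simple L]
    (hL : ¬ N L) (X : A) :
    (∃ G : Q ⥤ A, Nonempty (j ⊣ G) ∧ Nonempty (X ≅ G.obj (j.obj L))) ↔
    ∃ f : L ⟶ X, EssMono f ∧ N (cokernel f) ∧ ∀ V : A, N V → ExtVanish V X := by
  have := simple_op_of_simple L
  have := exists_adjoint_simple_iff (N := N.op) j.op inferInstance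
    (L := Opposite.op L) hL (Opposite.op X)
  constructor
  · rintro ⟨G, ⟨adj⟩, ⟨e⟩⟩
    obtain ⟨g, hg, hk, hV⟩ := this.1 ⟨G.op, ⟨adj.op⟩, ⟨e.symm.op⟩⟩
    exact ⟨g.unop, hg.unop, N.prop_of_iso (cokernelUnopUnop g).symm hk,
      fun V h => (hV (Opposite.op V) h).unop⟩
  · rintro ⟨f, hf, hk, hV⟩
    obtain ⟨F, ⟨adj⟩, ⟨e⟩⟩ := this.2 ⟨f.op, hf.op,
      N.prop_of_iso (cokernelUnopUnop f.op) hk, fun V h => (hV V.unop h).op⟩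
    exact ⟨F.unop, ⟨adj.unop⟩, ⟨e.unop.symm⟩⟩

omit [Preadditive Q] [j.Additive] in
/-- If every object maps to a closed object with kernel and cokernel in `N`, the Serre quotient
functor has a right adjoint. -/
lemma isLeftAdjoint_of_rightClosed
    (h : ∀ V : A, ∃ (X : A) (f : V ⟶ X), RightClosed N X ∧ N.isoModSerre f) :
    j.IsLeftAdjoint := by
  have : j.op.IsRightAdjoint := by
    refine isRightAdjoint_of_leftClosed (N := N.op) j.op fun V => ?_
    obtain ⟨X, f, hX, hf⟩ := h V.unop
    refine ⟨Opposite.op X, f.op, hX.op, ?_⟩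
    rw [isoModSerre_op]
    exact hf
  exact (Adjunction.ofIsRightAdjoint j.op).unop.isLeftAdjoint

lemma exactFunctor_of_rightClosed_cokernel {G : Q ⥤ A} (adj : j ⊣ G)
    (hcoker : ∀ {Z' Z Z'' : A} (a : Z' ⟶ Z) (b : Z ⟶ Z'') (w : a ≫ b = 0),
      (ShortComplex.mk a b w).ShortExact → RightClosed N Z' → RightClosed N Z →
        RightClosed N Z'') : exactFunctor Q A G := by
  have h := exactFunctor_of_leftClosed_kernel (N := N.op) adj.op
    fun a b w hE hZ hZ'' => (hcoker b.unop a.unop (Quiver.Hom.op_inj w) hE.unop hZ''.unop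
      hZ.unop).op
  have : PreservesFiniteLimits G.op := h.1
  have : PreservesFiniteColimits G.op := h.2
  exact ⟨preservesFiniteLimits_of_op _, preservesFiniteColimits_of_op _⟩

end Dual

end Standard

/-! ### Comparison of R_{≤ lam} with the ambient category. -/

section Subcategory

variable {R : Type u} [Category.{v} R] [Abelian R]

lemma IsSubquotient.op {X V : R} (h : IsSubquotient X V) :
    IsSubquotient (Opposite.op X) (Opposite.op V) := by
  obtain ⟨Y, i, p, hi, hp⟩ := h
  exact ⟨Opposite.op (pushout i p), (pushout.inl i p).op, (pushout.inr i p).op,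
    inferInstance, inferInstance⟩

lemma IsSubquotient.unop {X V : Rᵒᵖ} (h : IsSubquotient X V) :
    IsSubquotient X.unop V.unop := by
  obtain ⟨Y, i, p, hi, hp⟩ := h
  exact ⟨(pushout i p).unop, (pushout.inl i p).unop, (pushout.inr i p).unop,
    inferInstance, inferInstance⟩

section FullSubcategory

variable (P : ObjectProperty R) [P.IsSerreClass] [P.IsClosedUnderFiniteProducts]
  [PreservesFiniteLimits P.ι] [PreservesFiniteColimits P.ι]

variable {P}

lemma mono_hom_iff_of_isSerreClass {X Y : P.FullSubcategory} (f : X ⟶ Y) :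
    Mono f ↔ Mono f.hom :=
  ⟨fun _ => inferInstanceAs (Mono (P.ι.map f)), fun h => P.ι.mono_of_mono_map h⟩

lemma epi_hom_iff_of_isSerreClass {X Y : P.FullSubcategory} (f : X ⟶ Y) :
    Epi f ↔ Epi f.hom :=
  ⟨fun _ => inferInstanceAs (Epi (P.ι.map f)), fun h => P.ι.epi_of_epi_map h⟩

/-- The middle term of an extension of objects of a Serre subcategory belongs to the subcategory. -/
lemma extVanish_fullSubcategory_iff {X V : P.FullSubcategory} :
    ExtVanish X V ↔ ExtVanish X.obj V.obj := by
  constructor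
  · intro h E i p w hE
    have : Mono i := hE.mono_f
    have : Epi p := hE.epi_g
    have hP : P E := P.prop_X₂_of_shortExact hE V.property X.property
    let E' : P.FullSubcategory := ⟨E, hP⟩
    let i' : V ⟶ E' := P.homMk i
    let p' : E' ⟶ X := P.homMk p
    have : Mono i' := (mono_hom_iff_of_isSerreClass _).2 ‹_›
    have : Epi p' := (epi_hom_iff_of_isSerreClass _).2 ‹_›
    obtain ⟨s, hs⟩ := h i' p' (P.ι.map_injective w) (shortExact_of_lift _ _ _ fun {T} t ht => by
      obtain ⟨l, hl⟩ := hE.exists_lift t.hom (congr_arg P.ι.map ht)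
      exact ⟨P.homMk l, P.ι.map_injective hl⟩)
    exact ⟨s.hom, congr_arg P.ι.map hs⟩
  · intro h E i p w hE
    obtain ⟨s, hs⟩ := h i.hom p.hom (congr_arg P.ι.map w) (hE.map_of_exact P.ι)
    exact ⟨P.homMk s, P.ι.map_injective hs⟩

/-- A test morphism whose source is outside the subcategory can be replaced by the inclusion of its
image, a subobject of `X`. -/
lemma essEpi_fullSubcategory_iff {X Y : P.FullSubcategory} (f : X ⟶ Y) :
    EssEpi f ↔ EssEpi f.hom := by
  constructor
  · intro h
    refine ⟨(epi_hom_iff_of_isSerreClass f).1 h.epi, fun {Q} g hg => ?_⟩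
    have hQ : P (Abelian.image g) := P.prop_of_mono (Abelian.image.ι g) X.property
    let g' : (⟨Abelian.image g, hQ⟩ : P.FullSubcategory) ⟶ X := P.homMk (Abelian.image.ι g)
    have : Epi (g' ≫ f) := by
      rw [epi_hom_iff_of_isSerreClass]
      have h1 : Epi (Abelian.factorThruImage g ≫ Abelian.image.ι g ≫ f.hom) := by
        rw [← Category.assoc, Abelian.image.fac]; exact hg
      exact epi_of_epi (Abelian.factorThruImage g) (Abelian.image.ι g ≫ f.hom)
    have h2 := (epi_hom_iff_of_isSerreClass g').1 (h.essential g' this)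
    have h3 : Epi (Abelian.image.ι g) := h2
    have h4 : Epi (Abelian.factorThruImage g ≫ Abelian.image.ι g) := epi_comp _ _
    rwa [Abelian.image.fac] at h4
  · intro h
    refine ⟨(epi_hom_iff_of_isSerreClass f).2 h.epi, fun {Q} g hg => ?_⟩
    rw [epi_hom_iff_of_isSerreClass] at hg ⊢
    exact h.essential _ hg

lemma essMono_fullSubcategory_iff {X Y : P.FullSubcategory} (f : X ⟶ Y) :
    EssMono f ↔ EssMono f.hom := by
  constructor
  · intro h
    refine ⟨(mono_hom_iff_of_isSerreClass f).1 h.mono, fun {Q} g hg => ?_⟩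
    have hQ : P (Abelian.image g) := P.prop_of_epi (Abelian.factorThruImage g) Y.property
    let g' : Y ⟶ (⟨Abelian.image g, hQ⟩ : P.FullSubcategory) :=
      P.homMk (Abelian.factorThruImage g)
    have : Mono (f ≫ g') := by
      rw [mono_hom_iff_of_isSerreClass]
      have h1 : Mono ((f.hom ≫ Abelian.factorThruImage g) ≫ Abelian.image.ι g) := by
        rw [Category.assoc, Abelian.image.fac]; exact hg
      exact mono_of_mono (f.hom ≫ Abelian.factorThruImage g) (Abelian.image.ι g)
    have h2 := (mono_hom_iff_of_isSerreClass g').1 (h.essential g' this)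
    have h3 : Mono (Abelian.factorThruImage g) := h2
    have h4 : Mono (Abelian.factorThruImage g ≫ Abelian.image.ι g) := mono_comp _ _
    rwa [Abelian.image.fac] at h4
  · intro h
    refine ⟨(mono_hom_iff_of_isSerreClass f).2 h.mono, fun {Q} g hg => ?_⟩
    rw [mono_hom_iff_of_isSerreClass] at hg ⊢
    exact h.essential _ hg

lemma simple_fullSubcategory {X : P.FullSubcategory} (h : Simple X.obj) : Simple X where
  mono_isIso_iff_nonzero f hf := by
    have := (mono_hom_iff_of_isSerreClass f).1 hf
    rw [← isIso_iff_of_reflects_iso f P.ι]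
    refine (Simple.mono_isIso_iff_nonzero f.hom).trans (not_congr ⟨fun h => P.ι.map_injective h,
      fun h => congr_arg P.ι.map h⟩)

end FullSubcategory

namespace Stratification

variable {B : Type uB} {Λ : Type uL} [PartialOrder Λ] (S : Stratification R B Λ)

lemma serre_op_iff {T : Set B} {V : R} : S.op.serre T (Opposite.op V) ↔ S.serre T V :=
  ⟨fun h b hb => h b hb.op, fun h b hb => h b hb.unop⟩

lemma serre_unop_iff {T : Set B} {V : Rᵒᵖ} : S.serre T V.unop ↔ S.op.serre T V :=
  ⟨fun h b hb => h b hb.unop, fun h b hb => h b hb.op⟩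

lemma serre_mono {T T' : Set B} (h : T ⊆ T') {V : R} (hV : S.serre T V) : S.serre T' V :=
  fun b hb => h (hV b hb)

lemma serre_L_iff {T : Set B} {b : B} : S.serre T (S.L b) ↔ b ∈ T := by
  constructor
  · exact fun h => h b ⟨S.L b, 𝟙 _, 𝟙 _, inferInstance, inferInstance⟩
  · intro h c hc
    have := S.simple b
    have := S.simple c
    obtain ⟨e⟩ := hc.iso_of_simple
    rwa [S.injective c b ⟨e.symm⟩]

/-- `X` has simple head `L b`, radical in `S.serre T`, and no extensions by objects of
`S.serre T`. -/
def IsStd (T : Set B) (b : B) (X : R) : Prop :=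
  ∃ f : X ⟶ S.L b, EssEpi f ∧ S.serre T (kernel f) ∧ ∀ ⦃V : R⦄, S.serre T V → ExtVanish X V

/-- The dual notion to `IsStd`. -/
def IsCostd (T : Set B) (b : B) (X : R) : Prop :=
  ∃ f : S.L b ⟶ X, EssMono f ∧ S.serre T (cokernel f) ∧ ∀ ⦃V : R⦄, S.serre T V → ExtVanish V X

lemma isStd_op_iff {T : Set B} {b : B} {X : R} :
    S.op.IsStd T b (Opposite.op X) ↔ S.IsCostd T b X := by
  constructor
  · rintro ⟨f, hf, hk, hV⟩
    exact ⟨f.unop, hf.unop, (S.serre T).prop_of_iso (cokernelUnopUnop f).symm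
      (S.serre_unop_iff.2 hk), fun V h => (hV (S.serre_op_iff.2 h)).unop⟩
  · rintro ⟨f, hf, hk, hV⟩
    exact ⟨f.op, hf.op, S.serre_unop_iff.1 ((S.serre T).prop_of_iso (cokernelUnopUnop f.op) hk),
      fun V h => (hV (S.serre_unop_iff.2 h)).op⟩

lemma isCostd_op_iff {T : Set B} {b : B} {X : R} :
    S.op.IsCostd T b (Opposite.op X) ↔ S.IsStd T b X := by
  constructor
  · rintro ⟨f, hf, hk, hV⟩
    exact ⟨f.unop, hf.unop, (S.serre T).prop_of_iso (kernelUnopUnop f).symm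
      (S.serre_unop_iff.2 hk), fun V h => (hV (S.serre_op_iff.2 h)).unop⟩
  · rintro ⟨f, hf, hk, hV⟩
    exact ⟨f.op, hf.op, S.serre_unop_iff.1 ((S.serre T).prop_of_iso (kernelUnopUnop f.op) hk),
      fun V h => (hV (S.serre_unop_iff.2 h)).op⟩

variable {S}

lemma IsStd.of_iso {T : Set B} {b : B} {X Y : R} (h : S.IsStd T b X) (e : X ≅ Y) :
    S.IsStd T b Y := by
  obtain ⟨f, hf, hk, hV⟩ := h
  have := hf.epi
  refine ⟨e.inv ≫ f, ⟨inferInstance, fun g hg => ?_⟩,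
    (S.serre T).prop_of_iso (kernelIsIsoComp e.inv f).symm hk, fun V h => (hV h).of_iso_left e⟩
  have := hf.essential (g ≫ e.inv) (by rwa [Category.assoc])
  have h4 : g = (g ≫ e.inv) ≫ e.hom := by simp
  rw [h4]
  exact epi_comp _ _

lemma IsStd.serre {T T' : Set B} (hT : T ⊆ T') {b : B} (hb : b ∈ T') {X : R} (h : S.IsStd T b X) :
    S.serre T' X := by
  obtain ⟨f, hf, hk, hV⟩ := h
  have := hf.epi
  exact (S.serre T').prop_X₂_of_shortExact (shortExact_kernel f) (S.serre_mono hT hk)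
    (S.serre_L_iff.2 hb)

lemma IsCostd.of_iso {T : Set B} {b : B} {X Y : R} (h : S.IsCostd T b X) (e : X ≅ Y) :
    S.IsCostd T b Y := by
  rw [← isStd_op_iff] at h ⊢
  exact h.of_iso e.symm.op

lemma IsCostd.serre {T T' : Set B} (hT : T ⊆ T') {b : B} (hb : b ∈ T') {X : R}
    (h : S.IsCostd T b X) : S.serre T' X := by
  rw [← isStd_op_iff] at h
  exact S.serre_op_iff.1 (h.serre hT hb)

variable (S)

lemma simple_LLe (b : B) : Simple (S.LLe b) := simple_fullSubcategory (S.simple b)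

lemma not_ltIn_LLe (b : B) : ¬ S.ltIn (S.ρ b) (S.LLe b) := fun h =>
  lt_irrefl (S.ρ b) (S.serre_L_iff (T := {c | S.ρ c < S.ρ b}).1 h)

/-- Here the condition on the radical in `IsStd` is automatic from membership in R_{≤ ρ b}; it is
kept so that standard and proper standard objects differ only in the index set. -/
lemma isStandard_iff (h : ∀ lam, (S.j lam).IsRightAdjoint) {b : B} {X : R} :
    S.IsStandard b X ↔ S.IsStd {c | S.ρ c ≤ S.ρ b} b X := by
  have := S.simple_LLe b
  have key := exists_adjoint_projectiveCover_iff (N := S.ltIn (S.ρ b)) (S.j (S.ρ b)) (h _)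
    (S.not_ltIn_LLe b)
  constructor
  · rintro ⟨F, P, f, hF, hf, ⟨e⟩⟩
    obtain ⟨g, hg, hV⟩ := (key (F.obj P)).1 ⟨F, P, f, hF, hf, ⟨Iso.refl _⟩⟩
    have hk : S.serre {c | S.ρ c ≤ S.ρ b} (kernel g.hom) :=
      (S.serre {c | S.ρ c ≤ S.ρ b}).prop_of_mono (kernel.ι g.hom) (F.obj P).property
    have : S.IsStd {c | S.ρ c ≤ S.ρ b} b (F.obj P).obj :=
      ⟨g.hom, (essEpi_fullSubcategory_iff g).1 hg, hk,
        fun V hVS => extVanish_fullSubcategory_iff.1 (hV ⟨V, hVS⟩)⟩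
    exact this.of_iso e.symm
  · intro hX
    have hXs : S.serre {c | S.ρ c ≤ S.ρ b} X := hX.serre (T' := {c | S.ρ c ≤ S.ρ b}) subset_rfl (le_refl (S.ρ b))
    obtain ⟨f, hf, hk, hV⟩ := hX
    obtain ⟨F, P, p, hF, hp, ⟨e⟩⟩ := (key ⟨X, hXs⟩).2 ⟨(S.serre {c | S.ρ c ≤ S.ρ b}).homMk f,
      (essEpi_fullSubcategory_iff _).2 hf,
      fun V => extVanish_fullSubcategory_iff.2 (hV V.property)⟩
    exact ⟨F, P, p, hF, hp, ⟨(S.serre {c | S.ρ c ≤ S.ρ b}).ι.mapIso e⟩⟩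

lemma isProperStandard_iff (h : ∀ lam, (S.j lam).IsRightAdjoint) {b : B} {X : R} :
    S.IsProperStandard b X ↔ S.IsStd {c | S.ρ c < S.ρ b} b X := by
  have := S.simple_LLe b
  have key := exists_adjoint_simple_iff (N := S.ltIn (S.ρ b)) (S.j (S.ρ b)) (h _)
    (S.not_ltIn_LLe b)
  have hlt : {c | S.ρ c < S.ρ b} ⊆ {c | S.ρ c ≤ S.ρ b} := fun _ => le_of_lt
  have hker {X Y : S.Le (S.ρ b)} (f : X ⟶ Y) :
      S.ltIn (S.ρ b) (kernel f) ↔ S.serre {c | S.ρ c < S.ρ b} (kernel f.hom) :=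
    (S.serre _).prop_iff_of_iso (PreservesKernel.iso (S.serre {c | S.ρ c ≤ S.ρ b}).ι f)
  constructor
  · rintro ⟨F, hF, ⟨e⟩⟩
    obtain ⟨g, hg, hk, hV⟩ := (key _).1 ⟨F, hF, ⟨Iso.refl _⟩⟩
    have : S.IsStd {c | S.ρ c < S.ρ b} b (F.obj (S.LStratum b)).obj :=
      ⟨g.hom, (essEpi_fullSubcategory_iff g).1 hg, (hker g).1 hk,
        fun V hVS => extVanish_fullSubcategory_iff.1 (hV ⟨V, S.serre_mono hlt hVS⟩ hVS)⟩
    exact this.of_iso e.symm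
  · intro hX
    have hXs : S.serre {c | S.ρ c ≤ S.ρ b} X := hX.serre hlt le_rfl
    obtain ⟨f, hf, hk, hV⟩ := hX
    obtain ⟨F, hF, ⟨e⟩⟩ := (key ⟨X, hXs⟩).2 ⟨(S.serre {c | S.ρ c ≤ S.ρ b}).homMk f,
      (essEpi_fullSubcategory_iff _).2 hf, (hker _).2 hk,
      fun V hVS => extVanish_fullSubcategory_iff.2 (hV hVS)⟩
    exact ⟨F, hF, ⟨(S.serre {c | S.ρ c ≤ S.ρ b}).ι.mapIso e⟩⟩

lemma isCostandard_iff (h : ∀ lam, (S.j lam).IsLeftAdjoint) {b : B} {X : R} :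
    S.IsCostandard b X ↔ S.IsCostd {c | S.ρ c ≤ S.ρ b} b X := by
  have := S.simple_LLe b
  have key := exists_adjoint_injectiveHull_iff (N := S.ltIn (S.ρ b)) (S.j (S.ρ b)) (h _)
    (S.not_ltIn_LLe b)
  constructor
  · rintro ⟨F, P, f, hF, hf, ⟨e⟩⟩
    obtain ⟨g, hg, hV⟩ := (key (F.obj P)).1 ⟨F, P, f, hF, hf, ⟨Iso.refl _⟩⟩
    have hk : S.serre {c | S.ρ c ≤ S.ρ b} (cokernel g.hom) :=
      (S.serre {c | S.ρ c ≤ S.ρ b}).prop_of_epi (cokernel.π g.hom) (F.obj P).property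
    have : S.IsCostd {c | S.ρ c ≤ S.ρ b} b (F.obj P).obj :=
      ⟨g.hom, (essMono_fullSubcategory_iff g).1 hg, hk,
        fun V hVS => extVanish_fullSubcategory_iff.1 (hV ⟨V, hVS⟩)⟩
    exact this.of_iso e.symm
  · intro hX
    have hXs : S.serre {c | S.ρ c ≤ S.ρ b} X := hX.serre (T' := {c | S.ρ c ≤ S.ρ b}) subset_rfl (le_refl (S.ρ b))
    obtain ⟨f, hf, hk, hV⟩ := hX
    obtain ⟨F, P, p, hF, hp, ⟨e⟩⟩ := (key ⟨X, hXs⟩).2 ⟨(S.serre {c | S.ρ c ≤ S.ρ b}).homMk f,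
      (essMono_fullSubcategory_iff _).2 hf,
      fun V => extVanish_fullSubcategory_iff.2 (hV V.property)⟩
    exact ⟨F, P, p, hF, hp, ⟨(S.serre {c | S.ρ c ≤ S.ρ b}).ι.mapIso e⟩⟩

lemma isProperCostandard_iff (h : ∀ lam, (S.j lam).IsLeftAdjoint) {b : B} {X : R} :
    S.IsProperCostandard b X ↔ S.IsCostd {c | S.ρ c < S.ρ b} b X := by
  have := S.simple_LLe b
  have key := exists_right_adjoint_simple_iff (N := S.ltIn (S.ρ b)) (S.j (S.ρ b)) (h _)
    (S.not_ltIn_LLe b)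
  have hlt : {c | S.ρ c < S.ρ b} ⊆ {c | S.ρ c ≤ S.ρ b} := fun _ => le_of_lt
  have hcok {X Y : S.Le (S.ρ b)} (f : X ⟶ Y) :
      S.ltIn (S.ρ b) (cokernel f) ↔ S.serre {c | S.ρ c < S.ρ b} (cokernel f.hom) :=
    (S.serre _).prop_iff_of_iso (PreservesCokernel.iso (S.serre {c | S.ρ c ≤ S.ρ b}).ι f)
  constructor
  · rintro ⟨F, hF, ⟨e⟩⟩
    obtain ⟨g, hg, hk, hV⟩ := (key _).1 ⟨F, hF, ⟨Iso.refl _⟩⟩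
    have : S.IsCostd {c | S.ρ c < S.ρ b} b (F.obj (S.LStratum b)).obj :=
      ⟨g.hom, (essMono_fullSubcategory_iff g).1 hg, (hcok g).1 hk,
        fun V hVS => extVanish_fullSubcategory_iff.1 (hV ⟨V, S.serre_mono hlt hVS⟩ hVS)⟩
    exact this.of_iso e.symm
  · intro hX
    have hXs : S.serre {c | S.ρ c ≤ S.ρ b} X := hX.serre hlt le_rfl
    obtain ⟨f, hf, hk, hV⟩ := hX
    obtain ⟨F, hF, ⟨e⟩⟩ := (key ⟨X, hXs⟩).2 ⟨(S.serre {c | S.ρ c ≤ S.ρ b}).homMk f,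
      (essMono_fullSubcategory_iff _).2 hf, (hcok _).2 hk,
      fun V hVS => extVanish_fullSubcategory_iff.2 (hV hVS)⟩
    exact ⟨F, hF, ⟨(S.serre {c | S.ρ c ≤ S.ρ b}).ι.mapIso e⟩⟩

end Stratification

end Subcategory

/-! ### Consequences of the finiteness axioms. -/

section Finitary

variable {R : Type u} [Category.{v} R] [Abelian R]

/-- A natural-number-valued function on objects, additive on short exact sequences. -/
def IsAdditiveMeasure (D : R → ℕ) : Prop :=
  ∀ ⦃E : ShortComplex R⦄, E.ShortExact → D E.X₂ = D E.X₁ + D E.X₃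

namespace IsAdditiveMeasure

variable {D : R → ℕ} (hD : IsAdditiveMeasure D)
include hD

lemma eq_add_cokernel {X Y : R} (f : X ⟶ Y) [Mono f] : D Y = D X + D (cokernel f) :=
  hD (shortExact_cokernel f)

lemma eq_kernel_add {X Y : R} (f : X ⟶ Y) [Epi f] : D X = D (kernel f) + D Y :=
  hD (shortExact_kernel f)

lemma le_of_mono {X Y : R} (f : X ⟶ Y) [Mono f] : D X ≤ D Y := by
  have := hD.eq_add_cokernel f; omega

lemma le_of_epi {X Y : R} (f : X ⟶ Y) [Epi f] : D Y ≤ D X := by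
  have := hD.eq_kernel_add f; omega

lemma le_of_isSubquotient {X Y : R} (h : IsSubquotient X Y) : D X ≤ D Y := by
  obtain ⟨Z, i, p, hi, hp⟩ := h
  exact (hD.le_of_epi p).trans (hD.le_of_mono i)

lemma op : IsAdditiveMeasure (fun V : Rᵒᵖ => D V.unop) := fun E hE => by
  have := hD hE.unop
  exact this.trans (add_comm _ _)

end IsAdditiveMeasure

namespace Stratification

variable {B : Type uB} {Λ : Type uL} [PartialOrder Λ] (S : Stratification R B Λ)

/-- The finiteness properties of essentially finite Abelian categories, and of upper finite
Schurian categories, from which the equivalence of the four conditions follows. -/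
structure IsFinitary : Prop where
  measure : ∀ lam, ∃ D : R → ℕ, IsAdditiveMeasure D ∧ ∀ c, lam ≤ S.ρ c → 0 < D (S.L c)
  exists_subquotient : ∀ {V : R}, ¬ IsZero V → ∃ b, IsSubquotient (S.L b) V
  cover : ∀ b, ∃ (P : R) (f : P ⟶ S.L b), Projective P ∧ EssEpi f
  hull : ∀ b, ∃ (J : R) (f : S.L b ⟶ J), Injective J ∧ EssMono f
  largest_sub : ∀ (T : Set B) (V : R), ∃ (U : R) (i : U ⟶ V), Mono i ∧ S.serre T U ∧
    ∀ {W : R} (g : W ⟶ V), S.serre T W → ∃ l, l ≫ i = g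
  largest_quotient : ∀ (T : Set B) (V : R), ∃ (U : R) (p : V ⟶ U), Epi p ∧ S.serre T U ∧
    ∀ {W : R} (g : V ⟶ W), S.serre T W → ∃ l, p ≫ l = g

variable {S}

lemma IsFinitary.op (h : S.IsFinitary) : S.op.IsFinitary where
  measure lam := by
    obtain ⟨D, hD, hpos⟩ := h.measure lam
    exact ⟨_, hD.op, hpos⟩
  exists_subquotient {V} hV := by
    obtain ⟨b, hb⟩ := h.exists_subquotient (V := V.unop) fun h => hV h.op
    exact ⟨b, hb.op⟩
  cover b := by
    obtain ⟨J, f, hJ, hf⟩ := h.hull b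
    exact ⟨_, f.op, inferInstance, hf.op⟩
  hull b := by
    obtain ⟨P, f, hP, hf⟩ := h.cover b
    exact ⟨_, f.op, inferInstance, hf.op⟩
  largest_sub T V := by
    obtain ⟨U, p, hp, hU, hl⟩ := h.largest_quotient T V.unop
    refine ⟨_, p.op, inferInstance, S.serre_op_iff.2 hU, fun g hW => ?_⟩
    obtain ⟨l, hl⟩ := hl g.unop (S.serre_unop_iff.2 hW)
    exact ⟨l.op, Quiver.Hom.unop_inj hl⟩
  largest_quotient T V := by
    obtain ⟨U, p, hp, hU, hl⟩ := h.largest_sub T V.unop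
    refine ⟨_, p.op, inferInstance, S.serre_op_iff.2 hU, fun g hW => ?_⟩
    obtain ⟨l, hl⟩ := hl g.unop (S.serre_unop_iff.2 hW)
    exact ⟨l.op, Quiver.Hom.unop_inj hl⟩

/-- Vanishing of extensions lifts the head map of `X` to `g : X ⟶ Y`, and essentiality makes `g`
epi. Its kernel sits in the radical of `X`, so `g` has a section; the section is epi because the
head of `X` is essential. -/
lemma IsStd.nonempty_iso {T : Set B} {b : B} {X Y : R} (hX : S.IsStd T b X)
    (hY : S.IsStd T b Y) : Nonempty (X ≅ Y) := by
  obtain ⟨f, hf, hk, hV⟩ := hX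
  obtain ⟨f', hf', hk', hV'⟩ := hY
  have := hf.epi
  have := hf'.epi
  obtain ⟨g, hg⟩ := (hV hk').lift (shortExact_kernel f') f
  have hge : Epi g := hf'.essential g (by rw [hg]; infer_instance)
  have hkg : S.serre T (kernel g) := by
    obtain ⟨l, hl⟩ : ∃ l : kernel g ⟶ kernel f, l ≫ kernel.ι f = kernel.ι g :=
      ⟨kernel.lift _ (kernel.ι g) (by rw [← hg]; simp), kernel.lift_ι _ _ _⟩
    have : Mono (l ≫ kernel.ι f) := by rw [hl]; infer_instance
    have := mono_of_mono l (kernel.ι f)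
    exact (S.serre T).prop_of_mono l hk
  obtain ⟨s, hs⟩ := hV' hkg _ _ _ (shortExact_kernel g)
  have hse : Epi s := hf.essential s (by rw [← hg, reassoc_of% hs]; infer_instance)
  refine ⟨⟨g, s, ?_, hs⟩⟩
  rw [← cancel_epi s, reassoc_of% hs, Category.comp_id]

/-- Divide `V` by its largest subobject in the class; closure under extensions leaves nothing of the
class in the quotient. -/
lemma exists_torsionFree (h : S.IsFinitary) (T : Set B) (V : R) :
    ∃ (V'' : R) (q : V ⟶ V''), Epi q ∧ S.serre T (kernel q) ∧
      ∀ {W : R} (g : W ⟶ V''), S.serre T W → g = 0 := by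
  obtain ⟨U, i, hi, hU, hl⟩ := h.largest_sub T V
  refine ⟨cokernel i, cokernel.π i, inferInstance, ?_, fun {W} g hW => ?_⟩
  · obtain ⟨l, hl⟩ := (shortExact_cokernel i).exists_lift (kernel.ι (cokernel.π i)) (by simp)
    have : Mono (l ≫ i) := by rw [hl]; infer_instance
    have := mono_of_mono l i
    exact (S.serre T).prop_of_mono l hU
  · obtain ⟨i', w', hS, -⟩ := (shortExact_cokernel i).exists_pullback g
    obtain ⟨l, hl⟩ := hl (pullback.snd g (cokernel.π i))
      ((S.serre T).prop_X₂_of_shortExact hS hU hW)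
    rw [← cancel_epi (pullback.fst g (cokernel.π i)), pullback.condition, ← hl]
    simp

lemma exists_cotorsionFree (h : S.IsFinitary) (T : Set B) (V : R) :
    ∃ (V' : R) (i : V' ⟶ V), Mono i ∧ S.serre T (cokernel i) ∧
      ∀ {W : R} (g : V' ⟶ W), S.serre T W → g = 0 := by
  obtain ⟨V'', q, hq, hk, h0⟩ := exists_torsionFree h.op T (Opposite.op V)
  exact ⟨V''.unop, q.unop, inferInstance, (S.serre T).prop_of_iso (cokernelUnopUnop q).symm
    (S.serre_unop_iff.2 hk), fun g hW =>
      Quiver.Hom.op_inj (h0 g.op (S.serre_op_iff.2 hW))⟩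

/-- Quotients of relatively projective objects by the largest subobject of a kernel without maps
to `S.serre T`. -/
lemma exists_quotient_extVanish (h : S.IsFinitary) (T : Set B) {P L : R} (f : P ⟶ L) [Epi f]
    (hP : ∀ ⦃V : R⦄, S.serre T V → ExtVanish P V) :
    ∃ (X : R) (q : P ⟶ X) (f' : X ⟶ L), Epi q ∧ q ≫ f' = f ∧ S.serre T (kernel f') ∧
      ∀ ⦃V : R⦄, S.serre T V → ExtVanish X V := by
  obtain ⟨K', i, hi, hk, h0⟩ := exists_cotorsionFree h T (kernel f)
  obtain ⟨f', hf'⟩ := (shortExact_cokernel (i ≫ kernel.ι f)).exists_desc f (by simp)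
  refine ⟨cokernel (i ≫ kernel.ι f), cokernel.π _, f', inferInstance, hf', ?_, fun V hV =>
    (hP hV).of_hom_eq_zero_left (shortExact_cokernel (i ≫ kernel.ι f)) fun g => h0 g hV⟩
  -- The map `l` is onto and kills `K'`, so `kernel f'` is a quotient of `kernel f` by `K'`, which
  -- belongs to the class.
  obtain ⟨l, hl⟩ : ∃ l : kernel f ⟶ kernel f', l ≫ kernel.ι f' =
      kernel.ι f ≫ cokernel.π (i ≫ kernel.ι f) :=
    ⟨kernel.lift _ _ (by rw [Category.assoc, hf', kernel.condition]), kernel.lift_ι _ _ _⟩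
  have : Epi l := by
    rw [epi_iff_surjective_up_to_refinements]
    intro A y
    obtain ⟨A', π, hπ, x, hx⟩ := surjective_up_to_refinements_of_epi
      (cokernel.π (i ≫ kernel.ι f)) (y ≫ kernel.ι f')
    obtain ⟨x', rfl⟩ : ∃ x', x' ≫ kernel.ι f = x := by
      refine ⟨kernel.lift f x ?_, kernel.lift_ι _ _ _⟩
      rw [← hf', ← reassoc_of% hx, kernel.condition, comp_zero, comp_zero]
    refine ⟨A', π, hπ, x', ?_⟩
    rw [← cancel_mono (kernel.ι f'), Category.assoc, hx, Category.assoc, Category.assoc, hl]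
  obtain ⟨m, hm⟩ := (shortExact_cokernel i).exists_desc l (by
    rw [← cancel_mono (kernel.ι f'), Category.assoc, hl, zero_comp, ← Category.assoc,
      cokernel.condition])
  have : Epi (cokernel.π i ≫ m) := by rw [hm]; infer_instance
  have := epi_of_epi (cokernel.π i) m
  exact (S.serre T).prop_of_epi m hk

/-- Divide the projective cover of `L b` by the smallest subobject of its radical with quotient in
the class. The head remains essential, since any quotient through which an essential epimorphism
factors still maps essentially. -/
lemma exists_isStd (h : S.IsFinitary) (T : Set B) (b : B) : ∃ X, S.IsStd T b X := by
  obtain ⟨P, f, hP, hf⟩ := h.cover b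
  have := hf.epi
  obtain ⟨X, q, f', hq, hf', hk, hV⟩ := exists_quotient_extVanish h T f
    fun V _ => ExtVanish.of_projective
  refine ⟨X, f', ⟨?_, fun {Q} g hg => ?_⟩, hk, hV⟩
  · have : Epi (q ≫ f') := by rw [hf']; infer_instance
    exact epi_of_epi q f'
  · have h1 : Epi (pullback.snd g q ≫ f) := by
      rw [← hf', ← pullback.condition_assoc]
      exact epi_comp _ _
    have h2 := hf.essential _ h1
    have h3 : Epi (pullback.fst g q ≫ g) := by rw [pullback.condition]; exact epi_comp _ _
    exact epi_of_epi (pullback.fst g q) g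

lemma exists_isCostd (h : S.IsFinitary) (T : Set B) (b : B) : ∃ X, S.IsCostd T b X := by
  obtain ⟨X, hX⟩ := exists_isStd h.op T b
  exact ⟨X.unop, S.isStd_op_iff.1 hX⟩

/-- The measure replaces finite length. Let `M` be the smallest subobject with quotient in R_{< mu}.
A proper subobject `Z` of `M` has a quotient `M/Z` outside R_{< mu}, hence with a factor at `mu`, so
`Z` has smaller measure. The descent ends when `M` is simple. -/
lemma exists_simple_sub (h : S.IsFinitary) {mu : Λ} {V : R} (hV : S.serre {c | S.ρ c ≤ mu} V)
    (hne : ¬ IsZero V) (h0 : ∀ {W : R} (g : W ⟶ V), S.serre {c | S.ρ c < mu} W → g = 0) :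
    ∃ c, S.ρ c = mu ∧ ∃ f : S.L c ⟶ V, Mono f := by
  obtain ⟨D, hD, hpos⟩ := h.measure mu
  induction hn : D V using Nat.strong_induction_on generalizing V with
  | _ n ih =>
  obtain ⟨M, i, hi, hk, hM⟩ := exists_cotorsionFree h {c | S.ρ c < mu} V
  have hMle : S.serre {c | S.ρ c ≤ mu} M := (S.serre _).prop_of_mono i hV
  have hM0 : ¬ IsZero M := by
    intro hz
    apply hne
    have hVlt : S.serre {c | S.ρ c < mu} V := (S.serre _).prop_X₂_of_shortExact
      (shortExact_cokernel i) ((S.serre _).prop_of_isZero hz) hk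
    rw [IsZero.iff_id_eq_zero]
    exact h0 _ hVlt
  by_cases hs : Simple M
  · obtain ⟨c, ⟨e⟩⟩ := S.exhaustive M hs
    have hc : S.ρ c ≤ mu := S.serre_L_iff.1 ((S.serre {c | S.ρ c ≤ mu}).prop_of_iso e hMle)
    refine ⟨c, hc.eq_of_not_lt fun hlt => ?_, e.inv ≫ i, mono_comp _ _⟩
    have := h0 (e.inv ≫ i) (S.serre_L_iff.2 hlt)
    apply hM0
    rw [IsZero.iff_id_eq_zero, ← cancel_epi e.inv, ← cancel_mono i]
    simp [this]
  · obtain ⟨Z, f, hf, hf0, hfi⟩ : ∃ (Z : R) (f : Z ⟶ M), Mono f ∧ f ≠ 0 ∧ ¬ IsIso f := by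
      by_contra! hcon
      refine hs ⟨fun {Z} f hf => ⟨fun hiso h00 => hM0 ?_, fun hf0 => hcon Z f hf hf0⟩⟩
      rw [IsZero.iff_id_eq_zero, ← cancel_epi f, h00]
      simp
    have hC : ¬ S.serre {c | S.ρ c < mu} (cokernel f) := fun hC => hfi (by
      have := Preadditive.epi_of_cokernel_zero (f := f) (hM _ hC)
      exact isIso_of_mono_of_epi f)
    obtain ⟨c, hc, hcm⟩ : ∃ c, IsSubquotient (S.L c) (cokernel f) ∧ ¬ S.ρ c < mu := by
      by_contra! hcon
      exact hC fun b hb => hcon b hb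
    have hCle : S.serre {c | S.ρ c ≤ mu} (cokernel f) :=
      (S.serre _).prop_of_epi (cokernel.π f) hMle
    have hcmu : S.ρ c = mu := (hCle c hc).eq_of_not_lt hcm
    have h1 := hpos c hcmu.ge
    have h2 := hD.le_of_isSubquotient hc
    have h3 := hD.eq_add_cokernel f
    have h4 := hD.le_of_mono i
    obtain ⟨d, hd, g, hg⟩ := ih (D Z) (by omega) (V := Z) ((S.serre _).prop_of_mono f hMle)
      (fun hz => hf0 (hz.eq_of_src _ _)) (fun {W} g hW => by
        rw [← cancel_mono (f ≫ i), h0 (g ≫ f ≫ i) hW, zero_comp]) rfl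
    exact ⟨d, hd, g ≫ f ≫ i, mono_comp _ _⟩

lemma exists_simple_quotient (h : S.IsFinitary) {mu : Λ} {V : R}
    (hV : S.serre {c | S.ρ c ≤ mu} V)
    (hne : ¬ IsZero V) (h0 : ∀ {W : R} (g : V ⟶ W), S.serre {c | S.ρ c < mu} W → g = 0) :
    ∃ c, S.ρ c = mu ∧ ∃ f : V ⟶ S.L c, Epi f := by
  obtain ⟨c, hc, f, hf⟩ := exists_simple_sub h.op (mu := mu) (V := Opposite.op V)
    (S.serre_op_iff.2 hV) (fun hz => hne hz.unop)
    (fun g hW => Quiver.Hom.unop_inj (h0 g.unop (S.serre_unop_iff.2 hW)))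
  exact ⟨c, hc, f.unop, (op_mono_iff f.unop).1 hf⟩

end Stratification

end Finitary

/-! ### Existence and exactness of the adjoints of j^lam. -/

section Adjoints

variable {R : Type u} [Category.{v} R] [Abelian R]

namespace Stratification

variable {B : Type uB} {Λ : Type uL} [PartialOrder Λ] {S : Stratification R B Λ}

lemma serre_le_of_lt {mu : Λ} {V : R} (h : S.serre {c | S.ρ c < mu} V) :
    S.serre {c | S.ρ c ≤ mu} V :=
  S.serre_mono (fun _ hc => le_of_lt hc) h

lemma IsStd.hom_eq_zero {T T' : Set B} {b : B} {X : R} (hX : S.IsStd T b X) (hb : b ∉ T')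
    {V : R} (hV : S.serre T' V) (g : X ⟶ V) : g = 0 := by
  obtain ⟨f, hf, -⟩ := hX
  have := S.simple b
  exact hf.hom_eq_zero (N := S.serre T') (fun h => hb (S.serre_L_iff.1 h)) hV g

/-- The cover is a finite direct sum of objects Δ(c) with ρ c = mu. A simple quotient L(c) of `V`
lifts to a map Δ(c) → V whose cokernel has smaller measure; the cover of the cokernel lifts to `V`
by relative projectivity. -/
lemma exists_relativelyProjective_cover (h : S.IsFinitary) {mu : Λ} {V : R}
    (hV : S.serre {c | S.ρ c ≤ mu} V)
    (h0 : ∀ {W : R} (g : V ⟶ W), S.serre {c | S.ρ c < mu} W → g = 0) :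
    ∃ (Q : R) (e : Q ⟶ V), Epi e ∧ S.serre {c | S.ρ c ≤ mu} Q ∧
      (∀ ⦃W : R⦄, S.serre {c | S.ρ c ≤ mu} W → ExtVanish Q W) ∧
      ∀ {W : R} (g : Q ⟶ W), S.serre {c | S.ρ c < mu} W → g = 0 := by
  obtain ⟨D, hD, hpos⟩ := h.measure mu
  induction hn : D V using Nat.strong_induction_on generalizing V with
  | _ n ih =>
  by_cases hz : IsZero V
  · exact ⟨V, 𝟙 V, inferInstance, hV, fun W _ => ExtVanish.of_isZero_left hz,
      fun g _ => hz.eq_of_src _ _⟩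
  obtain ⟨c, rfl, f, hf⟩ := exists_simple_quotient h hV hz h0
  obtain ⟨X, hX⟩ := exists_isStd h {d | S.ρ d ≤ S.ρ c} c
  have hXle : S.serre {d | S.ρ d ≤ S.ρ c} X := hX.serre (T' := {d | S.ρ d ≤ S.ρ c}) subset_rfl (le_refl (S.ρ c))
  have hX0 : ∀ {W : R} (g : X ⟶ W), S.serre {d | S.ρ d < S.ρ c} W → g = 0 :=
    fun g hW => hX.hom_eq_zero (fun h : S.ρ c < S.ρ c => lt_irrefl _ h) hW g
  obtain ⟨p, hp, -, hXV⟩ := hX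
  have := hp.epi
  obtain ⟨t, ht⟩ := (hXV ((S.serre _).prop_of_mono (kernel.ι f) hV)).lift (shortExact_kernel f) p
  have hlt : D (cokernel t) < D V := by
    have h1 := hD.eq_kernel_add (cokernel.π t)
    have h2 : Epi (Abelian.image.ι t ≫ f) := by
      have : Epi (Abelian.factorThruImage t ≫ Abelian.image.ι t ≫ f) := by
        rw [← Category.assoc, Abelian.image.fac, ht]; infer_instance
      exact epi_of_epi (Abelian.factorThruImage t) _
    have h3 : 0 < D (kernel (cokernel.π t)) :=
      (hpos c le_rfl).trans_le (hD.le_of_epi (Abelian.image.ι t ≫ f))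
    omega
  obtain ⟨Q, e, he, hQle, hQ, hQ0⟩ := ih _ (hn ▸ hlt)
    ((S.serre _).prop_of_epi (cokernel.π t) hV)
    (fun g hW => by rw [← cancel_epi (cokernel.π t), h0 (cokernel.π t ≫ g) hW, comp_zero]) rfl
  obtain ⟨l, hl⟩ := (hQ ((S.serre _).prop_of_mono (kernel.ι (cokernel.π t)) hV)).lift
    (shortExact_kernel (cokernel.π t)) e
  have hS : (ShortComplex.mk (biprod.inl : X ⟶ X ⊞ Q) biprod.snd (by simp)).ShortExact :=
    shortExact_of_lift _ _ _ fun s hs => ⟨s ≫ biprod.fst, by ext <;> simp [hs]⟩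
  refine ⟨X ⊞ Q, biprod.desc t l, ?_, (S.serre _).prop_X₂_of_shortExact hS hXle hQle,
    fun W hW => ExtVanish.middle_left hS (hXV hW) (hQ hW), fun g hW => ?_⟩
  · refine Preadditive.epi_of_cancel_zero _ fun g hg => ?_
    have h1 : t ≫ g = 0 := by simpa using biprod.inl ≫= hg
    have h2 : l ≫ g = 0 := by simpa using biprod.inr ≫= hg
    have h3 : e ≫ cokernel.desc t g h1 = 0 := by rw [← hl, Category.assoc, cokernel.π_desc, h2]
    rw [← cokernel.π_desc t g h1, (cancel_epi e).1 (h3.trans comp_zero.symm), comp_zero]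
  · ext
    · rw [hX0 (biprod.inl ≫ g) hW, comp_zero]
    · rw [hQ0 (biprod.inr ≫ g) hW, comp_zero]

/-- Discard a quotient of `V` in R_{< mu}, cover the remaining subobject by a relatively projective
`Q`, then divide `Q` by the part of the kernel that has no maps to R_{< mu}. The quotient has lost
the extensions by R_{< mu} and differs from `V` only by objects of R_{< mu}. -/
lemma exists_leftClosed (h : S.IsFinitary) {mu : Λ} {V : R} (hV : S.serre {c | S.ρ c ≤ mu} V) :
    ∃ (X : R) (f : X ⟶ V), S.serre {c | S.ρ c ≤ mu} X ∧ LeftClosed (S.serre {c | S.ρ c < mu}) X ∧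
      S.serre {c | S.ρ c < mu} (kernel f) ∧ S.serre {c | S.ρ c < mu} (cokernel f) := by
  obtain ⟨V', i, hi, hcok, h0⟩ := exists_cotorsionFree h {c | S.ρ c < mu} V
  have hV' : S.serre {c | S.ρ c ≤ mu} V' := (S.serre _).prop_of_mono i hV
  obtain ⟨Q, e, he, hQle, hQ, hQ0⟩ := exists_relativelyProjective_cover h hV' h0
  obtain ⟨X, q, f, hq, hf, hk, hX⟩ := exists_quotient_extVanish h {c | S.ρ c < mu} e
    fun W hW => hQ (serre_le_of_lt hW)
  have hfe : Epi f := by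
    have : Epi (q ≫ f) := by rw [hf]; exact he
    exact epi_of_epi q f
  exact ⟨X, f ≫ i, (S.serre _).prop_of_epi q hQle,
    ⟨fun hW g => by rw [← cancel_epi q, hQ0 (q ≫ g) hW, comp_zero], fun hW => hX hW⟩,
    (S.serre _).prop_of_iso (kernelCompMono f i).symm hk,
    (S.serre _).prop_of_iso (cokernelEpiComp f i).symm hcok⟩

lemma exists_rightClosed (h : S.IsFinitary) {mu : Λ} {V : R}
    (hV : S.serre {c | S.ρ c ≤ mu} V) :
    ∃ (X : R) (f : V ⟶ X), S.serre {c | S.ρ c ≤ mu} X ∧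
      RightClosed (S.serre {c | S.ρ c < mu}) X ∧
      S.serre {c | S.ρ c < mu} (kernel f) ∧ S.serre {c | S.ρ c < mu} (cokernel f) := by
  obtain ⟨X, f, hX, hcl, hk, hc⟩ := exists_leftClosed h.op (mu := mu) (V := Opposite.op V)
    (S.serre_op_iff.2 hV)
  refine ⟨X.unop, f.unop, S.serre_unop_iff.2 hX,
    ⟨fun {W} hW g => Quiver.Hom.op_inj (hcl.hom_eq_zero (S.serre_op_iff.2 hW) g.op),
      fun {W} hW => (hcl.ext (S.serre_op_iff.2 hW)).unop⟩,
    (S.serre _).prop_of_iso (kernelUnopUnop f).symm (S.serre_unop_iff.2 hc),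
    (S.serre _).prop_of_iso (cokernelUnopUnop f).symm (S.serre_unop_iff.2 hk)⟩

lemma leftClosed_ltIn_iff {mu : Λ} {X : S.Le mu} :
    LeftClosed (S.ltIn mu) X ↔ LeftClosed (S.serre {c | S.ρ c < mu}) X.obj where
  mp h :=
    { hom_eq_zero := fun {V} hV g => congr_arg (S.serre {c | S.ρ c ≤ mu}).ι.map
        (h.hom_eq_zero (V := ⟨V, serre_le_of_lt hV⟩) hV (ObjectProperty.homMk g))
      ext := fun {V} hV => extVanish_fullSubcategory_iff.1
        (h.ext (V := ⟨V, serre_le_of_lt hV⟩) hV) }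
  mpr h :=
    { hom_eq_zero := fun hV g => (S.serre {c | S.ρ c ≤ mu}).ι.map_injective
        (h.hom_eq_zero hV g.hom)
      ext := fun hV => extVanish_fullSubcategory_iff.2 (h.ext hV) }

lemma rightClosed_ltIn_iff {mu : Λ} {X : S.Le mu} :
    RightClosed (S.ltIn mu) X ↔ RightClosed (S.serre {c | S.ρ c < mu}) X.obj where
  mp h :=
    { hom_eq_zero := fun {V} hV g => congr_arg (S.serre {c | S.ρ c ≤ mu}).ι.map
        (h.hom_eq_zero (V := ⟨V, serre_le_of_lt hV⟩) hV (ObjectProperty.homMk g))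
      ext := fun {V} hV => extVanish_fullSubcategory_iff.1
        (h.ext (V := ⟨V, serre_le_of_lt hV⟩) hV) }
  mpr h :=
    { hom_eq_zero := fun hV g => (S.serre {c | S.ρ c ≤ mu}).ι.map_injective
        (h.hom_eq_zero hV g.hom)
      ext := fun hV => extVanish_fullSubcategory_iff.2 (h.ext hV) }

lemma isoModSerre_ltIn_iff {mu : Λ} {X Y : S.Le mu} (f : X ⟶ Y) :
    (S.ltIn mu).isoModSerre f ↔ S.serre {c | S.ρ c < mu} (kernel f.hom) ∧
      S.serre {c | S.ρ c < mu} (cokernel f.hom) := by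
  rw [ObjectProperty.isoModSerre_iff]
  exact and_congr
    ((S.serre _).prop_iff_of_iso (PreservesKernel.iso (S.serre {c | S.ρ c ≤ mu}).ι f))
    ((S.serre _).prop_iff_of_iso (PreservesCokernel.iso (S.serre {c | S.ρ c ≤ mu}).ι f))

theorem isRightAdjoint_j (h : S.IsFinitary) (mu : Λ) : (S.j mu).IsRightAdjoint := by
  refine isRightAdjoint_of_leftClosed (N := S.ltIn mu) _ fun V => ?_
  obtain ⟨X, f, hX, hcl, hkc⟩ := exists_leftClosed h V.property
  exact ⟨⟨X, hX⟩, ObjectProperty.homMk f, leftClosed_ltIn_iff.2 hcl,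
    (isoModSerre_ltIn_iff _).2 hkc⟩

theorem isLeftAdjoint_j (h : S.IsFinitary) (mu : Λ) : (S.j mu).IsLeftAdjoint := by
  refine isLeftAdjoint_of_rightClosed (N := S.ltIn mu) _ fun V => ?_
  obtain ⟨X, f, hX, hcl, hkc⟩ := exists_rightClosed h V.property
  exact ⟨⟨X, hX⟩, ObjectProperty.homMk f, rightClosed_ltIn_iff.2 hcl,
    (isoModSerre_ltIn_iff _).2 hkc⟩

/-- In `R_{≤ mu}`, kernels of epimorphisms between left closed objects are left closed. -/
def KernelClosed (S : Stratification R B Λ) (mu : Λ) : Prop :=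
  ∀ ⦃Z' Z Z'' : R⦄ (a : Z' ⟶ Z) (b : Z ⟶ Z'') (w : a ≫ b = 0),
    (ShortComplex.mk a b w).ShortExact → S.serre {c | S.ρ c ≤ mu} Z →
      LeftClosed (S.serre {c | S.ρ c < mu}) Z → LeftClosed (S.serre {c | S.ρ c < mu}) Z'' →
        LeftClosed (S.serre {c | S.ρ c < mu}) Z'

lemma exactFunctor_of_kernelClosed {mu : Λ} (h : S.KernelClosed mu)
    {F : S.Stratum mu ⥤ S.Le mu} (adj : F ⊣ S.j mu) : exactFunctor _ _ F :=
  exactFunctor_of_leftClosed_kernel (N := S.ltIn mu) adj fun {_ Z _} _ _ _ hE hZ hZ'' =>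
    leftClosed_ltIn_iff.2 (h _ _ _ (hE.map_of_exact (S.serre {c | S.ρ c ≤ mu}).ι) Z.property
      (leftClosed_ltIn_iff.1 hZ) (leftClosed_ltIn_iff.1 hZ''))

lemma exactFunctor_of_op_kernelClosed {mu : Λ} (h : S.op.KernelClosed mu)
    {G : S.Stratum mu ⥤ S.Le mu} (adj : S.j mu ⊣ G) : exactFunctor _ _ G :=
  exactFunctor_of_rightClosed_cokernel (N := S.ltIn mu) (S.j mu) adj fun {_ Z _} _ _ _ hE hZ' hZ => by
    rw [rightClosed_ltIn_iff] at hZ hZ' ⊢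
    have key {X : R} : RightClosed (S.serre {c | S.ρ c < mu}) X ↔
        LeftClosed (S.op.serre {c | S.ρ c < mu}) (Opposite.op X) :=
      ⟨fun hX => ⟨fun hV g => Quiver.Hom.unop_inj (hX.hom_eq_zero (S.serre_unop_iff.2 hV) g.unop),
        fun hV => (hX.ext (S.serre_unop_iff.2 hV)).op⟩,
      fun hX => ⟨fun hV g => Quiver.Hom.op_inj (hX.hom_eq_zero (S.serre_op_iff.2 hV) g.op),
        fun hV => (hX.ext (S.serre_op_iff.2 hV)).unop⟩⟩
    rw [key] at hZ hZ' ⊢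
    exact h _ _ _ (hE.map_of_exact (S.serre {c | S.ρ c ≤ mu}).ι).op
      (S.serre_op_iff.2 Z.property) hZ hZ'

end Stratification

end Adjoints

/-! ### Flags, their opposites, and vanishing along them. -/

section Flags

variable {R : Type u} [Category.{v} R] [Abelian R] {B : Type uB} {Sec : B → R → Prop}

lemma HasFlag.mono {Sec' : B → R → Prop} (h : ∀ b X, Sec b X → Sec' b X) {l : List B} {V : R}
    (hV : HasFlag Sec l V) : HasFlag Sec' l V := by
  induction hV with
  | zero hz => exact .zero hz
  | cons i p w hE hU hW ih => exact .cons i p w hE ih (h _ _ hW)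

/-- Flags grow by adding a section at the top, and reversing arrows turns this into adding one at
the bottom. The induction restricts the extension to the penultimate step of the flag of `W`. -/
lemma HasFlag.append_bottom {l : List B} {W : R} (hW : HasFlag Sec l W) {U V : R} (i : U ⟶ V)
    (p : V ⟶ W) (w : i ≫ p = 0) (hE : (ShortComplex.mk i p w).ShortExact) {b : B}
    (hU : Sec b U) : HasFlag Sec (l ++ [b]) V := by
  induction hW generalizing U V with
  | zero hz =>
    have := hE.mono_f
    obtain ⟨z, hz0⟩ : ∃ z : R, IsZero z := ⟨_, isZero_zero R⟩
    obtain ⟨r, hr⟩ := hE.exists_lift (𝟙 V) (hz.eq_of_tgt _ _)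
    have hr' : i ≫ r = 𝟙 U := by
      rw [← cancel_mono i, Category.assoc, hr, Category.id_comp, Category.comp_id]
    have : Epi r := epi_of_epi_fac hr'
    have : Mono r := mono_of_mono_fac hr
    have : Mono (0 : z ⟶ V) := ⟨fun _ _ _ => hz0.eq_of_tgt _ _⟩
    refine .cons (0 : z ⟶ V) r zero_comp ?_ (.zero hz0) hU
    refine shortExact_of_lift _ _ _ fun t ht => ⟨0, ?_⟩
    rw [← cancel_mono r, ht, zero_comp, zero_comp]
  | @cons U' W W' i' p' w' hE' b' l hU' hW' ih =>
    have : Mono i' := hE'.mono_f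
    have : Epi p' := hE'.epi_g
    have : Epi p := hE.epi_g
    obtain ⟨i'', w'', hS, -⟩ := hE.exists_pullback i'
    refine .cons (pullback.snd i' p) (p ≫ p') ?_ ?_ (ih i'' _ w'' hS hU) hW'
    · rw [← pullback.condition_assoc, w', comp_zero]
    · refine shortExact_of_lift _ _ _ fun t ht => ?_
      obtain ⟨l, hl⟩ := hE'.exists_lift (t ≫ p) (by rw [Category.assoc, ht])
      exact ⟨pullback.lift l t hl, pullback.lift_snd _ _ _⟩

lemma HasFlag.op {Sec' : B → Rᵒᵖ → Prop} (h : ∀ b X, Sec b X → Sec' b (Opposite.op X))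
    {l : List B} {V : R} (hV : HasFlag Sec l V) : HasFlag Sec' l.reverse (Opposite.op V) := by
  induction hV with
  | zero hz => exact .zero hz.op
  | cons i p w hE hU hW ih =>
    rw [List.reverse_cons]
    exact ih.append_bottom _ _ _ hE.op (h _ _ hW)

lemma HasFlag.unop {Sec' : B → Rᵒᵖ → Prop} (h : ∀ b X, Sec' b X → Sec b X.unop)
    {l : List B} {V : Rᵒᵖ} (hV : HasFlag Sec' l V) : HasFlag Sec l.reverse V.unop := by
  induction hV with
  | zero hz => exact .zero hz.unop
  | cons i p w hE hU hW ih =>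
    rw [List.reverse_cons]
    exact ih.append_bottom _ _ _ hE.unop (h _ _ hW)

lemma HasFlag.hom_eq_zero {V : R} {l : List B} {K : R} (hK : HasFlag Sec l K)
    (h : ∀ c ∈ l, ∀ X, Sec c X → ∀ g : X ⟶ V, g = 0) (g : K ⟶ V) : g = 0 := by
  induction hK with
  | zero hz => exact hz.eq_of_src _ _
  | cons i p w hE hU hW ih =>
    have h1 := ih (fun c hc => h c (List.mem_cons_of_mem _ hc)) (i ≫ g)
    obtain ⟨l, rfl⟩ := hE.exists_desc g h1
    rw [h _ List.mem_cons_self _ hW l, comp_zero]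

lemma HasFlag.extVanish {V : R} {l : List B} {K : R} (hK : HasFlag Sec l K)
    (h : ∀ c ∈ l, ∀ X, Sec c X → ExtVanish X V) : ExtVanish K V := by
  induction hK with
  | zero hz => exact ExtVanish.of_isZero_left hz
  | cons i p w hE hU hW ih =>
    exact (ih fun c hc => h c (List.mem_cons_of_mem _ hc)).middle_left hE
      (h _ List.mem_cons_self _ hW)

end Flags

/-! ### The uniform description of Δ_ε and ∇_ε, and duality of the four conditions. -/

section Key

variable {R : Type u} [Category.{v} R] [Abelian R]

namespace Stratification

variable {B : Type uB} {Λ : Type uL} [PartialOrder Λ] (S : Stratification R B Λ)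

/-- The indices of the irreducible objects that may occur in the radical of `Δ_ε(b)`, for `b` with
`ρ b = lam`. -/
def radicalIndices (ε : Λ → ℤˣ) (lam : Λ) : Set B :=
  {c | S.ρ c < lam ∨ (ε lam = 1 ∧ S.ρ c = lam)}

variable {S} {ε : Λ → ℤˣ}

lemma radicalIndices_of_eq_one {lam : Λ} (h : ε lam = 1) :
    S.radicalIndices ε lam = {c | S.ρ c ≤ lam} := by
  ext c
  simp [radicalIndices, h, le_iff_lt_or_eq]

lemma radicalIndices_of_eq_neg_one {lam : Λ} (h : ε lam = -1) :
    S.radicalIndices ε lam = {c | S.ρ c < lam} := by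
  ext c
  simp [radicalIndices, h, show ¬ (-1 : ℤˣ) = 1 by decide]

lemma radicalIndices_subset (lam : Λ) : S.radicalIndices ε lam ⊆ {c | S.ρ c ≤ lam} := by
  rintro c (h | h)
  · exact h.le
  · exact h.2.le

/-- From here on the sign enters only through the index set, and no quotient category or adjoint
appears in the arguments. -/
lemma isEpsStandard_iff (h : S.IsFinitary) {b : B} {X : R} :
    S.IsEpsStandard ε b X ↔ S.IsStd (S.radicalIndices ε (S.ρ b)) b X := by
  rw [IsEpsStandard, S.isStandard_iff (isRightAdjoint_j h),
    S.isProperStandard_iff (isRightAdjoint_j h)]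
  have h1 : ¬ (-1 : ℤˣ) = 1 := by decide
  have h2 : ¬ (1 : ℤˣ) = -1 := by decide
  rcases Int.units_eq_one_or (ε (S.ρ b)) with hε | hε
  · simp [radicalIndices_of_eq_one hε, hε, h2]
  · simp [radicalIndices_of_eq_neg_one hε, hε, h1]

lemma isEpsCostandard_iff (h : S.IsFinitary) {b : B} {X : R} :
    S.IsEpsCostandard ε b X ↔ S.IsCostd (S.radicalIndices (-ε) (S.ρ b)) b X := by
  rw [IsEpsCostandard, S.isCostandard_iff (isLeftAdjoint_j h),
    S.isProperCostandard_iff (isLeftAdjoint_j h)]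
  have h1 : ¬ (-1 : ℤˣ) = 1 := by decide
  have h2 : ¬ (1 : ℤˣ) = -1 := by decide
  rcases Int.units_eq_one_or (ε (S.ρ b)) with hε | hε
  · have : (-ε) (S.ρ b) = -1 := by simp [hε]
    simp [radicalIndices_of_eq_neg_one this, hε, h2]
  · have : (-ε) (S.ρ b) = 1 := by simp [hε]
    simp [radicalIndices_of_eq_one this, hε, h1]

lemma isEpsStandard_op_iff (h : S.IsFinitary) {b : B} {X : R} :
    S.op.IsEpsStandard (-ε) b (Opposite.op X) ↔ S.IsEpsCostandard ε b X := by
  rw [isEpsStandard_iff h.op, isEpsCostandard_iff h]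
  exact S.isStd_op_iff

lemma isEpsCostandard_op_iff (h : S.IsFinitary) {b : B} {X : R} :
    S.op.IsEpsCostandard (-ε) b (Opposite.op X) ↔ S.IsEpsStandard ε b X := by
  rw [isEpsCostandard_iff h.op, isEpsStandard_iff h, neg_neg]
  exact S.isCostd_op_iff

lemma hatPDelta_op_iff (h : S.IsFinitary) : S.op.HatPDelta (-ε) ↔ S.HatINabla ε := by
  constructor
  · intro H b
    obtain ⟨P, l, hP, hl, hb⟩ := H b
    refine ⟨P.unop, l.reverse, ?_, ?_, fun c hc => hb c (List.mem_reverse.1 hc)⟩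
    · have : Projective (Opposite.op P.unop) := hP
      exact (Injective.injective_iff_projective_op).2 this
    · have := hl.unop (Sec := S.IsEpsCostandard ε) fun b X => (isEpsStandard_op_iff h).1
      rwa [List.reverse_cons] at this
  · intro H b
    obtain ⟨J, l, hJ, hl, hb⟩ := H b
    refine ⟨Opposite.op J, l.reverse, Injective.injective_iff_projective_op.1 hJ, ?_,
      fun c hc => hb c (List.mem_reverse.1 hc)⟩
    have := hl.op (Sec' := S.op.IsEpsStandard (-ε)) fun b X => (isEpsStandard_op_iff h).2
    rwa [List.reverse_append] at this

lemma pDelta_op_iff (h : S.IsFinitary) : S.op.PDelta (-ε) ↔ S.INabla ε := by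
  constructor
  · intro H b
    obtain ⟨P, f, l, hf, hl, hb⟩ := H b
    exact ⟨P.unop, f.unop, l.reverse, (isProjectiveCover_op_iff _).1 hf,
      hl.unop (Sec := S.IsEpsCostandard ε) fun b X => (isEpsStandard_op_iff h).1, fun c hc => hb c (List.mem_reverse.1 hc)⟩
  · intro H b
    obtain ⟨J, f, l, hf, hl, hb⟩ := H b
    exact ⟨Opposite.op J, f.op, l.reverse, (isProjectiveCover_op_iff _).2 hf,
      hl.op (Sec' := S.op.IsEpsStandard (-ε)) fun b X => (isEpsStandard_op_iff h).2, fun c hc => hb c (List.mem_reverse.1 hc)⟩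

lemma iNabla_op_iff (h : S.IsFinitary) : S.op.INabla (-ε) ↔ S.PDelta ε := by
  constructor
  · intro H b
    obtain ⟨P, f, l, hf, hl, hb⟩ := H b
    exact ⟨P.unop, f.unop, l.reverse, (isInjectiveHull_op_iff _).1 hf,
      hl.unop (Sec := S.IsEpsStandard ε) fun b X => (isEpsCostandard_op_iff h).1, fun c hc => hb c (List.mem_reverse.1 hc)⟩
  · intro H b
    obtain ⟨J, f, l, hf, hl, hb⟩ := H b
    exact ⟨Opposite.op J, f.op, l.reverse, (isInjectiveHull_op_iff _).2 hf,
      hl.op (Sec' := S.op.IsEpsCostandard (-ε)) fun b X => (isEpsCostandard_op_iff h).2, fun c hc => hb c (List.mem_reverse.1 hc)⟩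

lemma PDelta.hatPDelta (h : S.IsFinitary) (H : S.PDelta ε) : S.HatPDelta ε := by
  intro b
  obtain ⟨P, f, l, hf, hl, hb⟩ := H b
  have := hf.epi
  have := S.simple b
  cases hl with
  | zero hz => exact (Simple.not_isZero (S.L b) (hz.of_epi f)).elim
  | @cons U V W i p w hE c l hU hW =>
    have hc : c = b := by
      by_contra hne
      obtain ⟨g, hg, -⟩ := (isEpsStandard_iff h).1 hW
      have : Epi p := hE.epi_g
      have := hg.epi
      have := S.simple c
      -- The head of the top section is a simple quotient of the projective cover of `L b`. A head
      -- `L c` with `c ≠ b` would lie in the Serre class of objects without factor `L b`, to which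
      -- the cover has no nonzero map.
      have h0 := EssEpi.hom_eq_zero (N := S.serre {d | d ≠ b}) ⟨hf.epi, hf.essential⟩
        (fun h => (S.serre_L_iff (T := {d | d ≠ b}).1 h) rfl)
        (S.serre_L_iff (T := {d | d ≠ b}).2 hne) (p ≫ g)
      have : Epi (0 : P ⟶ S.L c) := by rw [← h0]; infer_instance
      exact Simple.not_isZero _ (IsZero.of_epi_zero P (S.L c))
    subst hc
    exact ⟨P, l, hf.projective, .cons i p w hE hU hW,
      fun d hd => hb d (List.mem_cons_of_mem _ hd)⟩

lemma INabla.hatINabla (h : S.IsFinitary) (H : S.INabla ε) : S.HatINabla ε :=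
  (hatPDelta_op_iff h).1 (((pDelta_op_iff h).2 H).hatPDelta h.op)

end Stratification

end Key

/-! ### From projectives with Δ_ε-flags to injective hulls with ∇_ε-flags. -/

section Key

variable {R : Type u} [Category.{v} R] [Abelian R]

namespace Stratification

variable {B : Type uB} {Λ : Type uL} [PartialOrder Λ] {S : Stratification R B Λ} {ε : Λ → ℤˣ}

lemma HatPDelta.exists_cover (h : S.IsFinitary) (H : S.HatPDelta ε) {b : B} {X : R}
    (hX : S.IsStd (S.radicalIndices ε (S.ρ b)) b X) :
    ∃ (P K : R) (k : K ⟶ P) (q : P ⟶ X) (w : k ≫ q = 0) (l : List B), Projective P ∧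
      (ShortComplex.mk k q w).ShortExact ∧
      HasFlag (fun c => S.IsStd (S.radicalIndices ε (S.ρ c)) c) l K ∧
      ∀ c ∈ l, S.ρ b ≤ S.ρ c := by
  obtain ⟨P, l, hP, hl, hb⟩ := H b
  have hl' := hl.mono fun b X => (isEpsStandard_iff h).1
  cases hl' with
  | @cons K _ W k q w hE _ _ hK hW =>
    obtain ⟨e⟩ := hW.nonempty_iso hX
    have := hE.mono_f
    have : Epi q := hE.epi_g
    refine ⟨P, K, k, q ≫ e.hom, by rw [reassoc_of% w, zero_comp], l, hP, ?_, hK, hb⟩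
    refine shortExact_of_lift _ _ _ fun t ht => hE.exists_lift t ?_
    rw [← cancel_mono e.hom, Category.assoc, ht, zero_comp]

lemma IsStd.hom_eq_zero_of_not_le {T : Set B} {b c : B} {X : R} (hX : S.IsStd T c X)
    (hbc : S.ρ b ≤ S.ρ c) {V : R} (hV : S.serre {d | ¬ S.ρ b ≤ S.ρ d} V) (g : X ⟶ V) : g = 0 :=
  hX.hom_eq_zero (T' := {d | ¬ S.ρ b ≤ S.ρ d}) (fun h => h hbc) hV g

/-- The kernel of the projective onto `X` has sections with heads L(c), ρ c ≥ ρ b, none of which is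
a factor of `V`; so it has no nonzero map to `V`. -/
lemma HatPDelta.extVanish (h : S.IsFinitary) (H : S.HatPDelta ε) {b : B} {X : R}
    (hX : S.IsStd (S.radicalIndices ε (S.ρ b)) b X) {V : R}
    (hV : S.serre {d | ¬ S.ρ b ≤ S.ρ d} V) : ExtVanish X V := by
  obtain ⟨P, K, k, q, w, l, hP, hE, hK, hb⟩ := H.exists_cover h hX
  exact ExtVanish.of_projective.of_hom_eq_zero_left hE
    (hK.hom_eq_zero fun c hc X hX => hX.hom_eq_zero_of_not_le (hb c hc) hV)

lemma HatPDelta.extVanish_of_hasFlag (h : S.IsFinitary) (H : S.HatPDelta ε) {b : B} {K : R}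
    {l : List B} (hK : HasFlag (fun c => S.IsStd (S.radicalIndices ε (S.ρ c)) c) l K)
    (hl : ∀ c ∈ l, S.ρ b ≤ S.ρ c) {V : R}
    (hV : S.serre {d | ¬ S.ρ b ≤ S.ρ d} V) : ExtVanish K V :=
  hK.extVanish fun c hc _ hX => H.extVanish h hX
    (S.serre_mono (T := {d | ¬ S.ρ b ≤ S.ρ d})
      (T' := {d | ¬ S.ρ c ≤ S.ρ d}) (fun _ hd hcd => hd ((hl c hc).trans hcd)) hV)

lemma HatPDelta.extVanish_costd (h : S.IsFinitary) (H : S.HatPDelta ε) {b c : B} {X Y : R}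
    (hX : S.IsStd (S.radicalIndices ε (S.ρ b)) b X)
    (hY : S.IsCostd (S.radicalIndices (-ε) (S.ρ c)) c Y) : ExtVanish X Y := by
  have hYle : S.serre {d | S.ρ d ≤ S.ρ c} Y :=
    hY.serre (T' := {d | S.ρ d ≤ S.ρ c}) (radicalIndices_subset _) (le_refl (S.ρ c))
  have hXle : S.serre {d | S.ρ d ≤ S.ρ b} X :=
    hX.serre (T' := {d | S.ρ d ≤ S.ρ b}) (radicalIndices_subset _) (le_refl (S.ρ b))
  by_cases hbc : S.ρ b ≤ S.ρ c
  -- Either `X` is relatively projective in R_{≤ ρ c}, or `X` lies in the class against which `Y` is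
  -- relatively injective. For ρ b < ρ c the second holds for either sign; for equality the sign
  -- decides.
  · have hcase : S.radicalIndices ε (S.ρ b) = {d | S.ρ d ≤ S.ρ c} ∨
        {d | S.ρ d ≤ S.ρ b} ⊆ S.radicalIndices (-ε) (S.ρ c) := by
      rcases hbc.lt_or_eq with hlt | heq
      · exact Or.inr fun d hd => Or.inl (lt_of_le_of_lt hd hlt)
      · rw [heq]
        rcases Int.units_eq_one_or (ε (S.ρ c)) with hε | hε
        · exact Or.inl (radicalIndices_of_eq_one hε)
        · exact Or.inr (radicalIndices_of_eq_one (ε := -ε) (by simp [hε])).ge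
    rcases hcase with hT | hT
    · obtain ⟨_, -, -, hV⟩ := hX
      exact hV (hT ▸ hYle)
    · obtain ⟨_, -, -, hV⟩ := hY
      exact hV (S.serre_mono hT hXle)
  · exact H.extVanish h hX (S.serre_mono (fun d hd hbd => hbc (le_trans hbd hd)) hYle)

/-- If L(d) is a subquotient of `V`, the projective P_d has a nonzero map to `V`, so some section of
its flag does. -/
lemma HatPDelta.exists_hom_ne_zero (h : S.IsFinitary) (H : S.HatPDelta ε) {V : R}
    (hV : ¬ IsZero V) : ∃ (d : B) (X : R), S.IsStd (S.radicalIndices ε (S.ρ d)) d X ∧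
      ∃ g : X ⟶ V, g ≠ 0 := by
  by_contra! h0
  obtain ⟨d, Y, i, p, hi, hp⟩ := h.exists_subquotient hV
  obtain ⟨X, hX⟩ := exists_isStd h (S.radicalIndices ε (S.ρ d)) d
  obtain ⟨P, K, k, q, w, l, hP, hE, hK, hb⟩ := H.exists_cover h hX
  have hP0 : HasFlag (fun c => S.IsStd (S.radicalIndices ε (S.ρ c)) c) (d :: l) P :=
    .cons k q w hE hK hX
  obtain ⟨f, hf, -⟩ := hX
  have : Epi q := hE.epi_g
  have := hf.epi
  have := S.simple d
  have h1 := hP0.hom_eq_zero (V := V) (fun c _ X hX => h0 c X hX)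
    (Projective.factorThru (q ≫ f) p ≫ i)
  have h2 : Projective.factorThru (q ≫ f) p = 0 := by
    rw [← cancel_mono i, h1, zero_comp]
  have h3 : q ≫ f = 0 := by rw [← Projective.factorThru_comp (q ≫ f) p, h2, zero_comp]
  have : Epi (0 : P ⟶ S.L d) := by rw [← h3]; infer_instance
  exact Simple.not_isZero _ (IsZero.of_epi_zero P (S.L d))

lemma isZero_image_iff {X Y : R} (f : X ⟶ Y) : IsZero (Abelian.image f) ↔ f = 0 := by
  constructor
  · intro h
    rw [← Abelian.image.fac f, h.eq_of_tgt (Abelian.factorThruImage f) 0, zero_comp]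
  · rintro rfl
    rw [IsZero.iff_id_eq_zero, ← cancel_mono (Abelian.image.ι _),
      ← cancel_epi (Abelian.factorThruImage (0 : X ⟶ Y))]
    simp

/-- A nonzero map from an object of a Serre class to `V` yields a nonzero map to `V` from a
standard object whose index lies in that class. -/
lemma HatPDelta.exists_hom_ne_zero_of_serre (h : S.IsFinitary) (H : S.HatPDelta ε) {T : Set B}
    {W V : R} (hW : S.serre T W) {g : W ⟶ V} (hg : g ≠ 0) :
    ∃ d ∈ T, ∃ X : R, S.IsStd (S.radicalIndices ε (S.ρ d)) d X ∧ ∃ g : X ⟶ V, g ≠ 0 := by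
  obtain ⟨d, X, hX, t, ht⟩ := H.exists_hom_ne_zero h (mt (isZero_image_iff g).1 hg)
  have hI : S.serre T (Abelian.image g) :=
    (S.serre T).prop_of_epi (Abelian.factorThruImage g) hW
  refine ⟨d, ?_, X, hX, t ≫ Abelian.image.ι g, fun h0 => ht ?_⟩
  · by_contra hd
    exact ht (hX.hom_eq_zero hd hI t)
  · rw [← cancel_mono (Abelian.image.ι g), h0, zero_comp]

/-- This supplies Ext¹(∇_ε(c)/L(c), V) = 0 for ρ c = mu, although only extensions of Δ_ε's by `V`
are controlled. A nonzero map from some Δ_ε(d) to the cokernel lifts to `E`, and the lift provides a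
piece of `E` disjoint from `V` that can be divided out, lowering the measure. -/
lemma HatPDelta.exists_retraction (h : S.IsFinitary) (H : S.HatPDelta ε) {mu : Λ} {V : R}
    (hacyc : ∀ (d : B) (X : R), S.ρ d ≤ mu → S.IsStd (S.radicalIndices ε (S.ρ d)) d X →
      ExtVanish X V)
    (h0 : ∀ {W : R} (g : W ⟶ V), S.serre {c | S.ρ c < mu} W → g = 0)
    {D : R → ℕ} (hD : IsAdditiveMeasure D) (hpos : ∀ c, mu ≤ S.ρ c → 0 < D (S.L c))
    {E : R} (i : V ⟶ E) [Mono i] (hC : S.serre (S.radicalIndices (-ε) mu) (cokernel i)) :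
    ∃ r : E ⟶ V, i ≫ r = 𝟙 V := by
  induction hn : D E using Nat.strong_induction_on generalizing E with
  | _ n ih =>
  -- Since `V` has no subobject in R_{< mu}, it still embeds after the largest such subobject of `E`
  -- is divided out.
  obtain ⟨E', q, hq, hk, hE'⟩ := exists_torsionFree h {c | S.ρ c < mu} E
  have hm : Mono (i ≫ q) := by
    refine Preadditive.mono_of_cancel_zero (i ≫ q) fun {W} g hg => ?_
    obtain ⟨l, hl⟩ : ∃ l, l ≫ kernel.ι q = kernel.ι (i ≫ q) ≫ i :=
      ⟨kernel.lift _ _ (by rw [Category.assoc, kernel.condition]), kernel.lift_ι _ _ _⟩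
    have : Mono (l ≫ kernel.ι q) := by rw [hl]; infer_instance
    have : Mono l := mono_of_mono l (kernel.ι q)
    have hz := h0 (kernel.ι (i ≫ q)) ((S.serre _).prop_of_mono l hk)
    rw [← kernel.lift_ι (i ≫ q) g hg, hz, comp_zero]
  have hC' : S.serre (S.radicalIndices (-ε) mu) (cokernel (i ≫ q)) := by
    obtain ⟨t, ht⟩ : ∃ t, cokernel.π i ≫ t = q ≫ cokernel.π (i ≫ q) :=
      ⟨cokernel.desc _ _ (by rw [← Category.assoc, cokernel.condition]), cokernel.π_desc _ _ _⟩
    have : Epi (cokernel.π i ≫ t) := by rw [ht]; infer_instance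
    have : Epi t := epi_of_epi (cokernel.π i) t
    exact (S.serre _).prop_of_epi t hC
  suffices ∃ r : E' ⟶ V, (i ≫ q) ≫ r = 𝟙 V by
    obtain ⟨r, hr⟩ := this
    exact ⟨q ≫ r, by rw [← hr, Category.assoc]⟩
  by_cases hz : IsZero (cokernel (i ≫ q))
  · obtain ⟨r, hr⟩ := (shortExact_cokernel (i ≫ q)).exists_lift (𝟙 E') (hz.eq_of_tgt _ _)
    exact ⟨r, by rw [← cancel_mono (i ≫ q), Category.assoc, hr, Category.comp_id,
      Category.id_comp]⟩
  obtain ⟨d, X, hX, g, hg⟩ := H.exists_hom_ne_zero h hz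
  have hd : d ∈ S.radicalIndices (-ε) mu := by
    by_contra hd
    exact hg (hX.hom_eq_zero hd hC' g)
  obtain ⟨l, hl⟩ := (hacyc d X (radicalIndices_subset _ hd) hX).lift (shortExact_cokernel (i ≫ q)) g
  have hl0 : l ≠ 0 := fun h => hg (by rw [← hl, h, zero_comp])
  -- An index below `mu` is impossible, as `E'` has no subobject in R_{< mu}. Otherwise the sign is
  -- −, Δ_ε(d) is proper standard, its radical dies in `E'`, and the lift factors through L(d).
  rcases hd with hd | ⟨hε, rfl⟩
  · refine (hl0 (hE' l ?_)).elim
    exact hX.serre (T' := {c | S.ρ c < mu}) (fun c hc => (radicalIndices_subset _ hc).trans_lt hd) hd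
  have hε' : ε (S.ρ d) = -1 := by
    rw [← neg_neg (ε (S.ρ d))]; exact congr_arg _ hε
  rw [radicalIndices_of_eq_neg_one hε'] at hX
  obtain ⟨f, hf, hfk, -⟩ := hX
  have := hf.epi
  have := S.simple d
  obtain ⟨m, hm'⟩ := (shortExact_kernel f).exists_desc l (hE' _ hfk)
  have hm0 : m ≠ 0 := fun h => hl0 (by rw [← hm', h, comp_zero])
  have hmm : Mono m := mono_of_nonzero_from_simple hm0
  have hmC : m ≫ cokernel.π (i ≫ q) ≠ 0 := fun h =>
    hg (by rw [← hl, ← hm', Category.assoc, h, comp_zero])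
  have hmCm : Mono (m ≫ cokernel.π (i ≫ q)) := mono_of_nonzero_from_simple hmC
  -- L(d) embeds into the cokernel of `V`, so it meets `V` trivially and `V` embeds into `E'` modulo
  -- L(d).
  have hm2 : Mono ((i ≫ q) ≫ cokernel.π m) := by
    refine Preadditive.mono_of_cancel_zero _ fun {W} g hg => ?_
    obtain ⟨s, hs⟩ := (shortExact_cokernel m).exists_lift (g ≫ i ≫ q) (by
      rw [Category.assoc, hg])
    have : s = 0 := by
      rw [← cancel_mono (m ≫ cokernel.π (i ≫ q)), reassoc_of% hs, ← Category.assoc i,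
        cokernel.condition, comp_zero, zero_comp]
    rw [← cancel_mono (i ≫ q), ← hs, this, zero_comp, zero_comp]
  have hlt : D (cokernel m) < n := by
    have h1 := hD.eq_add_cokernel m
    have h2 := hD.le_of_epi q
    have h3 := hpos d le_rfl
    omega
  obtain ⟨r, hr⟩ := ih _ hlt ((i ≫ q) ≫ cokernel.π m) (by
    obtain ⟨t, ht⟩ : ∃ t, cokernel.π (i ≫ q) ≫ t =
        cokernel.π m ≫ cokernel.π ((i ≫ q) ≫ cokernel.π m) :=
      ⟨cokernel.desc _ _ (by rw [← Category.assoc, cokernel.condition]), cokernel.π_desc _ _ _⟩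
    have : Epi (cokernel.π (i ≫ q) ≫ t) := by rw [ht]; infer_instance
    have : Epi t := epi_of_epi (cokernel.π (i ≫ q)) t
    exact (S.serre _).prop_of_epi t hC') rfl
  exact ⟨cokernel.π m ≫ r, by rw [← hr, Category.assoc, Category.assoc, Category.assoc]⟩

lemma HatPDelta.exists_costd_sub (h : S.IsFinitary) (H : S.HatPDelta ε) {lam : Λ} {V : R}
    (hV : ¬ IsZero V)
    (hacyc : ∀ (d : B) (X : R), S.IsStd (S.radicalIndices ε (S.ρ d)) d X → ExtVanish X V)
    (hlam : ∀ (d : B) (X : R), S.IsStd (S.radicalIndices ε (S.ρ d)) d X → ∀ g : X ⟶ V, g ≠ 0 →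
      lam ≤ S.ρ d) :
    ∃ (c : B) (Y : R) (m : Y ⟶ V), lam ≤ S.ρ c ∧
      S.IsCostd (S.radicalIndices (-ε) (S.ρ c)) c Y ∧ Mono m := by
  obtain ⟨d₀, X₀, hX₀, g₀, hg₀⟩ := H.exists_hom_ne_zero h hV
  obtain ⟨mu, hmu, hmin⟩ : ∃ mu, (∃ (d : B) (X : R), S.ρ d = mu ∧
      S.IsStd (S.radicalIndices ε (S.ρ d)) d X ∧ ∃ g : X ⟶ V, g ≠ 0) ∧
      ∀ (d : B) (X : R), S.ρ d < mu → S.IsStd (S.radicalIndices ε (S.ρ d)) d X →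
        ∀ g : X ⟶ V, g = 0 := by
    -- All candidates lie between `lam` and `S.ρ d₀`, so interval finiteness provides a minimal one.
    let M : Set Λ := {mu | mu ≤ S.ρ d₀ ∧ ∃ (d : B) (X : R), S.ρ d = mu ∧
      S.IsStd (S.radicalIndices ε (S.ρ d)) d X ∧ ∃ g : X ⟶ V, g ≠ 0}
    have hfin : M.Finite := (S.interval_finite lam (S.ρ d₀)).subset (by
      rintro mu ⟨hle, d, X, rfl, hX, g, hg⟩
      exact ⟨hlam d X hX g hg, hle⟩)
    obtain ⟨mu, hmu⟩ := hfin.exists_minimal ⟨S.ρ d₀, le_rfl, d₀, X₀, rfl, hX₀, g₀, hg₀⟩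
    refine ⟨mu, hmu.prop.2, fun d X hlt hX g => ?_⟩
    by_contra hg
    have := hmu.le_of_le ⟨hlt.le.trans hmu.prop.1, d, X, rfl, hX, g, hg⟩ hlt.le
    exact absurd hlt this.not_gt
  obtain ⟨d₁, X₁, hd₁, hX₁, g₁, hg₁⟩ := hmu
  have hlmu : lam ≤ mu := hd₁ ▸ hlam d₁ X₁ hX₁ g₁ hg₁
  -- The object `kernel q` is the part of `V` in R_{≤ mu}. It inherits the vanishing of extensions
  -- for ρ d ≤ mu, as such Δ_ε(d) have no nonzero map to `V₂`; minimality of `mu` excludes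
  -- subobjects in R_{< mu}.
  obtain ⟨V₂, q, hq, hk, hq0⟩ := exists_torsionFree h {c | S.ρ c ≤ mu} V
  have hXle {d : B} {X : R} (hX : S.IsStd (S.radicalIndices ε (S.ρ d)) d X) (hd : S.ρ d ≤ mu) :
      S.serre {c | S.ρ c ≤ mu} X :=
    hX.serre (T' := {c | S.ρ c ≤ mu}) (fun c hc => (radicalIndices_subset _ hc).trans hd) hd
  have hacyc' (d : B) (X : R) (hd : S.ρ d ≤ mu)
      (hX : S.IsStd (S.radicalIndices ε (S.ρ d)) d X) : ExtVanish X (kernel q) :=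
    (hacyc d X hX).of_hom_eq_zero_right (shortExact_kernel q) fun f => hq0 f (hXle hX hd)
  have h0 : ∀ {W : R} (g : W ⟶ kernel q), S.serre {c | S.ρ c < mu} W → g = 0 := by
    intro W g hW
    by_contra hg
    obtain ⟨d, hd, X, hX, t, ht⟩ := H.exists_hom_ne_zero_of_serre h hW hg
    refine ht ?_
    rw [← cancel_mono (kernel.ι q), zero_comp]
    exact hmin d X hd hX _
  have hne : ¬ IsZero (kernel q) := by
    intro hz
    refine hg₁ ?_
    rw [← kernel.lift_ι q g₁ (hq0 _ (hXle hX₁ hd₁.le)), hz.eq_of_tgt (kernel.lift q g₁ _) 0,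
      zero_comp]
  obtain ⟨c, rfl, f, hf⟩ := exists_simple_sub h hk hne h0
  obtain ⟨D, hD, hpos⟩ := h.measure (S.ρ c)
  obtain ⟨Y, hY⟩ := exists_isCostd h (S.radicalIndices (-ε) (S.ρ c)) c
  refine ⟨c, Y, ?_⟩
  have hY' := hY
  obtain ⟨j, hj, hjc, -⟩ := hY'
  have := hj.mono
  have hext : ExtVanish (cokernel j) (kernel q) := ExtVanish.of_retraction fun {E} i p w hE => by
    have := hE.mono_f
    have : Epi p := hE.epi_g
    refine H.exists_retraction h hacyc' h0 hD hpos i ?_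
    obtain ⟨t, ht⟩ := hE.exists_desc (cokernel.π i) (cokernel.condition i)
    have : Epi (p ≫ t) := by rw [ht]; infer_instance
    have : Epi t := epi_of_epi p t
    exact (S.serre _).prop_of_epi t hjc
  -- The inclusion of L(c) extends to ∇_ε(c), and the extension is mono because L(c) is essential in
  -- ∇_ε(c).
  obtain ⟨m, hm⟩ := hext.extend (shortExact_cokernel j) f
  have : Mono m := hj.essential m (by rw [hm]; exact hf)
  exact ⟨m ≫ kernel.ι q, hlmu, hY, inferInstance⟩

lemma HatPDelta.exists_costd_flag (h : S.IsFinitary) (H : S.HatPDelta ε) {lam : Λ} {V : R}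
    (hacyc : ∀ (d : B) (X : R), S.IsStd (S.radicalIndices ε (S.ρ d)) d X → ExtVanish X V)
    (hlam : ∀ (d : B) (X : R), S.IsStd (S.radicalIndices ε (S.ρ d)) d X → ∀ g : X ⟶ V, g ≠ 0 →
      lam ≤ S.ρ d) :
    ∃ l : List B, HasFlag (fun c => S.IsCostd (S.radicalIndices (-ε) (S.ρ c)) c) l V ∧
      ∀ c ∈ l, lam ≤ S.ρ c := by
  obtain ⟨D, hD, hpos⟩ := h.measure lam
  induction hn : D V using Nat.strong_induction_on generalizing V with
  | _ n ih =>
  by_cases hV : IsZero V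
  · exact ⟨[], .zero hV, by simp⟩
  obtain ⟨c, Y, m, hc, hY, hm⟩ := H.exists_costd_sub h hV hacyc hlam
  have hYX (d : B) (X : R) (hX : S.IsStd (S.radicalIndices ε (S.ρ d)) d X) : ExtVanish X Y :=
    H.extVanish_costd h hX hY
  have hlt : D (cokernel m) < n := by
    obtain ⟨j, hj, -⟩ := hY
    have := hj.mono
    have h1 := hD.eq_add_cokernel m
    have h2 := hD.le_of_mono j
    have h3 := hpos c hc
    omega
  -- Ext¹(X, V/Y) is squeezed between Ext¹(X, V) = 0 and Ext²(X, Y) = Ext¹(K, Y), which vanishes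
  -- because `K` has a Δ_ε-flag. Maps from `X` to V/Y lift to `V` because Ext¹(X, Y) = 0, so the
  -- bound by `lam` persists.
  obtain ⟨l, hl, hlc⟩ := ih _ hlt (V := cokernel m) (fun d X hX => by
      obtain ⟨P, K, k, q, w, l, hP, hE, hK, hb⟩ := H.exists_cover h hX
      exact (hacyc d X hX).quotient_right hE (shortExact_cokernel m)
        (hK.extVanish fun e _ Z hZ => hYX e Z hZ))
    (fun d X hX g hg => by
      obtain ⟨t, ht⟩ := (hYX d X hX).lift (shortExact_cokernel m) g
      exact hlam d X hX t fun h0 => hg (by rw [← ht, h0, zero_comp])) rfl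
  refine ⟨l ++ [c], hl.append_bottom m (cokernel.π m) _ (shortExact_cokernel m) hY,
    fun d hd => ?_⟩
  rcases List.mem_append.1 hd with hd | hd
  · exact hlc d hd
  · rw [List.mem_singleton.1 hd]; exact hc

/-- A nonzero map from Δ_ε(d) to the injective hull of L(b) makes L(b) a factor of Δ_ε(d), forcing ρ
b ≤ ρ d. -/
lemma HatPDelta.iNabla (h : S.IsFinitary) (H : S.HatPDelta ε) : S.INabla ε := by
  intro b
  obtain ⟨J, f, hJ, hf⟩ := h.hull b
  have := hf.mono
  have : Simple (Opposite.op (S.L b)) := S.op.simple b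
  obtain ⟨l, hl, hb⟩ := H.exists_costd_flag h (lam := S.ρ b) (V := J)
    (fun d X hX => ExtVanish.of_injective) (fun d X hX g hg => by
      by_contra hle
      refine hg ?_
      have hX' : S.serre {c | ¬ S.ρ b ≤ S.ρ c} X :=
        hX.serre (T' := {c | ¬ S.ρ b ≤ S.ρ c})
          (fun c hc hbc => hle (hbc.trans (radicalIndices_subset _ hc))) hle
      have := hf.op.hom_eq_zero (N := (S.serre {c | ¬ S.ρ b ≤ S.ρ c}).op)
        (V := Opposite.op X)
        (fun h => (S.serre_L_iff (T := {c | ¬ S.ρ b ≤ S.ρ c}).1 h) le_rfl) hX' g.op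
      exact Quiver.Hom.op_inj this)
  exact ⟨J, f, l, ⟨hJ, hf.mono, hf.essential⟩, hl.mono fun b X => (isEpsCostandard_iff h).2, hb⟩

/-- The substance is 1 → 4; applied to the opposite category and −ε it becomes 2 → 3. The other two
implications identify the extremal section of the flag. -/
theorem tfae (h : S.IsFinitary) :
    [S.HatPDelta ε, S.HatINabla ε, S.PDelta ε, S.INabla ε].TFAE := by
  tfae_have 1 → 4 := fun H => H.iNabla h
  tfae_have 4 → 2 := fun H => H.hatINabla h
  tfae_have 2 → 3 := fun H => (iNabla_op_iff h).1 (((hatPDelta_op_iff h).2 H).iNabla h.op)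
  tfae_have 3 → 1 := fun H => H.hatPDelta h
  tfae_finish

lemma LeftClosed.kernel_of_hom_eq_zero {N : ObjectProperty R} {Z' Z Z'' : R} {a : Z' ⟶ Z}
    {b : Z ⟶ Z''} {w : a ≫ b = 0} (hE : (ShortComplex.mk a b w).ShortExact)
    (hZ : LeftClosed N Z) (hZ'' : LeftClosed N Z'') {W : R} (hW : N W) (g : Z' ⟶ W) : g = 0 := by
  obtain ⟨l, rfl⟩ := (hZ''.ext hW).extend hE g
  rw [hZ.hom_eq_zero hW l, comp_zero]

/-- For `W` in R_{< mu}, Ext¹(Z', W) lies between Ext¹(Z, W) = 0 and Ext²(Z'', W). If `Z''` is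
proper standard at `mu`, the latter is Ext¹(K, W) with `K` flagged by Δ_ε(c), ρ c ≥ mu, hence zero.
A general `Z''` is reduced by removing one proper standard quotient at a time. -/
lemma HatPDelta.kernelClosed (h : S.IsFinitary) (H : S.HatPDelta ε) {mu : Λ} (hε : ε mu = -1) :
    S.KernelClosed mu := by
  obtain ⟨D, hD, hpos⟩ := h.measure mu
  -- the case of a proper standard quotient
  have key {Z X : R} {c : B} (hc : S.ρ c = mu) (hX : S.IsStd {d | S.ρ d < mu} c X)
      (hZ : LeftClosed (S.serre {d | S.ρ d < mu}) Z) (p : Z ⟶ X) [Epi p] :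
      LeftClosed (S.serre {d | S.ρ d < mu}) (kernel p) := by
    subst hc
    have hXc : LeftClosed (S.serre {d | S.ρ d < S.ρ c}) X :=
      ⟨fun hV => hX.hom_eq_zero (T' := {d | S.ρ d < S.ρ c}) (fun h => lt_irrefl (S.ρ c) h) hV,
        fun hV => by obtain ⟨_, -, -, h⟩ := hX; exact h hV⟩
    refine ⟨fun hW => LeftClosed.kernel_of_hom_eq_zero (shortExact_kernel p) hZ hXc hW,
      fun {W} hW => ?_⟩
    rw [← radicalIndices_of_eq_neg_one hε] at hX
    obtain ⟨P, K, k, q, w, l, hP, hE, hK, hb⟩ := H.exists_cover h hX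
    exact (hZ.ext hW).kernel_left hE (shortExact_kernel p)
      (H.extVanish_of_hasFlag h hK hb (S.serre_mono (fun d (hd : _ < _) => hd.not_ge) hW))
  intro Z' Z Z'' a b w hE hZle hZ hZ''
  have hb : Epi b := hE.epi_g
  have hZ''le : S.serre {c | S.ρ c ≤ mu} Z'' := (S.serre _).prop_of_epi b hZle
  induction hn : D Z'' using Nat.strong_induction_on generalizing Z Z'' with
  | _ n ih =>
  have ha : Mono a := hE.mono_f
  by_cases hz : IsZero Z''
  · obtain ⟨r, hr⟩ := hE.exists_lift (𝟙 Z) (hz.eq_of_tgt _ _)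
    have hr' : a ≫ r = 𝟙 Z' := by
      rw [← cancel_mono a, Category.assoc, hr, Category.id_comp, Category.comp_id]
    exact hZ.of_iso ⟨r, a, hr, hr'⟩
  obtain ⟨c, hc, f, hf⟩ := exists_simple_quotient h hZ''le hz
    fun g hW => hZ''.hom_eq_zero hW g
  obtain ⟨X, hX⟩ := exists_isStd h {d | S.ρ d < mu} c
  have hX' := hX
  obtain ⟨p, hp, hpk, -⟩ := hX'
  have := hp.epi
  -- The simple quotient L(c) of `Z''` lifts to a map to the proper standard object, since `Z''` has
  -- no extensions by its radical.
  obtain ⟨t, ht⟩ := (hZ''.ext hpk).lift (shortExact_kernel p) f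
  have : Epi t := hp.essential t (by rw [ht]; exact hf)
  have hlt : D (kernel t) < n := by
    have h1 := hD.eq_kernel_add t
    have h2 := hD.le_of_epi p
    have h3 := hpos c hc.ge
    omega
  -- By `key` the kernels of `Z` and of `Z''` over `X` are closed, and `Z'` is also the kernel of
  -- the induced epimorphism `b'` between them.
  obtain ⟨b', hb'⟩ : ∃ b' : kernel (b ≫ t) ⟶ kernel t, b' ≫ kernel.ι t = kernel.ι (b ≫ t) ≫ b :=
    ⟨kernel.lift _ _ (by rw [Category.assoc, kernel.condition]), kernel.lift_ι _ _ _⟩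
  obtain ⟨a', ha'⟩ : ∃ a' : Z' ⟶ kernel (b ≫ t), a' ≫ kernel.ι (b ≫ t) = a :=
    ⟨kernel.lift _ _ (by rw [reassoc_of% w, zero_comp]), kernel.lift_ι _ _ _⟩
  have : Mono a' := mono_of_mono_fac ha'
  have : Epi b' := by
    obtain ⟨u, hu⟩ : ∃ u, u ≫ kernel.ι (b ≫ t) = pullback.fst b (kernel.ι t) :=
      ⟨kernel.lift _ _ (by rw [pullback.condition_assoc, kernel.condition, comp_zero]),
        kernel.lift_ι _ _ _⟩
    have hub : u ≫ b' = pullback.snd b (kernel.ι t) := by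
      rw [← cancel_mono (kernel.ι t), Category.assoc, hb', reassoc_of% hu, pullback.condition]
    exact epi_of_epi_fac hub
  refine ih _ hlt a' b' ?_ (shortExact_of_lift _ _ _ fun s hs => ?_)
    ((S.serre _).prop_of_mono (kernel.ι (b ≫ t)) hZle) (key hc hX hZ (b ≫ t)) (key hc hX hZ'' t)
    this ((S.serre _).prop_of_mono (kernel.ι t) hZ''le) rfl
  · rw [← cancel_mono (kernel.ι t), Category.assoc, hb', reassoc_of% ha', w, zero_comp]
  · obtain ⟨l, hl⟩ := hE.exists_lift (s ≫ kernel.ι (b ≫ t)) (by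
      rw [Category.assoc, ← hb', reassoc_of% hs, zero_comp])
    exact ⟨l, by rw [← cancel_mono (kernel.ι (b ≫ t)), Category.assoc, ha', hl]⟩

end Stratification

end Key

/-! ### Duality and exactness for finitary stratifications. -/

namespace Stratification

variable {R : Type u} [Category.{v} R] [Abelian R] {B : Type uB} {Λ : Type uL} [PartialOrder Λ]
  {S : Stratification R B Λ} {ε : Λ → ℤˣ}

lemma isEpsStratified_op_iff (h : S.IsFinitary) :
    S.IsEpsStratified ε ↔ S.op.IsEpsStratified (-ε) :=
  ((tfae h).out 0 1).trans (hatPDelta_op_iff h).symm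

lemma exactFunctor_of_isEpsStratified (h : S.IsFinitary) (H : S.IsEpsStratified ε) (lam : Λ) :
    (ε lam = -1 → ∀ F : S.Stratum lam ⥤ S.Le lam, Nonempty (F ⊣ S.j lam) →
      exactFunctor _ _ F) ∧
    (ε lam = 1 → ∀ G : S.Stratum lam ⥤ S.Le lam, Nonempty (S.j lam ⊣ G) →
      exactFunctor _ _ G) := by
  refine ⟨fun hε F ⟨adj⟩ => exactFunctor_of_kernelClosed (HatPDelta.kernelClosed h H hε) adj,
    fun hε G ⟨adj⟩ => exactFunctor_of_op_kernelClosed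
      (HatPDelta.kernelClosed h.op ((isEpsStratified_op_iff h).1 H) ?_) adj⟩
  simp [hε]

end Stratification

/-! ### Projective covers and simple subquotients from finite weights. -/

section Weights

variable {R : Type u} [Category.{v} R] [Abelian R] {I : Type w} {d : I → R → ℕ}

lemma IsSubquotient.trans {X Y V : R} (h : IsSubquotient X Y) (h' : IsSubquotient Y V) :
    IsSubquotient X V := by
  obtain ⟨Z, i, p, hi, hp⟩ := h
  obtain ⟨W, i', p', hi', hp'⟩ := h'
  exact ⟨pullback p' i, pullback.fst p' i ≫ i', pullback.snd p' i ≫ p, inferInstance,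
    inferInstance⟩

lemma IsAdditiveMeasure.image_le {D : R → ℕ} (hD : IsAdditiveMeasure D) {X Y Z : R} {f : X ⟶ Y}
    (a : X ⟶ Z) (b : Z ⟶ Y) (h : a ≫ b = f) : D (Abelian.image f) ≤ D Z := by
  obtain ⟨l, hl⟩ : ∃ l : Abelian.image f ⟶ Abelian.image b,
      l ≫ Abelian.image.ι b = Abelian.image.ι f := by
    refine ⟨kernel.lift _ _ ?_, kernel.lift_ι _ _ _⟩
    rw [← cancel_epi (Abelian.factorThruImage f), reassoc_of% (Abelian.image.fac f), ← h, Category.assoc,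
      cokernel.condition, comp_zero, comp_zero]
  have : Mono (l ≫ Abelian.image.ι b) := by rw [hl]; infer_instance
  have : Mono l := mono_of_mono l (Abelian.image.ι b)
  exact (hD.le_of_mono l).trans (hD.le_of_epi (Abelian.factorThruImage b))

/-- The functions `d i` behave like the dimensions of the weight spaces `e i V` in a category of
locally finite-dimensional modules over a locally unital algebra. -/
structure HasWeights (d : I → R → ℕ) : Prop where
  additive : ∀ i, IsAdditiveMeasure (d i)
  isZero : ∀ {V : R}, (∀ i, d i V = 0) → IsZero V
  projective : ∀ i, ∃ P : R, Projective P ∧ ∀ V, d i V = 0 ↔ ∀ g : P ⟶ V, g = 0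
  injective : ∀ i, ∃ J : R, Injective J ∧ ∀ V, d i V = 0 ↔ ∀ g : V ⟶ J, g = 0

namespace HasWeights

lemma op (h : HasWeights d) : HasWeights (R := Rᵒᵖ) (fun i V => d i V.unop) where
  additive i := (h.additive i).op
  isZero hV := (h.isZero hV).op
  projective i := by
    obtain ⟨J, hJ, hd⟩ := h.injective i
    exact ⟨Opposite.op J, inferInstance, fun V => (hd V.unop).trans
      ⟨fun h g => Quiver.Hom.unop_inj (h g.unop), fun h g => Quiver.Hom.op_inj (h g.op)⟩⟩
  injective i := by
    obtain ⟨J, hJ, hd⟩ := h.projective i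
    exact ⟨Opposite.op J, inferInstance, fun V => (hd V.unop).trans
      ⟨fun h g => Quiver.Hom.unop_inj (h g.unop), fun h g => Quiver.Hom.op_inj (h g.op)⟩⟩

variable (h : HasWeights d)
include h

lemma exists_pos {V : R} (hV : ¬ IsZero V) : ∃ i, 0 < d i V := by
  by_contra! h0
  exact hV (h.isZero fun i => Nat.le_zero.1 (h0 i))

lemma isIso_of_epi {X : R} (f : X ⟶ X) [Epi f] : IsIso f := by
  have hz : IsZero (kernel f) := h.isZero fun i => by
    have := (h.additive i).eq_kernel_add f
    omega
  have : Mono f := Preadditive.mono_of_kernel_zero (hz.eq_of_src _ _)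
  exact isIso_of_mono_of_epi f

/-- If `X` has no nonzero quotient of weight zero, monomorphisms to `X` preserving the weight are
epimorphisms. -/
lemma epi_of_eq {i : I} {X Y : R} (hX : ∀ {Z : R} (q : X ⟶ Z), d i Z = 0 → q = 0) (f : Y ⟶ X)
    [Mono f] (hf : d i X ≤ d i Y) : Epi f := by
  refine Preadditive.epi_of_cokernel_zero (hX _ ?_)
  have := (h.additive i).eq_add_cokernel f
  omega

/-- A Fitting argument. For a power of φ whose image has least weight at `i`, restricting that power
to its image does not lower the weight. Since the image has no nonzero quotient of weight zero, the
restriction is epi, hence invertible, and the image is a direct summand of `P`. -/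
lemma exists_projective_retract {i : I} {P : R} [Projective P]
    (hP : ∀ {Z : R} (q : P ⟶ Z), d i Z = 0 → q = 0) (φ : P ⟶ P) :
    ∃ (n : ℕ) (X : R) (p : P ⟶ X) (m : X ⟶ P), Epi p ∧ Mono m ∧
      p ≫ m = (show End P from φ) ^ (n + 1) ∧ Projective X := by
  let ψ : End P := φ
  obtain ⟨n, hn⟩ : ∃ n : ℕ, ∀ m : ℕ, d i (Abelian.image (ψ ^ (n + 1))) ≤
      d i (Abelian.image (ψ ^ (m + 1))) := by
    have hs : (Set.range fun n : ℕ => d i (Abelian.image (ψ ^ (n + 1)))).Nonempty :=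
      Set.range_nonempty _
    obtain ⟨n, hn⟩ := Nat.sInf_mem hs
    exact ⟨n, fun m => hn.le.trans (Nat.sInf_le ⟨m, rfl⟩)⟩
  let p := Abelian.factorThruImage (ψ ^ (n + 1))
  let m := Abelian.image.ι (ψ ^ (n + 1))
  have hpm : p ≫ m = ψ ^ (n + 1) := Abelian.image.fac _
  have hX : ∀ {Z : R} (q : Abelian.image (ψ ^ (n + 1)) ⟶ Z), d i Z = 0 → q = 0 := fun q hq => by
    rw [← cancel_epi p, hP (p ≫ q) hq, comp_zero]
  -- The exponent is written `n + 1 + n + 1` so that `hn` applies to it at `n + 1 + n`.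
  have h2 : (p ≫ Abelian.factorThruImage (m ≫ p)) ≫ Abelian.image.ι (m ≫ p) ≫ m =
      ψ ^ (n + 1 + n + 1) := by
    rw [Category.assoc, reassoc_of% (Abelian.image.fac (m ≫ p)), hpm, reassoc_of% hpm,
      add_assoc (n + 1), pow_add ψ (n + 1) (n + 1)]
    rfl
  have : Epi (Abelian.image.ι (m ≫ p)) :=
    h.epi_of_eq hX _ ((hn (n + 1 + n)).trans ((h.additive i).image_le _ _ h2))
  have : Epi (m ≫ p) := by
    rw [← Abelian.image.fac (m ≫ p)]; infer_instance
  have := h.isIso_of_epi (m ≫ p)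
  refine ⟨n, _, p, m, inferInstance, inferInstance, hpm, ?_⟩
  exact Retract.projective ⟨m, p ≫ inv (m ≫ p), by rw [← Category.assoc, IsIso.hom_inv_id]⟩

/-- Among projectives generated in weight `i` and mapping onto `L`, one of least weight is a
projective cover. If `g ≫ f` is epi, the endomorphism φ through `g` lies over `L`; the summand cut
out by a power of φ still maps onto `L`, so by minimality that power is epi, and hence so is `g`. -/
lemma exists_cover (L : R) [Simple L] : ∃ (P : R) (f : P ⟶ L), Projective P ∧ EssEpi f := by
  obtain ⟨i, hi⟩ := h.exists_pos (Simple.not_isZero L)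
  let M : Set ℕ := {n | ∃ (P : R) (f : P ⟶ L), Projective P ∧ Epi f ∧
    (∀ {Z : R} (q : P ⟶ Z), d i Z = 0 → q = 0) ∧ d i P = n}
  have hM : M.Nonempty := by
    obtain ⟨P, hP, hd⟩ := h.projective i
    obtain ⟨f, hf⟩ : ∃ f : P ⟶ L, f ≠ 0 := by
      by_contra! h0
      exact hi.ne' ((hd L).2 h0)
    exact ⟨_, P, f, hP, epi_of_nonzero_to_simple hf, fun q hq => (hd _).1 hq q, rfl⟩
  obtain ⟨P, f, hP, hf, hq, hmin⟩ := Nat.sInf_mem hM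
  refine ⟨P, f, hP, hf, fun {Q} g hg => ?_⟩
  let φ : P ⟶ P := Projective.factorThru f (g ≫ f) ≫ g
  have hφ : φ ≫ f = f := by
    rw [Category.assoc, Projective.factorThru_comp]
  obtain ⟨n, X, p, m, hp, hm, hpm, hX⟩ := h.exists_projective_retract hq φ
  have hpow : ∀ n : ℕ, ((show End P from φ) ^ n : End P) ≫ f = f := by
    intro n
    induction n with
    | zero => exact Category.id_comp f
    | succ n ih =>
      rw [pow_succ, End.mul_def, Category.assoc, ih, hφ]
  have hmf : Epi (m ≫ f) := by
    have : Epi (p ≫ m ≫ f) := by rw [← Category.assoc, hpm, hpow]; exact hf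
    exact epi_of_epi p _
  have hXq : ∀ {Z : R} (q : X ⟶ Z), d i Z = 0 → q = 0 := fun q hZ => by
    rw [← cancel_epi p, hq (p ≫ q) hZ, comp_zero]
  have : Epi m := h.epi_of_eq hq m (hmin.le.trans (Nat.sInf_le ⟨X, m ≫ f, hX, hmf, hXq, rfl⟩))
  have : Epi ((show End P from φ) ^ (n + 1) : End P) := by rw [← hpm]; infer_instance
  rw [pow_succ', End.mul_def] at this
  have : Epi φ := epi_of_epi ((show End P from φ) ^ n : End P) φ
  exact epi_of_epi (Projective.factorThru f (g ≫ f)) g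

lemma exists_hull (L : R) [Simple L] : ∃ (J : R) (f : L ⟶ J), Injective J ∧ EssMono f := by
  have := simple_op_of_simple L
  obtain ⟨P, f, hP, hf⟩ := h.op.exists_cover (Opposite.op L)
  have : Projective (Opposite.op P.unop) := hP
  exact ⟨P.unop, f.unop, Injective.injective_iff_projective_op.2 this, hf.unop⟩

/-- Take a subquotient of least positive weight at `i`, then the part generated in weight `i`, then
the quotient of that cogenerated in weight `i`. Any nonzero subobject of the result has positive
weight at `i`, thus full weight by minimality, thus is everything. -/
lemma exists_simple_subquotient {V : R} (hV : ¬ IsZero V) :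
    ∃ X : R, Simple X ∧ IsSubquotient X V := by
  obtain ⟨i, hi⟩ := h.exists_pos hV
  let M : Set ℕ := {n | ∃ Y : R, IsSubquotient Y V ∧ 0 < d i Y ∧ d i Y = n}
  have hM : M.Nonempty := ⟨_, V, ⟨V, 𝟙 V, 𝟙 V, inferInstance, inferInstance⟩, hi, rfl⟩
  obtain ⟨Y, hYV, hY, hmin⟩ := Nat.sInf_mem hM
  obtain ⟨P, -, hP⟩ := h.projective i
  obtain ⟨J, -, hJ⟩ := h.injective i
  obtain ⟨f, hf⟩ : ∃ f : P ⟶ Y, f ≠ 0 := by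
    by_contra! h0
    exact hY.ne' ((hP Y).2 h0)
  let Y₁ := Abelian.image f
  have hY₁ : d i Y₁ ≠ 0 := fun h0 => hf (by
    rw [← Abelian.image.fac f, (hP Y₁).1 h0 (Abelian.factorThruImage f), zero_comp])
  obtain ⟨g, hg⟩ : ∃ g : Y₁ ⟶ J, g ≠ 0 := by
    by_contra! h0
    exact hY₁ ((hJ Y₁).2 h0)
  let Y₂ := Abelian.image g
  have hY₂ : IsSubquotient Y₂ Y :=
    ⟨Y₁, Abelian.image.ι f, Abelian.factorThruImage g, inferInstance, inferInstance⟩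
  have hgen : ∀ {Z : R} (q : Y₂ ⟶ Z), d i Z = 0 → q = 0 := fun q hZ => by
    rw [← cancel_epi (Abelian.factorThruImage g), ← cancel_epi (Abelian.factorThruImage f),
      (hP _).1 hZ (Abelian.factorThruImage f ≫ Abelian.factorThruImage g ≫ q), comp_zero,
      comp_zero]
  refine ⟨Y₂, ⟨fun {N} j hj => ⟨fun hiso h0 => ?_, fun hj0 => ?_⟩⟩, hY₂.trans hYV⟩
  · have : 𝟙 Y₂ = 0 := by rw [← cancel_epi j, comp_zero, Category.comp_id, h0]
    refine hg ?_
    rw [← Abelian.image.fac g, ← Category.id_comp (Abelian.image.ι g), this, zero_comp, comp_zero]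
  · have hN : d i N ≠ 0 := fun h0 => hj0 (by
      rw [← cancel_mono (Abelian.image.ι g), (hJ N).1 h0 (j ≫ Abelian.image.ι g), zero_comp])
    have hNY : IsSubquotient N Y₂ := ⟨N, j, 𝟙 N, hj, inferInstance⟩
    have h1 : d i Y ≤ d i N := hmin.le.trans
      (Nat.sInf_le ⟨N, hNY.trans (hY₂.trans hYV), Nat.pos_of_ne_zero hN, rfl⟩)
    have := h.epi_of_eq hgen j (((h.additive i).le_of_isSubquotient hY₂).trans h1)
    exact isIso_of_mono_of_epi j

end HasWeights

end Weights

/-! ### The projective modules A e_i and the injective modules dual to e_i A. -/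

namespace LocallyUnitalAlgebra

variable {k : Type w} [Field k] {A : LocallyUnitalAlgebra.{w} k}

section Representation

variable {V : Type w} [AddCommGroup V] [Module k V] (act : A.carrier →ₙₐ[k] Module.End k V)

lemma act_mul (a b : A.carrier) (x : V) : act (a * b) x = act a (act b x) := by
  rw [map_mul]; rfl

lemma act_idem (i : A.I) (x : V) : act (A.e i) (act (A.e i) x) = act (A.e i) x := by
  rw [← act_mul, A.idem]

lemma act_eq_self_iff {i : A.I} {x : V} :
    act (A.e i) x = x ↔ x ∈ LinearMap.range (act (A.e i)) := by
  refine ⟨fun h => ⟨x, h⟩, ?_⟩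
  rintro ⟨y, rfl⟩
  exact act_idem act i y

/-- An element of the sum of the weight spaces is the finite sum of its components under the
idempotents, and each component stays in `W`. -/
lemma mem_iSup_of_act_mem {W : Submodule k V} (hW : ∀ i, ∀ x ∈ W, act (A.e i) x ∈ W) {x : V}
    (hx : x ∈ W) (hx' : x ∈ ⨆ i, LinearMap.range (act (A.e i))) :
    x ∈ ⨆ i, LinearMap.range (act (A.e i)) ⊓ W := by
  classical
  obtain ⟨s, hs⟩ : ∃ s : Finset A.I, ∑ i ∈ s, act (A.e i) x = x ∧
      ∀ j ∉ s, act (A.e j) x = 0 := by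
    clear hx
    refine Submodule.iSup_induction (fun i => LinearMap.range (act (A.e i)))
      (motive := fun x => ∃ s : Finset A.I, ∑ i ∈ s, act (A.e i) x = x ∧
        ∀ j ∉ s, act (A.e j) x = 0) hx' ?_ ?_ ?_
    · rintro i _ ⟨y, rfl⟩
      have h0 : ∀ j, j ≠ i → act (A.e j) (act (A.e i) y) = 0 := fun j hj => by
        rw [← act_mul, A.ortho j i hj, map_zero, LinearMap.zero_apply]
      exact ⟨{i}, by simp [act_idem], fun j hj => h0 j (by simpa using hj)⟩
    · exact ⟨∅, by simp, by simp⟩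
    · rintro y z ⟨s, hs, hs'⟩ ⟨t, ht, ht'⟩
      refine ⟨s ∪ t, ?_, fun j hj => ?_⟩
      · simp_rw [map_add]
        rw [Finset.sum_add_distrib,
          ← Finset.sum_subset (Finset.subset_union_left (s₁ := s) (s₂ := t)) fun j _ h => hs' j h,
          ← Finset.sum_subset (Finset.subset_union_right (s₁ := s) (s₂ := t)) fun j _ h => ht' j h,
          hs, ht]
      · rw [Finset.mem_union, not_or] at hj
        rw [map_add, hs' j hj.1, ht' j hj.2, add_zero]
  rw [← hs.1]
  exact Submodule.sum_mem _ fun i _ => Submodule.mem_iSup_of_mem i ⟨⟨x, rfl⟩, hW i x hx⟩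

/-- The module given by a stable subspace of a not necessarily unital representation. -/
def ofStable (W : Submodule k V) (hW : ∀ a, ∀ x ∈ W, act a x ∈ W)
    (hW' : W ≤ ⨆ i, LinearMap.range (act (A.e i))) : A.Mod where
  carrier := W
  act :=
    { toFun := fun a => (act a).restrict (hW a)
      map_smul' := fun c a => by ext x; simp
      map_zero' := by ext x; simp
      map_add' := fun a b => by ext x; simp
      map_mul' := fun a b => by ext x; simp }
  iSup_eq_top := by
    have hle : W ≤ Submodule.map W.subtype
        (⨆ i, LinearMap.range ((act (A.e i)).restrict (hW (A.e i)))) := by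
      intro x hx
      have := mem_iSup_of_act_mem act (fun i => hW (A.e i)) hx (hW' hx)
      rw [Submodule.map_iSup]
      refine SetLike.le_def.1 (iSup_mono fun i => ?_) this
      rintro _ ⟨⟨y, rfl⟩, hy⟩
      exact ⟨⟨_, hy⟩, ⟨⟨_, hy⟩, Subtype.ext (act_idem act i y)⟩, rfl⟩
    refine eq_top_iff.2 fun x _ => ?_
    obtain ⟨y, hy, hyx⟩ := hle x.2
    rwa [← Subtype.ext hyx]

end Representation

/-- The inclusion of a stable subspace of a module. -/
def ofStableHom {V : A.Mod} (W : Submodule k V.carrier) (hW : ∀ a, ∀ x ∈ W, V.act a x ∈ W) :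
    ModHom A (ofStable V.act W hW (V.iSup_eq_top ▸ le_top)) V where
  toLin := W.subtype
  map_act _ _ := rfl

/-- Weight spaces of submodules are finite-dimensional. -/
lemma finite_range_act_of_injective {V W : A.Mod} (f : ModHom A V W)
    (hf : Function.Injective f.toLin) (i : A.I)
    [Module.Finite k (LinearMap.range (W.act (A.e i)))] :
    Module.Finite k (LinearMap.range (V.act (A.e i))) := by
  refine Module.Finite.of_injective (f.toLin.restrict (p := LinearMap.range (V.act (A.e i)))
    (q := LinearMap.range (W.act (A.e i))) ?_) fun x y h => Subtype.ext (hf ?_)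
  · rintro _ ⟨x, rfl⟩
    exact ⟨f.toLin x, (f.map_act _ _).symm⟩
  · exact congr_arg Subtype.val h

variable (A)

/-- The left regular representation. -/
def regular : A.carrier →ₙₐ[k] Module.End k A.carrier where
  toFun a := LinearMap.mulLeft k a
  map_smul' c a := by ext x; simp [smul_mul_assoc]
  map_zero' := by ext x; simp
  map_add' a b := by ext x; simp [add_mul]
  map_mul' a b := by ext x; simp

lemma range_regular_iSup : ⨆ i, LinearMap.range (A.regular (A.e i)) = ⊤ := by
  rw [eq_top_iff, ← A.span_eq_top, Submodule.span_le]
  rintro _ ⟨i, j, a, rfl⟩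
  exact Submodule.mem_iSup_of_mem i ⟨a * A.e j, (mul_assoc _ _ _).symm⟩

/-- The module `A e i`. -/
def proj (i : A.I) : A.Mod :=
  ofStable A.regular (A.leftIdeal i)
    (by
      rintro a _ ⟨b, rfl⟩
      exact ⟨a * b, mul_assoc _ _ _⟩)
    (A.range_regular_iSup ▸ le_top)

/-- The generator of `A e i`. -/
def projGen (i : A.I) : (A.proj i).carrier :=
  ⟨A.e i, A.e i, A.idem i⟩

lemma act_projGen (i : A.I) : (A.proj i).act (A.e i) (A.projGen i) = A.projGen i :=
  Subtype.ext (A.idem i)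

variable {A}

lemma proj_eq_act (i : A.I) (x : (A.proj i).carrier) :
    (A.proj i).act x.1 (A.projGen i) = x := by
  obtain ⟨_, ⟨a, rfl⟩⟩ := x
  refine Subtype.ext ?_
  change a * A.e i * A.e i = a * A.e i
  rw [mul_assoc, A.idem]

/-- The homomorphism from `A e i` defined by an element of `e i V`. -/
def projHom (i : A.I) {V : A.Mod} (x : V.carrier) : ModHom A (A.proj i) V where
  toLin :=
    { toFun := fun a => V.act a.1 x
      map_add' := fun a b => by
        change V.act (a.1 + b.1) x = _
        rw [map_add, LinearMap.add_apply]
      map_smul' := fun c a => by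
        change V.act (c • a.1) x = _
        rw [map_smul, LinearMap.smul_apply, RingHom.id_apply] }
  map_act a b := act_mul V.act a b.1 x

lemma projHom_gen (i : A.I) {V : A.Mod} (x : V.carrier) :
    (projHom i x).toLin (A.projGen i) = V.act (A.e i) x := rfl

lemma finite_range_proj (i j : A.I) [Module.Finite k (A.corner j i)] :
    Module.Finite k (LinearMap.range ((A.proj i).act (A.e j))) := by
  refine Module.Finite.of_injective ((A.leftIdeal i).subtype.restrict
    (p := LinearMap.range ((A.proj i).act (A.e j))) (q := A.corner j i) ?_) fun x y h => by
      have := congr_arg Subtype.val h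
      exact Subtype.ext (Subtype.ext this)
  rintro _ ⟨⟨_, ⟨a, rfl⟩⟩, rfl⟩
  exact ⟨a, rfl⟩

variable (A)

/-- The representation on the dual of `A` given by right multiplication. -/
def coregular : A.carrier →ₙₐ[k] Module.End k (Module.Dual k A.carrier) where
  toFun a := Module.Dual.transpose (LinearMap.mulRight k a)
  map_smul' c a := by
    ext φ x
    change φ (x * c • a) = c • φ (x * a)
    rw [mul_smul_comm, map_smul]
  map_zero' := by
    ext φ x
    change φ (x * 0) = 0
    rw [mul_zero, map_zero]
  map_add' a b := by
    ext φ x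
    change φ (x * (a + b)) = φ (x * a) + φ (x * b)
    rw [mul_add, map_add]
  map_mul' a b := by
    ext φ x
    exact congr_arg φ (mul_assoc x a b).symm

lemma coregular_apply (a x : A.carrier) (φ : Module.Dual k A.carrier) :
    A.coregular a φ x = φ (x * a) := rfl

lemma act_mem_iSup {V : Type w} [AddCommGroup V] [Module k V]
    (act : A.carrier →ₙₐ[k] Module.End k V) (a : A.carrier) (x : V) :
    act a x ∈ ⨆ i, LinearMap.range (act (A.e i)) := by
  have ha : a ∈ Submodule.span k {x : A.carrier | ∃ i j a, x = A.e i * a * A.e j} :=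
    A.span_eq_top ▸ Submodule.mem_top
  induction ha using Submodule.span_induction with
  | mem y hy =>
    obtain ⟨i, j, a, rfl⟩ := hy
    refine Submodule.mem_iSup_of_mem i ⟨act (a * A.e j) x, ?_⟩
    rw [← act_mul, mul_assoc]
  | zero => simp
  | add y z _ _ hy hz => rw [map_add]; exact Submodule.add_mem _ hy hz
  | smul c y _ hy => rw [map_smul]; exact Submodule.smul_mem _ c hy

/-- The functionals on `e i A` that vanish on almost all `e i A e j`. -/
def injSubmodule (i : A.I) : Submodule k (Module.Dual k A.carrier) :=
  LinearMap.ker (Module.Dual.transpose (LinearMap.mulLeft k (A.e i)) - LinearMap.id) ⊓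
    ⨆ j, LinearMap.range (A.coregular (A.e j))

variable {A}

lemma mem_injSubmodule {i : A.I} {φ : Module.Dual k A.carrier} :
    φ ∈ A.injSubmodule i ↔ (∀ x, φ (A.e i * x) = φ x) ∧
      φ ∈ ⨆ j, LinearMap.range (A.coregular (A.e j)) := by
  rw [injSubmodule, Submodule.mem_inf, LinearMap.mem_ker, LinearMap.sub_apply, sub_eq_zero]
  exact and_congr_left fun _ => LinearMap.ext_iff

variable (A)

/-- The injective module `⨁ j, (e i A e j)^*`. -/
def inj (i : A.I) : A.Mod :=
  ofStable A.coregular (A.injSubmodule i)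
    (fun a φ hφ => mem_injSubmodule.2 ⟨fun x => by
      rw [coregular_apply, coregular_apply, mul_assoc, (mem_injSubmodule.1 hφ).1],
      A.act_mem_iSup _ a φ⟩)
    inf_le_right

variable {A}

/-- Evaluation of a homomorphism to `inj i` at `e i`. -/
def injEval {i : A.I} {V : A.Mod} (f : ModHom A V (A.inj i)) : V.carrier →ₗ[k] k where
  toFun v := (f.toLin v).1 (A.e i)
  map_add' x y := by rw [map_add]; rfl
  map_smul' c x := by rw [map_smul]; rfl

lemma injEval_apply {i : A.I} {V : A.Mod} (f : ModHom A V (A.inj i)) (v : V.carrier) :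
    injEval f v = (f.toLin v).1 (A.e i) := rfl

lemma injEval_act {i : A.I} {V : A.Mod} (f : ModHom A V (A.inj i)) (a : A.carrier)
    (v : V.carrier) : injEval f (V.act a v) = (f.toLin v).1 a := by
  rw [injEval_apply, f.map_act]
  exact (mem_injSubmodule.1 (f.toLin v).2).1 a

/-- A functional in `A.inj i` is unchanged by left multiplication of its argument by e_i, so a map
from `V` is determined by its values at e_i. With `injHom` this identifies Hom(V, inj i) with the
dual of e_i V. -/
lemma inj_hom_ext {i : A.I} {V : A.Mod} {f g : ModHom A V (A.inj i)}
    (h : injEval f = injEval g) : f = g := by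
  ext v
  refine Subtype.ext (LinearMap.ext fun a => ?_)
  rw [← injEval_act, h, injEval_act]

/-- The linear map underlying `injHom`. -/
def injHomAux (i : A.I) {V : A.Mod} (l : V.carrier →ₗ[k] k) :
    V.carrier →ₗ[k] Module.Dual k A.carrier where
  toFun := fun v =>
    { toFun := fun a => l (V.act (A.e i * a) v)
      map_add' := fun a b => by simp [mul_add]
      map_smul' := fun c a => by simp [mul_smul_comm] }
  map_add' := fun x y => by ext a; simp
  map_smul' := fun c x => by ext a; simp

lemma injHomAux_act (i : A.I) {V : A.Mod} (l : V.carrier →ₗ[k] k) (a : A.carrier)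
    (v : V.carrier) : injHomAux i l (V.act a v) = A.coregular a (injHomAux i l v) := by
  refine LinearMap.ext fun b => ?_
  change l (V.act (A.e i * b) (V.act a v)) = l (V.act (A.e i * (b * a)) v)
  rw [← act_mul, mul_assoc]

/-- The homomorphism to `inj i` defined by a functional on `e i V`. -/
def injHom (i : A.I) {V : A.Mod} (l : V.carrier →ₗ[k] k) : ModHom A V (A.inj i) where
  toLin := LinearMap.codRestrict (A.injSubmodule i) (injHomAux i l) (by
    intro v
    refine mem_injSubmodule.2 ⟨fun x => ?_, ?_⟩
    · change l (V.act (A.e i * (A.e i * x)) v) = l (V.act (A.e i * x) v)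
      rw [← mul_assoc, A.idem]
    · have hv : v ∈ ⨆ i, LinearMap.range (V.act (A.e i)) := V.iSup_eq_top ▸ Submodule.mem_top
      refine Submodule.iSup_induction (fun i => LinearMap.range (V.act (A.e i)))
        (motive := fun v => injHomAux i l v ∈ ⨆ j, LinearMap.range (A.coregular (A.e j))) hv ?_ ?_ ?_
      · rintro j _ ⟨v, rfl⟩
        exact Submodule.mem_iSup_of_mem j ⟨_, (injHomAux_act i l _ v).symm⟩
      · rw [map_zero]; exact Submodule.zero_mem _
      · intro v w hv hw
        rw [map_add]; exact Submodule.add_mem _ hv hw)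
  map_act a v := Subtype.ext (injHomAux_act i l a v)

lemma injEval_injHom (i : A.I) {V : A.Mod} (l : V.carrier →ₗ[k] k) (v : V.carrier) :
    injEval (injHom i l) v = l (V.act (A.e i) v) := by
  change l (V.act (A.e i * A.e i) v) = _
  rw [A.idem]

lemma finite_range_inj (i j : A.I) [Module.Finite k (A.corner i j)] :
    Module.Finite k (LinearMap.range ((A.inj i).act (A.e j))) := by
  refine Module.Finite.of_injective (N := Module.Dual k (A.corner i j))
    ((Module.Dual.transpose (A.corner i j).subtype ∘ₗ (A.injSubmodule i).subtype) ∘ₗ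
      (LinearMap.range ((A.inj i).act (A.e j))).subtype) fun φ ψ h => ?_
  -- A functional of weight `j` in `A.inj i` is determined by its restriction to e_i A e_j.
  have key (φ : LinearMap.range ((A.inj i).act (A.e j))) (x : A.carrier) :
      φ.1.1 x = φ.1.1 (A.e i * (x * A.e j)) := by
    rw [(mem_injSubmodule.1 φ.1.2).1]
    exact congr_arg (fun ψ : (A.inj i).carrier => ψ.1 x)
      ((act_eq_self_iff (A.inj i).act).2 φ.2).symm
  refine Subtype.ext (Subtype.ext (LinearMap.ext fun x => ?_))
  rw [key φ, key ψ]
  exact LinearMap.congr_fun h ⟨A.e i * (x * A.e j), x, rfl⟩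

lemma finite_inj (i : A.I) [Module.Finite k (A.rightIdeal i)] :
    Module.Finite k (A.inj i).carrier := by
  refine Module.Finite.of_injective (N := Module.Dual k (A.rightIdeal i))
    (Module.Dual.transpose (A.rightIdeal i).subtype ∘ₗ (A.injSubmodule i).subtype)
    fun φ ψ h => ?_
  refine Subtype.ext (LinearMap.ext fun x => ?_)
  rw [← (mem_injSubmodule.1 φ.2).1, ← (mem_injSubmodule.1 ψ.2).1]
  exact LinearMap.congr_fun h ⟨A.e i * x, x, rfl⟩

end LocallyUnitalAlgebra

/-! ### Abelian categories realized by modules. -/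

section ModuleCategory

open LocallyUnitalAlgebra

variable {k : Type w} [Field k] {A : LocallyUnitalAlgebra.{w} k} {R : Type u} [Category.{v} R]

/-- `U` realizes `R` as a full subcategory of `A.Mod` consisting of locally finite-dimensional
modules, closed under submodules, and containing the modules `A.proj i` and `A.inj i`. -/
structure IsModuleRealization (U : R ⥤ A.Mod) : Prop where
  full : U.Full
  faithful : U.Faithful
  finite : ∀ X i, Module.Finite k (LinearMap.range ((U.obj X).act (A.e i)))
  sub : ∀ {X : R} {M : A.Mod} (f : ModHom A M (U.obj X)), Function.Injective f.toLin →
    ∃ Y, Nonempty (U.obj Y ≅ M)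
  proj : ∀ i, ∃ Y, Nonempty (U.obj Y ≅ A.proj i)
  inj : ∀ i, ∃ Y, Nonempty (U.obj Y ≅ A.inj i)

namespace LocallyUnitalAlgebra

/-- The linear map underlying the image of a morphism. -/
def lin (U : R ⥤ A.Mod) {X Y : R} (f : X ⟶ Y) : (U.obj X).carrier →ₗ[k] (U.obj Y).carrier :=
  ModHom.toLin (U.map f)

/-- The dimension of the weight space `e i V`. -/
noncomputable def weight (U : R ⥤ A.Mod) (i : A.I) (X : R) : ℕ :=
  Module.finrank k (LinearMap.range ((U.obj X).act (A.e i)))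

lemma lin_comp (U : R ⥤ A.Mod) {X Y Z : R} (f : X ⟶ Y) (g : Y ⟶ Z) :
    lin U (f ≫ g) = lin U g ∘ₗ lin U f := by
  rw [lin, U.map_comp]; rfl

lemma lin_comp_apply (U : R ⥤ A.Mod) {X Y Z : R} (f : X ⟶ Y) (g : Y ⟶ Z) (x) :
    lin U (f ≫ g) x = lin U g (lin U f x) := by
  rw [lin_comp]; rfl

lemma lin_id (U : R ⥤ A.Mod) (X : R) : lin U (𝟙 X) = LinearMap.id := by
  rw [lin, U.map_id]; rfl

lemma lin_act (U : R ⥤ A.Mod) {X Y : R} (f : X ⟶ Y) (a : A.carrier) (x : (U.obj X).carrier) :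
    lin U f ((U.obj X).act a x) = (U.obj Y).act a (lin U f x) :=
  ModHom.map_act (U.map f) a x

/-- A module isomorphism as a linear equivalence. -/
def isoLin {M N : A.Mod} (e : M ≅ N) : M.carrier ≃ₗ[k] N.carrier :=
  LinearEquiv.ofLinearMap (ModHom.toLin e.hom) (ModHom.toLin e.inv)
    (congr_arg ModHom.toLin e.inv_hom_id) (congr_arg ModHom.toLin e.hom_inv_id)

lemma isoLin_act {M N : A.Mod} (e : M ≅ N) (a : A.carrier) (x : M.carrier) :
    isoLin e (M.act a x) = N.act a (isoLin e x) :=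
  ModHom.map_act e.hom a x

lemma isoLin_symm_act {M N : A.Mod} (e : M ≅ N) (a : A.carrier) (x : N.carrier) :
    (isoLin e).symm (N.act a x) = M.act a ((isoLin e).symm x) :=
  ModHom.map_act e.inv a x

end LocallyUnitalAlgebra

namespace IsModuleRealization

variable {U : R ⥤ A.Mod} (h : IsModuleRealization U)
include h

lemma lin_injective {X Y : R} {f g : X ⟶ Y} (e : lin U f = lin U g) : f = g := by
  have := h.faithful
  exact U.map_injective (ModHom.ext e)

lemma exists_lin {X Y : R} (T : (U.obj X).carrier →ₗ[k] (U.obj Y).carrier)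
    (hT : ∀ a x, T ((U.obj X).act a x) = (U.obj Y).act a (T x)) : ∃ f : X ⟶ Y, lin U f = T := by
  have := h.full
  obtain ⟨f, hf⟩ := U.map_surjective (show U.obj X ⟶ U.obj Y from ⟨T, hT⟩)
  exact ⟨f, congr_arg ModHom.toLin hf⟩

lemma exists_sub {X : R} (N : Submodule k (U.obj X).carrier)
    (hN : ∀ a, ∀ x ∈ N, (U.obj X).act a x ∈ N) :
    ∃ (Y : R) (i : Y ⟶ X), Function.Injective (lin U i) ∧ LinearMap.range (lin U i) = N := by
  obtain ⟨Y, ⟨e⟩⟩ := h.sub (ofStableHom N hN) N.injective_subtype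
  obtain ⟨i, hi⟩ := h.exists_lin (X := Y) (Y := X)
    ((ofStableHom N hN).toLin ∘ₗ (isoLin e).toLinearMap)
    fun a x => congr_arg Subtype.val (isoLin_act e a x)
  refine ⟨Y, i, ?_, ?_⟩
  · rw [hi]
    exact N.injective_subtype.comp (isoLin e).injective
  · rw [hi, LinearMap.range_comp_of_range_eq_top _ (LinearEquiv.range (isoLin e))]
    exact N.range_subtype

lemma exists_lift {X Y Z : R} (i : Y ⟶ X) (hi : Function.Injective (lin U i)) (f : Z ⟶ X)
    (hf : LinearMap.range (lin U f) ≤ LinearMap.range (lin U i)) : ∃ l : Z ⟶ Y, l ≫ i = f := by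
  let e := LinearEquiv.ofInjective (lin U i) hi
  have he (y) : lin U i (e.symm y) = y.1 := by
    have := LinearEquiv.ofInjective_apply (lin U i) (h := hi) (e.symm y)
    rw [← this]
    exact congr_arg Subtype.val (e.apply_symm_apply y)
  let T := e.symm.toLinearMap ∘ₗ
    (lin U f).codRestrict (LinearMap.range (lin U i)) (fun x => hf ⟨x, rfl⟩)
  have hT (x) : lin U i (T x) = lin U f x := he _
  obtain ⟨l, hl⟩ := h.exists_lin T fun a x => hi (by rw [hT, lin_act, lin_act, hT])
  refine ⟨l, h.lin_injective (LinearMap.ext fun x => ?_)⟩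
  rw [lin_comp_apply, hl, hT]

lemma mono_of_injective {X Y : R} {f : X ⟶ Y} (hf : Function.Injective (lin U f)) : Mono f :=
  ⟨fun a b e => h.lin_injective (LinearMap.ext fun x => hf (by
    rw [← lin_comp_apply, e, lin_comp_apply]))⟩

lemma weight_eq_zero_iff {i : A.I} {X : R} :
    weight U i X = 0 ↔ ∀ x, (U.obj X).act (A.e i) x = 0 := by
  have := h.finite X i
  rw [weight, Submodule.finrank_eq_zero, LinearMap.range_eq_bot]
  exact LinearMap.ext_iff

variable [Abelian R]

lemma lin_zero (X Y : R) : lin U (0 : X ⟶ Y) = 0 := by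
  obtain ⟨z, hz⟩ : ∃ z : R, IsZero z := ⟨_, isZero_zero R⟩
  obtain ⟨f, hf⟩ := h.exists_lin (X := z) (Y := z) 0 fun a x => by simp
  have hid : (0 : X ⟶ Y) = 0 ≫ f ≫ (0 : z ⟶ Y) := by simp
  rw [hid, lin_comp, lin_comp, hf, LinearMap.comp_zero, LinearMap.zero_comp]

lemma lin_eq_zero_iff {X Y : R} {f : X ⟶ Y} : lin U f = 0 ↔ f = 0 :=
  ⟨fun e => h.lin_injective (e.trans (h.lin_zero X Y).symm), fun e => e ▸ h.lin_zero X Y⟩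

lemma injective_of_mono {X Y : R} (f : X ⟶ Y) [Mono f] : Function.Injective (lin U f) := by
  obtain ⟨K, i, hi, hr⟩ := h.exists_sub (LinearMap.ker (lin U f)) fun a x hx => by
    rw [LinearMap.mem_ker] at hx ⊢
    rw [lin_act, hx, map_zero]
  have hif : i ≫ f = 0 := h.lin_eq_zero_iff.1 (LinearMap.ext fun x => by
    have : lin U i x ∈ LinearMap.ker (lin U f) := hr ▸ ⟨x, rfl⟩
    rw [lin_comp_apply]; exact this)
  have hi0 : i = 0 := by rw [← cancel_mono f, hif, zero_comp]
  rw [← LinearMap.ker_eq_bot, ← hr, hi0, h.lin_zero, LinearMap.range_zero]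

/-- Only closure under submodules is available, so the image is used in place of the cokernel: its
inclusion is both mono and epi, hence invertible. -/
lemma surjective_of_epi {X Y : R} (f : X ⟶ Y) [Epi f] : Function.Surjective (lin U f) := by
  obtain ⟨K, i, hi, hr⟩ := h.exists_sub (LinearMap.range (lin U f)) fun a x hx => by
    obtain ⟨y, rfl⟩ := hx
    exact ⟨_, lin_act U f a y⟩
  obtain ⟨l, hl⟩ := h.exists_lift i hi f hr.ge
  have := h.mono_of_injective hi
  have := epi_of_epi_fac hl
  have := isIso_of_mono_of_epi i
  rw [← LinearMap.range_eq_top, ← hr, LinearMap.range_eq_top]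
  intro y
  exact ⟨lin U (inv i) y, by rw [← lin_comp_apply, IsIso.inv_hom_id, lin_id]; rfl⟩

lemma range_eq_ker {X Y Z : R} {i : X ⟶ Y} {p : Y ⟶ Z} {w : i ≫ p = 0}
    (hE : (ShortComplex.mk i p w).ShortExact) :
    LinearMap.range (lin U i) = LinearMap.ker (lin U p) := by
  apply le_antisymm
  · rintro _ ⟨x, rfl⟩
    rw [LinearMap.mem_ker, ← lin_comp_apply, w, h.lin_zero, LinearMap.zero_apply]
  · obtain ⟨K, j, hj, hr⟩ := h.exists_sub (LinearMap.ker (lin U p)) fun a x hx => by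
      rw [LinearMap.mem_ker] at hx ⊢
      rw [lin_act, hx, map_zero]
    obtain ⟨l, hl⟩ := hE.exists_lift j (h.lin_eq_zero_iff.1 (LinearMap.ext fun x => by
      have : lin U j x ∈ LinearMap.ker (lin U p) := hr ▸ ⟨x, rfl⟩
      rw [lin_comp_apply]; exact this))
    rw [← hr, ← hl, lin_comp]
    exact LinearMap.range_comp_le_range _ _

lemma finrank_additive [∀ X, Module.Finite k (U.obj X).carrier] :
    IsAdditiveMeasure fun X : R => Module.finrank k (U.obj X).carrier := by
  rintro ⟨i, p, w⟩ hE
  have : Mono i := hE.mono_f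
  have : Epi p := hE.epi_g
  have h1 := LinearMap.finrank_range_add_finrank_ker (lin U p)
  rw [← h.range_eq_ker hE, LinearMap.finrank_range_of_inj (h.injective_of_mono i),
    LinearMap.range_eq_top.2 (h.surjective_of_epi p), finrank_top] at h1
  exact h1.symm.trans (add_comm _ _)

lemma weight_additive (i : A.I) : IsAdditiveMeasure (weight (R := R) U i) := by
  rintro ⟨a, p, w⟩ hE
  have : Mono a := hE.mono_f
  have : Epi p := hE.epi_g
  have := h.finite
  have hmap {X Y : R} (f : X ⟶ Y) : ∀ x ∈ LinearMap.range ((U.obj X).act (A.e i)),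
      lin U f x ∈ LinearMap.range ((U.obj Y).act (A.e i)) := by
    rintro _ ⟨x, rfl⟩
    exact ⟨_, (lin_act U f _ x).symm⟩
  have ha : Function.Injective ((lin U a).restrict (hmap a)) := fun x y e =>
    Subtype.ext (h.injective_of_mono a (congr_arg Subtype.val e))
  have hp : Function.Surjective ((lin U p).restrict (hmap p)) := by
    rintro ⟨_, y, rfl⟩
    obtain ⟨x, rfl⟩ := h.surjective_of_epi p y
    exact ⟨⟨_, x, rfl⟩, Subtype.ext (lin_act U p _ x)⟩
  have hr : LinearMap.range ((lin U a).restrict (hmap a)) =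
      LinearMap.ker ((lin U p).restrict (hmap p)) := by
    ext ⟨x, hx⟩
    have hiff : x ∈ LinearMap.range (lin U a) ↔ x ∈ LinearMap.ker (lin U p) := by
      rw [h.range_eq_ker hE]
    constructor
    · rintro ⟨y, hy⟩
      exact Subtype.ext (hiff.1 ⟨y.1, congr_arg Subtype.val hy⟩)
    · intro hx'
      obtain ⟨y, rfl⟩ := hiff.2 (congr_arg Subtype.val hx')
      refine ⟨⟨_, y, rfl⟩, Subtype.ext ?_⟩
      exact (lin_act U a _ y).trans ((act_eq_self_iff _).2 hx)
  have h1 := LinearMap.finrank_range_add_finrank_ker ((lin U p).restrict (hmap p))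
  rw [← hr, LinearMap.finrank_range_of_inj ha, LinearMap.range_eq_top.2 hp, finrank_top] at h1
  exact h1.symm.trans (add_comm _ _)

lemma isZero_of_weight {X : R} (hX : ∀ i, weight U i X = 0) : IsZero X := by
  rw [IsZero.iff_id_eq_zero]
  apply h.lin_eq_zero_iff.1
  have htop : (⊤ : Submodule k (U.obj X).carrier) = ⊥ := by
    rw [← (U.obj X).iSup_eq_top, iSup_eq_bot]
    exact fun i => LinearMap.range_eq_bot.2 (LinearMap.ext (h.weight_eq_zero_iff.1 (hX i)))
  refine LinearMap.ext fun x => ?_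
  have hx : x ∈ (⊥ : Submodule k (U.obj X).carrier) := htop ▸ Submodule.mem_top
  rw [(Submodule.mem_bot k).1 hx, map_zero, map_zero]

/-- Maps from `P` to `V` correspond to vectors of e_i V through the image of the generator, and such
vectors lift along surjections. -/
lemma exists_projective (i : A.I) :
    ∃ P : R, Projective P ∧ ∀ V, weight U i V = 0 ↔ ∀ g : P ⟶ V, g = 0 := by
  obtain ⟨P, ⟨e⟩⟩ := h.proj i
  let x₀ := (isoLin e).symm (A.projGen i)
  have hx₀ : (U.obj P).act (A.e i) x₀ = x₀ := by
    rw [← isoLin_symm_act, act_projGen]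
  have hom_ext {V : R} {f g : P ⟶ V} (hfg : lin U f x₀ = lin U g x₀) : f = g := by
    refine h.lin_injective (LinearMap.ext fun x => ?_)
    obtain ⟨y, rfl⟩ := (isoLin e).symm.surjective x
    rw [← proj_eq_act i y, isoLin_symm_act, lin_act, lin_act, hfg]
  have hom {V : R} (v : (U.obj V).carrier) :
      ∃ f : P ⟶ V, lin U f x₀ = (U.obj V).act (A.e i) v := by
    obtain ⟨f, hf⟩ := h.exists_lin (X := P) (Y := V)
      ((projHom i v).toLin ∘ₗ (isoLin e).toLinearMap) fun a x =>
        (congr_arg (projHom i v).toLin (isoLin_act e a x)).trans ((projHom i v).map_act _ _)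
    refine ⟨f, ?_⟩
    rw [hf, ← projHom_gen i v]
    exact congr_arg (projHom i v).toLin ((isoLin e).apply_symm_apply _)
  refine ⟨P, ⟨fun {V W} g p hp => ?_⟩, fun V => ?_⟩
  · obtain ⟨v, hv⟩ := h.surjective_of_epi p (lin U g x₀)
    obtain ⟨f, hf⟩ := hom v
    refine ⟨f, hom_ext ?_⟩
    rw [lin_comp_apply, hf, lin_act, hv, ← lin_act, hx₀]
  · rw [h.weight_eq_zero_iff]
    refine ⟨fun h0 g => hom_ext ?_, fun h0 v => ?_⟩
    · rw [h.lin_zero, LinearMap.zero_apply, ← hx₀, lin_act, h0]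
    · obtain ⟨f, hf⟩ := hom v
      rw [← hf, h0 f, h.lin_zero, LinearMap.zero_apply]

/-- Maps from `V` to `J` correspond to functionals on e_i V, and these extend along injections of
vector spaces. -/
lemma exists_injective (i : A.I) :
    ∃ J : R, Injective J ∧ ∀ V, weight U i V = 0 ↔ ∀ g : V ⟶ J, g = 0 := by
  obtain ⟨J, ⟨e⟩⟩ := h.inj i
  let ev {V : R} (f : V ⟶ J) : (U.obj V).carrier →ₗ[k] k := injEval (U.map f ≫ e.hom)
  have ev_act {V : R} (f : V ⟶ J) (v) : ev f ((U.obj V).act (A.e i) v) = ev f v := injEval_act _ _ _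
  have ev_comp {V W : R} (f : V ⟶ W) (g : W ⟶ J) (v) : ev (f ≫ g) v = ev g (lin U f v) := by
    change injEval (U.map (f ≫ g) ≫ e.hom) v = _
    rw [U.map_comp]; rfl
  have hom_ext {V : R} {f g : V ⟶ J} (hfg : ev f = ev g) : f = g := by
    have := h.faithful
    exact U.map_injective ((cancel_mono e.hom).1 (inj_hom_ext hfg))
  have hom {V : R} (l : (U.obj V).carrier →ₗ[k] k) :
      ∃ f : V ⟶ J, ∀ v, ev f v = l ((U.obj V).act (A.e i) v) := by
    have := h.full
    obtain ⟨f, hf⟩ := U.map_surjective ((show U.obj V ⟶ A.inj i from injHom i l) ≫ e.inv)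
    refine ⟨f, fun v => ?_⟩
    rw [← injEval_injHom]
    change injEval (U.map f ≫ e.hom) v = _
    rw [hf, Category.assoc, e.inv_hom_id, Category.comp_id]
  have ev_zero (V : R) : ev (0 : V ⟶ J) = 0 := by
    refine LinearMap.ext fun v => ?_
    have h0 : (0 : V ⟶ J) = (0 : V ⟶ V) ≫ 0 := by simp
    rw [h0, ev_comp, h.lin_zero, LinearMap.zero_apply, map_zero, LinearMap.zero_apply]
  refine ⟨J, ⟨fun {V W} g m hm => ?_⟩, fun V => ?_⟩
  · obtain ⟨r, hr⟩ := LinearMap.exists_leftInverse_of_injective (lin U m)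
      (LinearMap.ker_eq_bot.2 (h.injective_of_mono m))
    obtain ⟨f, hf⟩ := hom (ev g ∘ₗ r)
    refine ⟨f, hom_ext (LinearMap.ext fun v => ?_)⟩
    rw [ev_comp, hf, ← lin_act, LinearMap.comp_apply, ← LinearMap.comp_apply r, hr,
      LinearMap.id_apply, ev_act]
  · rw [h.weight_eq_zero_iff]
    refine ⟨fun h0 g => hom_ext (LinearMap.ext fun v => ?_), fun h0 v => ?_⟩
    · rw [ev_zero, ← ev_act, h0, map_zero, LinearMap.zero_apply]
    · refine (Module.forall_dual_apply_eq_zero_iff k _).1 fun l => ?_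
      obtain ⟨f, hf⟩ := hom l
      rw [← hf, h0 f, ev_zero, LinearMap.zero_apply]

lemma hasWeights : HasWeights (weight (R := R) U) where
  additive := h.weight_additive
  isZero := h.isZero_of_weight
  projective := h.exists_projective
  injective := h.exists_injective

end IsModuleRealization

end ModuleCategory

/-! ### Verification of the finiteness axioms for categories of modules. -/

section Finitary

open LocallyUnitalAlgebra

variable {k : Type w} [Field k] {A : LocallyUnitalAlgebra.{w} k} {R : Type u} [Category.{v} R]

lemma isModuleRealization_of_equivalence {P : ObjectProperty A.Mod} (e : R ≌ P.FullSubcategory)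
    (hlfd : P ≤ A.isLfd)
    (hsub : ∀ {M N : A.Mod} (f : ModHom A M N), Function.Injective f.toLin → P N → P M)
    (hproj : ∀ i, P (A.proj i)) (hinj : ∀ i, P (A.inj i)) :
    IsModuleRealization (e.functor ⋙ P.ι) := by
  have key {M : A.Mod} (hM : P M) : ∃ Y, Nonempty ((e.functor ⋙ P.ι).obj Y ≅ M) :=
    ⟨e.inverse.obj ⟨M, hM⟩, ⟨P.ι.mapIso (e.counitIso.app ⟨M, hM⟩)⟩⟩
  exact
    { full := inferInstance
      faithful := inferInstance
      finite := fun X => hlfd _ (e.functor.obj X).property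
      sub := fun {X _} f hf => key (hsub f hf (e.functor.obj X).property)
      proj := fun i => key (hproj i)
      inj := fun i => key (hinj i) }

lemma isModuleRealization_of_isFd (hA : A.IsEssentiallyFiniteDimensional)
    (e : R ≌ A.isFd.FullSubcategory) : IsModuleRealization (e.functor ⋙ A.isFd.ι) := by
  refine isModuleRealization_of_equivalence e (fun V hV i => ?_) (fun {M N} f hf hN => ?_)
    (fun i => hA.2 i) fun i => ?_
  · have : Module.Finite k V.carrier := hV
    infer_instance
  · have : Module.Finite k N.carrier := hN
    exact Module.Finite.of_injective f.toLin hf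
  · have := hA.1 i
    exact finite_inj i

lemma isModuleRealization_of_isLfd (hA : A.IsLocallyFiniteDimensional)
    (e : R ≌ A.isLfd.FullSubcategory) : IsModuleRealization (e.functor ⋙ A.isLfd.ι) := by
  refine isModuleRealization_of_equivalence e le_rfl (fun {M N} f hf hN i => ?_)
    (fun i j => ?_) fun i j => ?_
  · have := hN i
    exact finite_range_act_of_injective f hf i
  · have := hA j i
    exact finite_range_proj i j
  · have := hA i j
    exact finite_range_inj i j

namespace IsModuleRealization

variable [Abelian R] {U : R ⥤ A.Mod} (h : IsModuleRealization U)
include h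

lemma act_mem_range_of_weight_le {i : A.I} {X Y : R} (f : Y ⟶ X) [Mono f]
    (hf : weight U i X ≤ weight U i Y) (x : (U.obj X).carrier) :
    (U.obj X).act (A.e i) x ∈ LinearMap.range (lin U f) := by
  have h0 : weight U i (cokernel f) = 0 := by
    have := (h.weight_additive i).eq_add_cokernel f
    omega
  rw [h.range_eq_ker (shortExact_cokernel f), LinearMap.mem_ker, lin_act]
  exact h.weight_eq_zero_iff.1 h0 _

lemma act_mem_ker_of_weight_le {i : A.I} {X Y : R} (f : X ⟶ Y) [Epi f]
    (hf : weight U i X ≤ weight U i Y) {x : (U.obj X).carrier} (hx : lin U f x = 0) :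
    (U.obj X).act (A.e i) x = 0 := by
  have h0 : weight U i (kernel f) = 0 := by
    have := (h.weight_additive i).eq_kernel_add f
    omega
  obtain ⟨z, rfl⟩ : x ∈ LinearMap.range (lin U (kernel.ι f)) := by
    rw [h.range_eq_ker (shortExact_kernel f)]; exact hx
  rw [← lin_act, h.weight_eq_zero_iff.1 h0, map_zero]

variable {B : Type uB} {Λ : Type uL} [PartialOrder Λ] {S : Stratification R B Λ}

lemma serre_of_weight_eq_zero {i : A.I} {b : B} (hb : 0 < weight U i (S.L b)) {X : R}
    (hX : weight U i X = 0) : S.serre {c | c ≠ b} X := by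
  rintro c hc rfl
  have := (h.weight_additive i).le_of_isSubquotient hc
  omega

lemma exists_weight_pos (b : B) : ∃ i, 0 < weight U i (S.L b) :=
  have := S.simple b
  h.hasWeights.exists_pos (Simple.not_isZero (S.L b))

/-- The sum of the submodules of `V` that belong to a Serre class. -/
lemma exists_largest_sub (T : Set B) (V : R) : ∃ (Y : R) (j : Y ⟶ V), Mono j ∧ S.serre T Y ∧
    ∀ {W : R} (g : W ⟶ V), S.serre T W → ∃ l, l ≫ j = g := by
  let F : Set (Submodule k (U.obj V).carrier) :=
    {N | ∃ (X : R) (m : X ⟶ V), Mono m ∧ S.serre T X ∧ LinearMap.range (lin U m) = N}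
  obtain ⟨Y, j, hj, hr⟩ := h.exists_sub (sSup F) fun a x hx => by
    refine SetLike.le_def.1 (sSup_le fun N hN => ?_ :
      sSup F ≤ Submodule.comap ((U.obj V).act a) (sSup F)) hx
    have hle := le_sSup hN
    obtain ⟨X, m, -, -, rfl⟩ := hN
    rintro _ ⟨y, rfl⟩
    rw [Submodule.mem_comap, ← lin_act]
    exact hle ⟨_, rfl⟩
  have hjm := h.mono_of_injective hj
  refine ⟨Y, j, hjm, fun b hb => ?_, fun {W} g hW => h.exists_lift j hj g ?_⟩
  -- The sum may be infinite, but for a fixed `i` with e_i L(b) ≠ 0 a single summand X₁ of largest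
  -- weight contains e_i of the whole sum. Then L(b) is a factor neither of X₁, as b ∉ T, nor of the
  -- quotient by X₁, whose weight at `i` is zero.
  · by_contra hbT
    obtain ⟨i, hi⟩ := h.exists_weight_pos (S := S) b
    let M : Set ℕ := {n | ∃ (X : R) (m : X ⟶ V), Mono m ∧ S.serre T X ∧
      weight U i V - weight U i X = n}
    have hM : M.Nonempty := by
      obtain ⟨z, hz⟩ : ∃ z : R, IsZero z := ⟨_, isZero_zero R⟩
      exact ⟨_, z, 0, ⟨fun _ _ _ => hz.eq_of_tgt _ _⟩, (S.serre T).prop_of_isZero hz, rfl⟩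
    obtain ⟨X₁, m₁, hm₁, hX₁, hmin⟩ := Nat.sInf_mem hM
    have key : sSup F ≤
        Submodule.comap ((U.obj V).act (A.e i)) (LinearMap.range (lin U m₁)) := by
      refine sSup_le ?_
      rintro _ ⟨X, m, hm, hX, rfl⟩ _ ⟨x, rfl⟩
      -- X₂ is the sum of `X` and X₁ inside `V`. It is in the class, so by the choice of X₁ it has
      -- no larger weight, and e_i X lies in X₁.
      let X₂ := Abelian.image (biprod.desc m m₁)
      let π := Abelian.factorThruImage (biprod.desc m m₁)
      let m₂ : X₂ ⟶ V := Abelian.image.ι (biprod.desc m m₁)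
      have hX₂ : S.serre T X₂ := (S.serre T).prop_of_epi π ((S.serre T).prop_biprod hX hX₁)
      have hl₁ : (biprod.inr ≫ π) ≫ m₂ = m₁ := by
        rw [Category.assoc, Abelian.image.fac, biprod.inr_desc]
      have hl : (biprod.inl ≫ π) ≫ m₂ = m := by
        rw [Category.assoc, Abelian.image.fac, biprod.inl_desc]
      have : Mono (biprod.inr ≫ π) := mono_of_mono_fac hl₁
      have hle : weight U i X₂ ≤ weight U i X₁ := by
        have h1 := hmin.le.trans (Nat.sInf_le ⟨X₂, m₂, inferInstance, hX₂, rfl⟩)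
        have h2 := (h.weight_additive i).le_of_mono m₂
        have h3 := (h.weight_additive i).le_of_mono m₁
        omega
      obtain ⟨y, hy⟩ := h.act_mem_range_of_weight_le (biprod.inr ≫ π) hle
        (lin U (biprod.inl ≫ π) x)
      refine ⟨y, ?_⟩
      have hy' := congr_arg (lin U m₂) hy
      rwa [← lin_comp_apply, hl₁, lin_act, ← lin_comp_apply, hl] at hy'
    have hle₁ : LinearMap.range (lin U m₁) ≤ LinearMap.range (lin U j) := by
      rw [hr]
      exact le_sSup ⟨X₁, m₁, hm₁, hX₁, rfl⟩
    obtain ⟨t, ht⟩ := h.exists_lift j hj m₁ hle₁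
    have htm : Mono t := mono_of_mono_fac ht
    have h0 : weight U i (cokernel t) = 0 := h.weight_eq_zero_iff.2 fun z => by
      obtain ⟨y, rfl⟩ := h.surjective_of_epi (cokernel.π t) z
      obtain ⟨x, hx⟩ := key (hr ▸ LinearMap.mem_range_self (lin U j) y)
      have : (U.obj Y).act (A.e i) y = lin U t x := hj (by
        rw [lin_act, ← hx, ← ht, lin_comp_apply])
      rw [← lin_act, this, ← lin_comp_apply, cokernel.condition, h.lin_zero,
        LinearMap.zero_apply]
    exact (S.serre {c | c ≠ b}).prop_X₂_of_shortExact (shortExact_cokernel t)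
      (S.serre_mono (fun c hc (hcb : c = b) => hbT (hcb ▸ hc)) hX₁)
      (h.serre_of_weight_eq_zero hi h0) b hb rfl
  · rw [hr]
    have hle : LinearMap.range (lin U g) ≤ LinearMap.range (lin U (Abelian.image.ι g)) := by
      conv_lhs => rw [← Abelian.image.fac g, lin_comp]
      exact LinearMap.range_comp_le_range _ _
    exact hle.trans (le_sSup ⟨_, Abelian.image.ι g, inferInstance,
      (S.serre T).prop_of_epi (Abelian.factorThruImage g) hW, rfl⟩)

/-- The quotient of `V` by the intersection of the submodules whose quotient belongs to a Serre
class. -/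
lemma exists_largest_quotient (T : Set B) (V : R) : ∃ (Q : R) (p : V ⟶ Q), Epi p ∧ S.serre T Q ∧
    ∀ {W : R} (g : V ⟶ W), S.serre T W → ∃ l, p ≫ l = g := by
  let F : Set (Submodule k (U.obj V).carrier) :=
    {N | ∃ (Q : R) (q : V ⟶ Q), Epi q ∧ S.serre T Q ∧ LinearMap.ker (lin U q) = N}
  obtain ⟨Y, j, hj, hr⟩ := h.exists_sub (sInf F) fun a x hx => by
    rw [Submodule.mem_sInf] at hx ⊢
    intro N hN
    have hxN := hx N hN
    obtain ⟨Q, q, -, -, rfl⟩ := hN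
    rw [LinearMap.mem_ker] at hxN ⊢
    rw [lin_act, hxN, map_zero]
  have hjm := h.mono_of_injective hj
  have hj0 {Q : R} (q : V ⟶ Q) [Epi q] (hQ : S.serre T Q) : j ≫ q = 0 := by
    refine h.lin_eq_zero_iff.1 (LinearMap.ext fun y => ?_)
    rw [lin_comp_apply]
    exact SetLike.le_def.1 (sInf_le ⟨Q, q, inferInstance, hQ, rfl⟩ : sInf F ≤ _)
      (hr ▸ LinearMap.mem_range_self (lin U j) y)
  refine ⟨cokernel j, cokernel.π j, inferInstance, fun b hb => ?_, fun {W} g hW => ?_⟩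
  · by_contra hbT
    obtain ⟨i, hi⟩ := h.exists_weight_pos (S := S) b
    let M : Set ℕ := {n | ∃ (Q : R) (q : V ⟶ Q), Epi q ∧ S.serre T Q ∧
      weight U i V - weight U i Q = n}
    have hM : M.Nonempty := by
      obtain ⟨z, hz⟩ : ∃ z : R, IsZero z := ⟨_, isZero_zero R⟩
      exact ⟨_, z, 0, ⟨fun _ _ _ => hz.eq_of_src _ _⟩, (S.serre T).prop_of_isZero hz, rfl⟩
    obtain ⟨Q₁, q₁, hq₁, hQ₁, hmin⟩ := Nat.sInf_mem hM
    -- Dually, Q₁ has largest weight at `i` among the quotients in the class. The image of `V` in Q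
    -- ⊞ Q₁ has no larger weight, so e_i of the kernel of q₁ lies in every kernel of the family.
    have key : ∀ v, lin U q₁ v = 0 → (U.obj V).act (A.e i) v ∈ sInf F := by
      intro v hv
      rw [Submodule.mem_sInf]
      rintro _ ⟨Q, q, hq, hQ, rfl⟩
      let Q₂ := Abelian.image (biprod.lift q q₁)
      let π : V ⟶ Q₂ := Abelian.factorThruImage (biprod.lift q q₁)
      let ι := Abelian.image.ι (biprod.lift q q₁)
      have hQ₂ : S.serre T Q₂ := (S.serre T).prop_of_mono ι ((S.serre T).prop_biprod hQ hQ₁)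
      have hl₁ : π ≫ ι ≫ biprod.snd = q₁ := by
        rw [← Category.assoc, Abelian.image.fac, biprod.lift_snd]
      have hl : π ≫ ι ≫ biprod.fst = q := by
        rw [← Category.assoc, Abelian.image.fac, biprod.lift_fst]
      have : Epi (ι ≫ biprod.snd) := epi_of_epi_fac hl₁
      have hle : weight U i Q₂ ≤ weight U i Q₁ := by
        have h1 := hmin.le.trans (Nat.sInf_le ⟨Q₂, π, inferInstance, hQ₂, rfl⟩)
        have h2 := (h.weight_additive i).le_of_epi π
        have h3 := (h.weight_additive i).le_of_epi q₁
        omega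
      have h0 := h.act_mem_ker_of_weight_le (ι ≫ biprod.snd) hle (x := lin U π v) (by
        rw [← lin_comp_apply, hl₁, hv])
      have h0' := congr_arg (lin U (ι ≫ biprod.fst)) h0
      rwa [← lin_act, ← lin_comp_apply, hl, map_zero] at h0'
    obtain ⟨t, ht⟩ := (shortExact_cokernel j).exists_desc q₁ (hj0 q₁ hQ₁)
    have hte : Epi t := epi_of_epi_fac ht
    have h0 : weight U i (kernel t) = 0 := h.weight_eq_zero_iff.2 fun z => by
      apply h.injective_of_mono (kernel.ι t)
      obtain ⟨v, hv⟩ := h.surjective_of_epi (cokernel.π j) (lin U (kernel.ι t) z)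
      obtain ⟨y, hy⟩ := hr.ge (key v (by
        rw [← ht, lin_comp_apply, hv, ← lin_comp_apply, kernel.condition, h.lin_zero,
          LinearMap.zero_apply]))
      rw [lin_act, ← hv, ← lin_act, ← hy, ← lin_comp_apply, cokernel.condition, h.lin_zero,
        LinearMap.zero_apply, map_zero]
    exact (S.serre {c | c ≠ b}).prop_X₂_of_shortExact (shortExact_kernel t)
      (h.serre_of_weight_eq_zero hi h0)
      (S.serre_mono (fun c hc (hcb : c = b) => hbT (hcb ▸ hc)) hQ₁) b hb rfl
  · refine (shortExact_cokernel j).exists_desc g ?_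
    rw [← Abelian.image.fac g, ← Category.assoc, hj0 _ ((S.serre T).prop_of_mono
      (Abelian.image.ι g) hW), zero_comp]

lemma isFinitary (hm : ∀ lam, ∃ D : R → ℕ, IsAdditiveMeasure D ∧
    ∀ c, lam ≤ S.ρ c → 0 < D (S.L c)) : S.IsFinitary where
  measure := hm
  exists_subquotient hV := by
    obtain ⟨X, hX, hXV⟩ := h.hasWeights.exists_simple_subquotient hV
    obtain ⟨b, ⟨e⟩⟩ := S.exhaustive X hX
    exact ⟨b, IsSubquotient.trans ⟨X, 𝟙 X, e.hom, inferInstance, inferInstance⟩ hXV⟩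
  cover b := have := S.simple b; h.hasWeights.exists_cover (S.L b)
  hull b := have := S.simple b; h.hasWeights.exists_hull (S.L b)
  largest_sub := h.exists_largest_sub
  largest_quotient := h.exists_largest_quotient

end IsModuleRealization

/-- The measure is the total dimension in the essentially finite case. In the Schurian case upper
finiteness and finite fibers leave only finitely many `c` with lam ≤ ρ c; one weight nonvanishing on
L(c) is chosen for each, and these are summed. -/
theorem Stratification.isFinitary (k : Type w) [Field k] {R : Type u} [Category.{v} R] [Abelian R]
    {B : Type uB} {Λ : Type uL} [PartialOrder Λ] (S : Stratification R B Λ)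
    (hR : IsEssentiallyFiniteAbelian k R ∨
      (IsSchurian k R ∧ ∀ lam : Λ, (Set.Ici lam).Finite)) : S.IsFinitary := by
  rcases hR with ⟨A, hA, ⟨e⟩⟩ | ⟨⟨A, hA, ⟨e⟩⟩, hfin⟩
  · have h := isModuleRealization_of_isFd hA e
    have hf : ∀ X, Module.Finite k ((e.functor ⋙ A.isFd.ι).obj X).carrier :=
      fun X => (e.functor.obj X).property
    refine h.isFinitary fun lam => ⟨_, h.finrank_additive, fun c _ => ?_⟩
    obtain ⟨i, hi⟩ := h.exists_weight_pos (S := S) c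
    exact hi.trans_le (Submodule.finrank_le _)
  · have h := isModuleRealization_of_isLfd hA e
    refine h.isFinitary fun lam => ?_
    choose i hi using fun c => h.exists_weight_pos (S := S) c
    have hF : (S.ρ ⁻¹' Set.Ici lam).Finite := by
      rw [← Set.biUnion_preimage_singleton]
      exact (hfin lam).biUnion fun mu _ => S.finite_fibers mu
    refine ⟨fun X => ∑ c ∈ hF.toFinset, weight (e.functor ⋙ A.isLfd.ι) (i c) X,
      fun E hE => ?_, fun c hc => ?_⟩
    · rw [← Finset.sum_add_distrib]
      exact Finset.sum_congr rfl fun c _ => h.weight_additive (i c) hE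
    · exact (hi c).trans_le (Finset.single_le_sum
        (f := fun d => weight (e.functor ⋙ A.isLfd.ι) (i d) (S.L c)) (fun _ _ => Nat.zero_le _)
        (hF.mem_toFinset.2 hc))

end Finitary

theorem theorem2 (k : Type w) [Field k] [IsAlgClosed k]
    {R : Type u} [Category.{v} R] [Abelian R]
    {B : Type uB} {Λ : Type uL} [PartialOrder Λ]
    (S : Stratification R B Λ) (ε : Λ → ℤˣ)
    (hR : IsEssentiallyFiniteAbelian k R ∨
      (IsSchurian k R ∧ ∀ lam : Λ, (Set.Ici lam).Finite)) :
    (∀ lam, (S.j lam).IsRightAdjoint ∧ (S.j lam).IsLeftAdjoint) ∧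
    [S.HatPDelta ε, S.HatINabla ε, S.PDelta ε, S.INabla ε].TFAE ∧
    (S.IsEpsStratified ε → ∀ lam,
      (ε lam = -1 → ∀ F : S.Stratum lam ⥤ S.Le lam, Nonempty (F ⊣ S.j lam) →
        exactFunctor _ _ F) ∧
      (ε lam = 1 → ∀ G : S.Stratum lam ⥤ S.Le lam, Nonempty (S.j lam ⊣ G) →
        exactFunctor _ _ G)) ∧
    (S.IsEpsStratified ε ↔ S.op.IsEpsStratified (-ε)) ∧
    (S.IsEpsHighestWeight ε ↔ S.op.IsEpsHighestWeight (-ε)) := by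
  have h : S.IsFinitary := Stratification.isFinitary k S hR
  refine ⟨fun lam => ⟨Stratification.isRightAdjoint_j h lam, Stratification.isLeftAdjoint_j h lam⟩,
    Stratification.tfae h,
    fun H lam => Stratification.exactFunctor_of_isEpsStratified h H lam,
    Stratification.isEpsStratified_op_iff h,
    and_congr Iff.rfl (Stratification.isEpsStratified_op_iff h)⟩
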